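/- Let $d\ge 1$, let $\mathcal H,\mathfrak H$ be complex Hilbert spaces, $\Pi:\mathcal H\to L^2(\mathbb R^d,\mathfrak H)$ a unitary, and write $\phi_P$ for the components of $\Pi\phi$. Let $U(k)$ be the unitary with $(U(k)\phi)_P=\phi_{P+k}$, and let $H=\Pi^*\big(\int^\oplus_{\mathbb R^d}dP\,H(P)\big)\Pi$ be self-adjoint, where $H(P)$, $P\in\mathbb R^d$, are positive (i.e. nonnegative), possibly unbounded, self-adjoint operators on $\mathfrak H$. Put $E(P)=\inf\mathrm{spec}\,H(P)$. Assume: 0. For every $P_0$ and $\xi\notin\mathrm{spec}\,H(P_0)$ there is a neighbourhood $N$ of $P_0$ such that $\xi\notin\mathrm{spec}\,H(P)$ for $P\in N$ and $N\ni P\mapsto (H(P)-\xi)^{-1}$ is real analytic. 1. $E(P)=E_{\mathrm r}(|P|)$ is rotation invariant; its set of global minima is the union of the spheres $M_\ell=\{|P|=Q_\ell\}$, $\ell=0,\dots,L$, with $0\le Q_0<Q_1<\dots<Q_L$, and $E_{\mathrm r}(Q_\ell)=0$. Moreover $\liminf_{|P|\to\infty}E(P)>0$. 2. There are neighbourhoods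 $\Delta_\ell$ of $Q_\ell$ such that $E$ is real analytic on $\tilde M_\ell=\{|P|\in\Delta_\ell\}$, and there are integers $n_\ell\ge 2$ and constants $a_\ell\ne 0$ with $E_{\mathrm r}(Q_\ell+R)=a_\ell R^{n_\ell}(1+o(1))$ as $R\to 0$, $Q_\ell+R\ge 0$. 3. For $P\in\tilde M_\ell$, $E(P)$ is a simple eigenvalue of $H(P)$ with normalized eigenvector $\psi_P$, and $\tilde M_\ell\ni P\mapsto|\psi_P\rangle\langle\psi_P|$ is strongly continuous. Call $\phi\in\mathcal H$, together with a choice of its components $\phi_P$, admissible if for every $\ell$ the function $P\mapsto|\langle\phi_P,\psi_P\rangle|$ is continuous on $\tilde M_\ell$ and non-zero on $M_\ell$, and if at every $P_*\in M_\ell$ either $P\mapsto\phi_P$ is norm continuous at $P_*$ or $E(P_*)$ is an isolated point of $\mathrm{spec}\,H(P_*)$. For such $\phi$, $k\in\mathbb R^d$ and $t,T\ge 0$ let $$\tilde G_T(k,t)=\langle\phi,e^{-TH}U(k)e^{-tH}U(k)^*e^{-TH}\phi\rangle,\qquad G_T(k,t)=\tilde G_T(k,t)/\tilde G_T(0,t).$$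 For $q\ge 0$, with $d\Omega$ the surface measure of the unit sphere (the counting measure on $\{-1,1\}$ if $d=1$), write $$N_q(k,t)=\int d\Omega(u)\,|\langle\phi_{qu},\psi_{qu}\rangle|^2\langle\psi_{qu},e^{-tH(qu+k)}\psi_{qu}\rangle,\qquad D_q=\int d\Omega(u)\,|\langle\phi_{qu},\psi_{qu}\rangle|^2 .$$ Then the following holds, for all admissible $\phi$, all $k\in\mathbb R^d$ and all $t\ge 0$; the positive constants $C_\ell$, $c_\ell$ below do not depend on $\phi$, $k$ and $t$. 1. If $Q_0=0$ and $L=0$, then $\lim_{T\to\infty}G_T(k,t)=\langle\psi_0,e^{-tH(k)}\psi_0\rangle$. 2. If $Q_0=0$ and $L\ge 1$, put $n=\max_{\ell\ne 0}n_\ell$. (a) If $n>n_0/d$, there are constants $C_\ell>0$ such that $$\lim_{T\to\infty}G_T(k,t)=\frac{\sum_\ell C_\ell N_{Q_\ell}(k,t)}{\sum_\ell C_\ell D_{Q_\ell}},$$ the sums being over those $\ell>0$ with $n_\ell=n$. (b) If $n=n_0/d$, there are constants $c_0,c_\ell>0$ such that $$\lim_{T\to\infty}G_T(k,t)=\frac{c_0|\langle\phi_0,\psi_0\rangle|^2\langle\psi_0,e^{-tH(k)}\psi_0\rangle+\sum_\ell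 c_\ell N_{Q_\ell}(k,t)}{c_0|\langle\phi_0,\psi_0\rangle|^2+\sum_\ell c_\ell D_{Q_\ell}},$$ the sums being over those $\ell>0$ with $n_\ell=n$. (c) If $n<n_0/d$, then $\lim_{T\to\infty}G_T(k,t)=\langle\psi_0,e^{-tH(k)}\psi_0\rangle$. 3. If $Q_0>0$ (and $L\ge 0$), there are constants $C_\ell>0$ such that $$\lim_{T\to\infty}G_T(k,t)=\frac{\sum_\ell C_\ell N_{Q_\ell}(k,t)}{\sum_\ell C_\ell D_{Q_\ell}},$$ the sums being over those $\ell$ with $n_\ell=\max_{\ell'}n_{\ell'}$. -/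

import Mathlib

open MeasureTheory Filter Topology

noncomputable section

/-- The momentum space `ℝ^d`. -/
abbrev Mom (d : ℕ) : Type := EuclideanSpace ℝ (Fin d)

section UnboundedOperators

variable {F : Type*} [NormedAddCommGroup F] [InnerProductSpace ℂ F] [CompleteSpace F]

/-- `R` is the bounded, everywhere defined inverse of `A - ξ`:
`R y = x` holds exactly when `x ∈ D(A)` and `A x - ξ x = y`. -/
def IsResolventOf (A : F →ₗ.[ℂ] F) (ξ : ℂ) (R : F →L[ℂ] F) : Prop :=
  ∀ x y : F, R y = x ↔ (x, y + ξ • x) ∈ A.graph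

/-- The spectrum of an unbounded operator. -/
def opSpectrum (A : F →ₗ.[ℂ] F) : Set ℂ :=
  {ξ | ¬ ∃ R : F →L[ℂ] F, IsResolventOf A ξ R}

open Classical in
/-- The resolvent `(A - ξ)⁻¹`; it is set to `0` for `ξ` in the spectrum. -/
def opResolvent (A : F →ₗ.[ℂ] F) (ξ : ℂ) : F →L[ℂ] F :=
  if h : ∃ R : F →L[ℂ] F, IsResolventOf A ξ R then h.choose else 0

/-- The infimum of the (real) spectrum of a self-adjoint operator. -/
def infSpec (A : F →ₗ.[ℂ] F) : ℝ := sInf {x : ℝ | (x : ℂ) ∈ opSpectrum A}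

/-- Positive (that is, nonnegative) self-adjoint operators, possibly unbounded. -/
structure IsPositiveSelfAdjoint (A : F →ₗ.[ℂ] F) : Prop where
  selfAdjoint : IsSelfAdjoint A
  nonneg : ∀ x : A.domain, 0 ≤ (inner ℂ (A x) (x : F)).re

/-- The function with `r ↦ exp (-t λ)` for `r = (λ + 1)⁻¹`, `λ ≥ 0`, and `0 ↦ 0`
(the value at `λ = ∞`). For `t > 0` it is continuous on `[0, 1]`. -/
def expNegFun (t r : ℝ) : ℝ := if 0 < r then Real.exp (-t * (r⁻¹ - 1)) else 0

open Classical in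
/-- `exp (-t A)` for a positive self-adjoint operator `A` and `t ≥ 0`, through the functional
calculus: `A = R⁻¹ - 1` with `R = (A + 1)⁻¹`, a bounded self-adjoint operator with spectrum
in `[0, 1]`, so that `exp (-t A)` is the function `expNegFun t` of `R`. -/
def expNeg (A : F →ₗ.[ℂ] F) (t : ℝ) : F →L[ℂ] F :=
  if t = 0 then 1 else cfc (expNegFun t) (opResolvent A (-1))

end UnboundedOperators

section Fibers

variable {d : ℕ} {F : Type*} [NormedAddCommGroup F] [InnerProductSpace ℂ F] [CompleteSpace F]
variable {K : Type*} [NormedAddCommGroup K] [InnerProductSpace ℂ K] [CompleteSpace K]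

/-- `H` is the operator `Π* (∫^⊕ dP H(P)) Π`: `f` is in the domain of `H` with `H f = g` iff for
almost every `P` the vector `f_P` is in the domain of `H(P)` and `H(P) f_P = g_P`, where `f_P` and
`g_P` are the components of `Π f` and `Π g`. -/
def IsDirectIntegral (Pi : K ≃ₗᵢ[ℂ] Lp F 2 (volume : Measure (Mom d)))
    (H : K →ₗ.[ℂ] K) (Hf : Mom d → F →ₗ.[ℂ] F) : Prop :=
  ∀ f g : K, (f, g) ∈ H.graph ↔ ∀ᵐ P : Mom d, (Pi f P, Pi g P) ∈ (Hf P).graph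

/-- The unitary `U(k)` with `(U(k) f)_P = f_{P + k}`. -/
def shiftU (Pi : K ≃ₗᵢ[ℂ] Lp F 2 (volume : Measure (Mom d))) (k : Mom d) : K →L[ℂ] K :=
  (Pi.symm.toLinearIsometry.comp
    ((Lp.compMeasurePreservingₗᵢ ℂ (fun P : Mom d => P + k)
      (measurePreserving_add_right volume k)).comp Pi.toLinearIsometry)).toContinuousLinearMap

/-- `⟨φ, e^{-TH} U(k) e^{-tH} U(k)^* e^{-TH} φ⟩`. -/
def charFunUnnormalized (Pi : K ≃ₗᵢ[ℂ] Lp F 2 (volume : Measure (Mom d)))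
    (H : K →ₗ.[ℂ] K) (φ : K) (T : ℝ) (k : Mom d) (t : ℝ) : ℂ :=
  inner ℂ φ (expNeg H T (shiftU Pi k (expNeg H t
    (ContinuousLinearMap.adjoint (shiftU Pi k) (expNeg H T φ)))))

/-- The normalized two-sided characteristic function `G_T(k, t)`. -/
def charFunNormalized (Pi : K ≃ₗᵢ[ℂ] Lp F 2 (volume : Measure (Mom d)))
    (H : K →ₗ.[ℂ] K) (φ : K) (T : ℝ) (k : Mom d) (t : ℝ) : ℂ :=
  charFunUnnormalized Pi H φ T k t / charFunUnnormalized Pi H φ T 0 t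

/-- The assumptions on the family `P ↦ H(P)`. The global minima of `E(P) = inf spec H(P)` are the
spheres of radii `Q 0 < ... < Q L`, `Er` is the radial profile of `E`, `n ℓ` is the order of
vanishing of `E` at the `ℓ`-th sphere, `Δ ℓ` is a neighbourhood of `Q ℓ`, and `ψ P` is a normalized
ground state of `H(P)` for `|P| ∈ Δ ℓ`. -/
structure StandingAssumptions (Hf : Mom d → F →ₗ.[ℂ] F) (Er : ℝ → ℝ) {L : ℕ}
    (Q : Fin (L + 1) → ℝ) (n : Fin (L + 1) → ℕ) (Δ : Fin (L + 1) → Set ℝ)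
    (ψ : Mom d → F) : Prop where
  positive : ∀ P, IsPositiveSelfAdjoint (Hf P)
  analytic_family : ∀ (P₀ : Mom d) (ξ : ℂ), ξ ∉ opSpectrum (Hf P₀) →
    ∃ N ∈ 𝓝 P₀, (∀ P ∈ N, ξ ∉ opSpectrum (Hf P)) ∧
      AnalyticOnNhd ℝ (fun P => opResolvent (Hf P) ξ) N
  radial : ∀ P, infSpec (Hf P) = Er ‖P‖
  Q_nonneg : 0 ≤ Q 0
  Q_strictMono : StrictMono Q
  minima : ∀ P, (∀ P', infSpec (Hf P) ≤ infSpec (Hf P')) ↔ ∃ ℓ, ‖P‖ = Q ℓ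
  Er_Q : ∀ ℓ, Er (Q ℓ) = 0
  /-- `E` does not approach its minimal value `0` at infinity. -/
  positive_at_infinity : ∃ δ > (0 : ℝ), ∃ R : ℝ, ∀ P, R ≤ ‖P‖ → δ ≤ infSpec (Hf P)
  Δ_nhds : ∀ ℓ, Δ ℓ ∈ 𝓝 (Q ℓ)
  analytic_E : ∀ ℓ, AnalyticOnNhd ℝ (fun P => infSpec (Hf P)) {P | ‖P‖ ∈ Δ ℓ}
  two_le_n : ∀ ℓ, 2 ≤ n ℓ
  order : ∀ ℓ, ∃ a : ℝ, a ≠ 0 ∧ Asymptotics.IsEquivalent (𝓝[{R | 0 ≤ Q ℓ + R}] 0)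
    (fun R => Er (Q ℓ + R)) (fun R => a * R ^ n ℓ)
  ψ_norm : ∀ ℓ P, ‖P‖ ∈ Δ ℓ → ‖ψ P‖ = 1
  ψ_eigenvector : ∀ ℓ P, ‖P‖ ∈ Δ ℓ → (ψ P, (infSpec (Hf P) : ℂ) • ψ P) ∈ (Hf P).graph
  simple : ∀ ℓ P, ‖P‖ ∈ Δ ℓ → ∀ x : F, (x, (infSpec (Hf P) : ℂ) • x) ∈ (Hf P).graph →
    ∃ c : ℂ, x = c • ψ P
  projection_continuous : ∀ ℓ, ∀ x : F,
    ContinuousOn (fun P => (inner ℂ (ψ P) x : ℂ) • ψ P) {P | ‖P‖ ∈ Δ ℓ}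

/-- The assumptions on the boundary vector `φ`, whose fiber components are `Φ P = φ_P`. -/
structure AdmissibleVector (Pi : K ≃ₗᵢ[ℂ] Lp F 2 (volume : Measure (Mom d)))
    (Hf : Mom d → F →ₗ.[ℂ] F) {L : ℕ} (Q : Fin (L + 1) → ℝ) (Δ : Fin (L + 1) → Set ℝ)
    (ψ : Mom d → F) (φ : K) (Φ : Mom d → F) : Prop where
  components : ∀ᵐ P : Mom d, Pi φ P = Φ P
  overlap_continuous : ∀ ℓ, ContinuousOn (fun P => ‖(inner ℂ (Φ P) (ψ P) : ℂ)‖) {P | ‖P‖ ∈ Δ ℓ}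
  overlap_ne_zero : ∀ ℓ P, ‖P‖ = Q ℓ → (inner ℂ (Φ P) (ψ P) : ℂ) ≠ 0
  /-- At each global minimum, `P ↦ φ_P` is continuous or the ground state energy is isolated. -/
  continuous_or_isolated : ∀ ℓ P, ‖P‖ = Q ℓ →
    ContinuousAt Φ P ∨
    ∃ g > (0 : ℝ), ∀ x : ℝ, (x : ℂ) ∈ opSpectrum (Hf P) →
      x = infSpec (Hf P) ∨ infSpec (Hf P) + g ≤ x

/-- `⟨ψ_P, e^{-t H(P + k)} ψ_P⟩`. -/
def groundExpectation (Hf : Mom d → F →ₗ.[ℂ] F) (ψ : Mom d → F) (P k : Mom d) (t : ℝ) : ℂ :=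
  inner ℂ (ψ P) (expNeg (Hf (P + k)) t (ψ P))

/-- `∫ dΩ(u) |⟨φ_{qu}, ψ_{qu}⟩|² ⟨ψ_{qu}, e^{-t H(qu + k)} ψ_{qu}⟩` over the unit sphere; in
dimension one `dΩ` is the counting measure on `{-1, 1}`. -/
def sphereNumerator (Hf : Mom d → F →ₗ.[ℂ] F) (ψ Φ : Mom d → F) (q : ℝ) (k : Mom d) (t : ℝ) : ℂ :=
  ∫ u : Metric.sphere (0 : Mom d) 1,
    ((‖(inner ℂ (Φ (q • (u : Mom d))) (ψ (q • (u : Mom d))) : ℂ)‖ ^ 2 : ℝ) : ℂ) *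
      groundExpectation Hf ψ (q • (u : Mom d)) k t ∂((volume : Measure (Mom d)).toSphere)

/-- `∫ dΩ(u) |⟨φ_{qu}, ψ_{qu}⟩|²` over the unit sphere. -/
def sphereDenominator (ψ Φ : Mom d → F) (q : ℝ) : ℝ :=
  ∫ u : Metric.sphere (0 : Mom d) 1,
    ‖(inner ℂ (Φ (q • (u : Mom d))) (ψ (q • (u : Mom d))) : ℂ)‖ ^ 2
      ∂((volume : Measure (Mom d)).toSphere)

/-- The average over the spheres with label in `S`, with weights `C ℓ`. -/
def sphereAverage (Hf : Mom d → F →ₗ.[ℂ] F) (ψ Φ : Mom d → F) {L : ℕ} (Q : Fin (L + 1) → ℝ)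
    (C : Fin (L + 1) → ℝ) (S : Finset (Fin (L + 1))) (k : Mom d) (t : ℝ) : ℂ :=
  (∑ ℓ ∈ S, (C ℓ : ℂ) * sphereNumerator Hf ψ Φ (Q ℓ) k t) /
    ((∑ ℓ ∈ S, C ℓ * sphereDenominator ψ Φ (Q ℓ) : ℝ) : ℂ)

/-- The average over the point `0`, with weight `c 0`, and the spheres with label in `S`, with
weights `c ℓ`. -/
def originSphereAverage (Hf : Mom d → F →ₗ.[ℂ] F) (ψ Φ : Mom d → F) {L : ℕ}
    (Q : Fin (L + 1) → ℝ) (c : Fin (L + 1) → ℝ) (S : Finset (Fin (L + 1))) (k : Mom d) (t : ℝ) :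
    ℂ :=
  (((c 0 * ‖(inner ℂ (Φ 0) (ψ 0) : ℂ)‖ ^ 2 : ℝ) : ℂ) * groundExpectation Hf ψ 0 k t +
      ∑ ℓ ∈ S, (c ℓ : ℂ) * sphereNumerator Hf ψ Φ (Q ℓ) k t) /
    ((c 0 * ‖(inner ℂ (Φ 0) (ψ 0) : ℂ)‖ ^ 2 +
      ∑ ℓ ∈ S, c ℓ * sphereDenominator ψ Φ (Q ℓ) : ℝ) : ℂ)

end Fibers

end

/-!
In momentum space the numerator of `G_T` is

`∫ ⟨exp (-T H(P)) φ_P, exp (-t H(P + k)) exp (-T H(P)) φ_P⟩ dP`.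

As `T → ∞` the factor `exp (-T H(P))` is of size `exp (-T E(P))`, so only thin shells around the
spheres of minima matter, and there `exp (-T (H(P) - E(P)))` tends to the projection onto the ground
state `ψ_P`. A shell around the `ℓ`-th sphere thus contributes the radial integral of
`exp (-2 T E)` times the spherical integral `N_{Q_ℓ}(k, t)`. By Laplace's method the radial integral
is asymptotic to a constant times `T ^ (-1 / n_ℓ)` if `Q_ℓ > 0` and, because of the volume element
`r ^ (d - 1)`, to a constant times `T ^ (-d / n_ℓ)` if `Q_ℓ = 0`. The quotient `G_T` converges to
the average over the shells of slowest decay; the weights depend on the radial profile of `E`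
only.

Unbounded operators enter only through the resolvent `R = (H + 1)⁻¹`, a positive contraction:
`exp (-t H)` is by definition a function of `R`, and `inf spec H = ‖R‖⁻¹ - 1`
(`IsPositiveSelfAdjoint.infSpec_eq`). The momentum space formula
(`IsDirectIntegral.integrable_and_charFunUnnormalized_eq`) holds because bounded continuous families
of operators form a C⋆-algebra on which both the evaluations at the momenta and the direct integral
are C⋆-homomorphisms; such homomorphisms commute with the continuous functional calculus. The same
argument shows that `exp (-t H(P))` is norm continuous in `P`.

The local statement is `IsLocalGroundState.eventually_norm_fiberIntegrand_sub_le`. If `φ_P` is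
continuous at the minimum, it follows from the strong decay of `exp (-T (H(P) - E(P)))` on the
orthogonal complement of the ground state at the minimum, which a contraction semigroup transfers
from one time to all later ones and continuity transfers to nearby momenta. If the ground state
energy is isolated, the spectral gap persists nearby and the decay is exponential in operator norm.
Compactness of the spheres makes the estimate uniform in a shell, and away from the shells `E` is
bounded below by a positive constant, so that the remainder is exponentially small
(`StandingAssumptions.norm_charFunUnnormalized_sub_sum_le`). Laplace's method is
`exists_tendsto_shell`, by rescaling and dominated convergence.
-/

/-! ### Functional calculus -/

lemma expNegFun_nonneg (t r : ℝ) : 0 ≤ expNegFun t r := by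
  unfold expNegFun; split_ifs <;> positivity

lemma expNegFun_of_pos {r : ℝ} (hr : 0 < r) (t : ℝ) :
    expNegFun t r = Real.exp (-t * (r⁻¹ - 1)) := if_pos hr

lemma expNegFun_add (s t r : ℝ) : expNegFun (s + t) r = expNegFun s r * expNegFun t r := by
  unfold expNegFun
  split_ifs
  · rw [← Real.exp_add]; ring_nf
  · simp

lemma expNegFun_mono {t : ℝ} (ht : 0 ≤ t) : Monotone (expNegFun t) := by
  intro r s hrs
  by_cases hr : 0 < r
  · have hs := hr.trans_le hrs
    rw [expNegFun_of_pos hr, expNegFun_of_pos hs, Real.exp_le_exp]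
    have := inv_anti₀ hr hrs
    nlinarith
  · unfold expNegFun
    rw [if_neg hr]
    split_ifs <;> positivity

lemma continuous_expNegFun {t : ℝ} (ht : 0 < t) : Continuous (expNegFun t) := by
  rw [continuous_iff_continuousAt]
  intro r
  rcases lt_trichotomy r 0 with hr | rfl | hr
  · have : expNegFun t =ᶠ[𝓝 r] fun _ => 0 := by
      filter_upwards [gt_mem_nhds hr] with s hs
      exact if_neg (not_lt.2 hs.le)
    exact (continuousAt_const).congr this.symm
  · rw [ContinuousAt, ← nhdsLE_sup_nhdsGT, tendsto_sup]
    have h0 : expNegFun t 0 = 0 := if_neg (lt_irrefl _)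
    rw [h0]
    constructor
    · refine tendsto_const_nhds.congr' ?_
      filter_upwards [self_mem_nhdsWithin] with s hs
      exact (if_neg (not_lt.2 hs)).symm
    · have h1 : Tendsto (fun s : ℝ => Real.exp (-t * (s⁻¹ - 1))) (𝓝[>] 0) (𝓝 0) := by
        refine Real.tendsto_exp_atBot.comp ?_
        refine Tendsto.const_mul_atTop_of_neg (by linarith) ?_
        exact tendsto_atTop_add_const_right _ _ tendsto_inv_nhdsGT_zero
      refine h1.congr' ?_
      filter_upwards [self_mem_nhdsWithin] with s hs
      exact (if_pos hs).symm
  · have : expNegFun t =ᶠ[𝓝 r] fun s => Real.exp (-t * (s⁻¹ - 1)) := by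
      filter_upwards [lt_mem_nhds hr] with s hs
      exact if_pos hs
    refine ContinuousAt.congr ?_ this.symm
    have : ContinuousAt (fun s : ℝ => s⁻¹) r := continuousAt_inv₀ hr.ne'
    fun_prop

section Cfc

variable {𝒜 : Type*} [CStarAlgebra 𝒜]

/-- The continuous functional calculus respects intertwining relations; this follows from the
case of polynomials by the Weierstrass theorem. -/
lemma cfc_mul_eq_mul_cfc {a b w : 𝒜} (ha : IsSelfAdjoint a) (hb : IsSelfAdjoint b)
    (h : a * w = w * b) {f : ℝ → ℝ} (hf : Continuous f) : cfc f a * w = w * cfc f b := by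
  have hpoly (p : Polynomial ℝ) :
      Polynomial.aeval a p * w = w * Polynomial.aeval b p := by
    induction p using Polynomial.induction_on' with
    | add p q hp hq => simp [add_mul, mul_add, hp, hq]
    | monomial k c =>
      have hk : a ^ k * w = w * b ^ k := (show SemiconjBy w b a from h.symm).pow_right k |>.symm
      simp only [Polynomial.aeval_monomial, ← Algebra.smul_def, smul_mul_assoc, mul_smul_comm, hk]
  set M : ℝ := max (‖a‖ * ‖(1 : 𝒜)‖) (‖b‖ * ‖(1 : 𝒜)‖) with hM
  have haM : ∀ x ∈ spectrum ℝ a, x ∈ Set.Icc (-M) M := fun x hx =>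
    abs_le.1 (((by simpa using spectrum.subset_closedBall_norm_mul a hx)
      : |x| ≤ ‖a‖ * ‖(1 : 𝒜)‖).trans (le_max_left _ _))
  have hbM : ∀ x ∈ spectrum ℝ b, x ∈ Set.Icc (-M) M := fun x hx =>
    abs_le.1 (((by simpa using spectrum.subset_closedBall_norm_mul b hx)
      : |x| ≤ ‖b‖ * ‖(1 : 𝒜)‖).trans (le_max_right _ _))
  rw [← sub_eq_zero, ← norm_le_zero_iff]
  refine le_of_forall_pos_le_add fun ε hε => ?_
  set η : ℝ := ε / (2 * (‖w‖ + 1)) with hη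
  have hηpos : 0 < η := by positivity
  obtain ⟨p, hp⟩ := exists_polynomial_near_of_continuousOn (-M) M f hf.continuousOn η hηpos
  have key {c : 𝒜} (hc : IsSelfAdjoint c) (hcM : ∀ x ∈ spectrum ℝ c, x ∈ Set.Icc (-M) M) :
      ‖cfc f c - Polynomial.aeval c p‖ ≤ η := by
    rw [← cfc_polynomial (R := ℝ) p c hc, ← cfc_sub f p.eval c hf.continuousOn
      p.continuous.continuousOn]
    refine norm_cfc_le hηpos.le fun x hx => ?_
    rw [← norm_neg, neg_sub]
    exact (hp x (hcM x hx)).le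
  have e : cfc f a * w - w * cfc f b =
      (cfc f a - Polynomial.aeval a p) * w - w * (cfc f b - Polynomial.aeval b p) := by
    rw [sub_mul, mul_sub, hpoly]; abel
  rw [e, zero_add]
  calc _ ≤ η * ‖w‖ + ‖w‖ * η := by
        refine (norm_sub_le _ _).trans (add_le_add ((norm_mul_le _ _).trans ?_)
          ((norm_mul_le _ _).trans ?_))
        · gcongr; exact key ha haM
        · gcongr; exact key hb hbM
    _ ≤ ε := by
        have : ε = η * (2 * (‖w‖ + 1)) := by rw [hη]; field_simp
        rw [this]; nlinarith

end Cfc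

section BoundedOperators

variable {F : Type*} [NormedAddCommGroup F] [InnerProductSpace ℂ F] [CompleteSpace F]

lemma cfc_apply_eigenvector {A : F →L[ℂ] F} (hA : IsSelfAdjoint A) {x : F} {c : ℝ}
    (hx : A x = (c : ℂ) • x) {f : ℝ → ℝ} (hf : Continuous f) : cfc f A x = (f c : ℂ) • x := by
  rcases eq_or_ne x 0 with rfl | hx0
  · simp
  -- The rank one operator onto `x` intertwines `A` with the scalar `c`.
  set W : F →L[ℂ] F := InnerProductSpace.rankOne ℂ x x
  have hW : A * W = W * algebraMap ℝ (F →L[ℂ] F) c := by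
    ext y
    simp only [W, Algebra.algebraMap_eq_smul_one, mul_apply_eq_comp,
      InnerProductSpace.rankOne_apply, map_smul, hx, mul_smul_comm, mul_one, smul_apply,
      Complex.coe_smul]
    exact smul_comm _ _ _
  have h := cfc_mul_eq_mul_cfc hA (.algebraMap _ (.all c)) hW hf
  rw [cfc_algebraMap] at h
  have h2 := congrArg (fun B : F →L[ℂ] F => B x) h
  simp only [mul_apply_eq_comp, W, InnerProductSpace.rankOne_apply, map_smul,
    Algebra.algebraMap_eq_smul_one, mul_smul_comm, mul_one, smul_apply] at h2
  have h3 : (inner ℂ x x : ℂ) ≠ 0 := inner_self_ne_zero.2 hx0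
  have h4 : (inner ℂ x x : ℂ) • cfc f A x = (inner ℂ x x : ℂ) • ((f c : ℂ) • x) := by
    rw [h2, Complex.coe_smul]
    exact smul_comm _ _ _
  exact smul_right_injective _ h3 h4

lemma spectrum_subset_of_nonneg {A : F →L[ℂ] F} (hA : 0 ≤ A) {x : ℝ}
    (hx : x ∈ spectrum ℝ A) : x ∈ Set.Icc 0 ‖A‖ := by
  refine ⟨spectrum_nonneg_of_nonneg hA hx, ?_⟩
  rcases subsingleton_or_nontrivial F with h | h
  · simp at hx
  · exact (le_abs_self x).trans (spectrum.norm_le_norm_of_mem hx)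

/-! ### Semigroups of bounded positive operators -/

lemma norm_cfc_expNegFun_le {A : F →L[ℂ] F} (hA : 0 ≤ A) {c : ℝ} (hc : 0 < c) (hAc : ‖A‖ ≤ c)
    {t : ℝ} (ht : 0 ≤ t) : ‖cfc (expNegFun t) A‖ ≤ Real.exp (-t * (c⁻¹ - 1)) := by
  refine norm_cfc_le (Real.exp_pos _).le fun r hr => ?_
  rw [Real.norm_of_nonneg (expNegFun_nonneg _ _), ← expNegFun_of_pos hc]
  exact expNegFun_mono ht ((spectrum_subset_of_nonneg hA hr).2.trans hAc)

lemma cfc_expNegFun_add (A : F →L[ℂ] F) {s t : ℝ} (hs : 0 < s) (ht : 0 < t) :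
    cfc (expNegFun (s + t)) A = cfc (expNegFun s) A * cfc (expNegFun t) A := by
  rw [← cfc_mul _ _ A (continuous_expNegFun hs).continuousOn (continuous_expNegFun ht).continuousOn]
  congr 1
  ext r
  exact expNegFun_add s t r

/-- On the range of `A - c` the rescaled semigroup decays like `1 / t`. -/
lemma norm_cfc_expNegFun_mul_sub_le {A : F →L[ℂ] F} (hA : 0 ≤ A) {c : ℝ} (hc : 0 < c)
    (hc1 : c ≤ 1) (hAc : ‖A‖ ≤ c) {t : ℝ} (ht : 0 < t) :
    ‖cfc (expNegFun t) A * (A - (c : ℂ) • 1)‖ ≤ Real.exp (-t * (c⁻¹ - 1)) / t := by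
  have hsa : IsSelfAdjoint A := .of_nonneg hA
  have h1 : A - (c : ℂ) • 1 = cfc (fun r : ℝ => r - c) A := by
    rw [cfc_sub _ _ A, cfc_id' ℝ A, cfc_const c A, Algebra.algebraMap_eq_smul_one,
      Complex.coe_smul]
  rw [h1, ← cfc_mul _ _ A (continuous_expNegFun ht).continuousOn]
  refine norm_cfc_le (by positivity) fun r hr => ?_
  obtain ⟨hr0, hr1⟩ := spectrum_subset_of_nonneg hA hr
  have hrc := hr1.trans hAc
  rcases hr0.eq_or_lt with rfl | hr0
  · simp only [expNegFun, lt_irrefl, if_false, zero_mul, norm_zero]; positivity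
  rw [expNegFun_of_pos hr0, norm_mul, Real.norm_of_nonneg (Real.exp_pos _).le, Real.norm_eq_abs,
    abs_of_nonpos (by linarith), le_div_iff₀ ht]
  have h2 : c - r ≤ r⁻¹ - c⁻¹ := by
    rw [inv_sub_inv hr0.ne' hc.ne', le_div_iff₀ (by positivity)]
    have : r * c ≤ 1 := by nlinarith
    nlinarith
  have h3 : (c - r) * t ≤ Real.exp (t * (r⁻¹ - c⁻¹)) := by
    have := Real.add_one_le_exp (t * (r⁻¹ - c⁻¹))
    nlinarith
  calc Real.exp (-t * (r⁻¹ - 1)) * -(r - c) * t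
      = Real.exp (-t * (r⁻¹ - 1)) * ((c - r) * t) := by ring
    _ ≤ Real.exp (-t * (r⁻¹ - 1)) * Real.exp (t * (r⁻¹ - c⁻¹)) := by gcongr
    _ = Real.exp (-t * (c⁻¹ - 1)) := by rw [← Real.exp_add]; ring_nf

/-- The semigroup, rescaled by its norm, tends to zero strongly on the orthogonal complement of
the ground states. -/
lemma tendsto_exp_smul_cfc_expNegFun_apply {A : F →L[ℂ] F} (hA : 0 ≤ A) {c : ℝ} (hc : 0 < c)
    (hc1 : c ≤ 1) (hAc : ‖A‖ ≤ c) {y : F}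
    (hy : ∀ x : F, A x = (c : ℂ) • x → inner ℂ x y = 0) :
    Tendsto (fun t : ℝ => ‖((Real.exp (t * (c⁻¹ - 1)) : ℝ) : ℂ) • cfc (expNegFun t) A y‖)
      atTop (𝓝 0) := by
  have hsa : IsSelfAdjoint A := .of_nonneg hA
  set B : F →L[ℂ] F := A - (c : ℂ) • 1 with hB
  have hBsa : ContinuousLinearMap.adjoint B = B :=
    (hsa.sub (.smul (by simp [isSelfAdjoint_iff]) (.one _))).adjoint_eq
  -- `y` is orthogonal to the kernel of the self-adjoint operator `A - c`, so it is a limit of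
  -- vectors in its range, on which the decay is like `1 / t`.
  have hmem : y ∈ B.range.topologicalClosure := by
    rw [← Submodule.orthogonal_orthogonal_eq_closure, B.orthogonal_range, hBsa,
      Submodule.mem_orthogonal]
    intro x hx
    refine hy x ?_
    have : A x - (c : ℂ) • x = 0 := by simpa [hB] using hx
    exact sub_eq_zero.1 this
  rw [Metric.tendsto_atTop]
  intro ε hε
  obtain ⟨_, ⟨z, rfl⟩, hz⟩ := Metric.mem_closure_iff.1 hmem (ε / 2) (half_pos hε)
  refine ⟨max 1 (2 * (‖z‖ + 1) / ε), fun t ht => ?_⟩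
  have ht1 : 0 < t := lt_of_lt_of_le one_pos ((le_max_left _ _).trans ht)
  have hexp : Real.exp (t * (c⁻¹ - 1)) * Real.exp (-t * (c⁻¹ - 1)) = 1 := by
    rw [← Real.exp_add]; simp
  have h1 : ‖cfc (expNegFun t) A (y - B z)‖ ≤ Real.exp (-t * (c⁻¹ - 1)) * (ε / 2) :=
    (ContinuousLinearMap.le_opNorm _ _).trans (by
      gcongr
      · exact norm_cfc_expNegFun_le hA hc hAc ht1.le
      · rw [← dist_eq_norm]; exact hz.le)
  have h2 : ‖cfc (expNegFun t) A (B z)‖ ≤ Real.exp (-t * (c⁻¹ - 1)) / t * ‖z‖ :=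
    (ContinuousLinearMap.le_opNorm (cfc (expNegFun t) A * B) z).trans (by
      gcongr
      exact norm_cfc_expNegFun_mul_sub_le hA hc hc1 hAc ht1)
  have h3 : ‖cfc (expNegFun t) A y‖ ≤ Real.exp (-t * (c⁻¹ - 1)) * (ε / 2 + ‖z‖ / t) := by
    calc _ = ‖cfc (expNegFun t) A (y - B z) + cfc (expNegFun t) A (B z)‖ := by
          rw [← map_add, sub_add_cancel]
      _ ≤ _ := (norm_add_le _ _).trans (add_le_add h1 h2)
      _ = _ := by ring
  have h4 : ‖z‖ / t < ε / 2 := by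
    rw [div_lt_iff₀ ht1]
    have := (le_max_right _ _).trans ht
    rw [div_le_iff₀ hε] at this
    linarith
  rw [dist_zero_right, norm_norm, norm_smul, Complex.norm_real,
    Real.norm_of_nonneg (Real.exp_pos _).le]
  calc _ ≤ Real.exp (t * (c⁻¹ - 1)) * (Real.exp (-t * (c⁻¹ - 1)) * (ε / 2 + ‖z‖ / t)) := by gcongr
    _ = ε / 2 + ‖z‖ / t := by rw [← mul_assoc, hexp, one_mul]
    _ < ε := by linarith

/-- If the part of `A` orthogonal to an eigenvector is bounded by `b`, then so is the semigroup. -/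
lemma norm_cfc_expNegFun_mul_one_sub_le {A : F →L[ℂ] F} (hA : 0 ≤ A) {x : F} (hx : ‖x‖ = 1)
    {c : ℝ} (hAx : A x = (c : ℂ) • x) {b : ℝ} (hb : 0 < b)
    (hAb : ‖A - (c : ℂ) • InnerProductSpace.rankOne ℂ x x‖ ≤ b) {t : ℝ} (ht : 0 < t) :
    ‖cfc (expNegFun t) A * (1 - InnerProductSpace.rankOne ℂ x x)‖
      ≤ Real.exp (-t * (b⁻¹ - 1)) := by
  have hsa : IsSelfAdjoint A := .of_nonneg hA
  set p : F →L[ℂ] F := InnerProductSpace.rankOne ℂ x x with hp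
  have hpp : p * p = p := InnerProductSpace.isIdempotentElem_rankOne_self hx
  have hpsa : IsSelfAdjoint p := (InnerProductSpace.isStarProjection_rankOne_self hx).isSelfAdjoint
  have hAp : A * p = (c : ℂ) • p := by
    ext y
    simp only [hp, mul_apply_eq_comp, InnerProductSpace.rankOne_apply, smul_apply, map_smul, hAx]
    exact smul_comm _ _ _
  have hpA : p * A = (c : ℂ) • p := by
    have := congrArg star hAp
    simpa [hsa.star_eq, hpsa.star_eq] using this
  set q : F →L[ℂ] F := 1 - p with hq
  have hqsa : IsSelfAdjoint q := (IsSelfAdjoint.one _).sub hpsa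
  set B : F →L[ℂ] F := A - (c : ℂ) • p with hB
  have hqq : q * q = q := by rw [hq]; simp [mul_sub, sub_mul, hpp]
  have hAq : A * q = B := by simp [hq, hB, mul_sub, hAp]
  have hqA : q * A = B := by simp [hq, hB, sub_mul, hpA]
  have hqB : q * B = B := by rw [← hqA, ← mul_assoc, hqq]
  have hB0 : 0 ≤ B := by
    have : B = star q * A * q := by rw [hqsa.star_eq, mul_assoc, hAq, hqB]
    rw [this]
    exact star_left_conjugate_nonneg hA q
  have hq1 : ‖q‖ ≤ 1 := by
    have h : IsStarProjection q := ⟨hqq, hqsa⟩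
    exact h.norm_le
  -- `A` and `B = A - c p` agree on the range of `q = 1 - p`, so the functional calculus of `A` may
  -- be replaced there by that of `B`.
  rw [cfc_mul_eq_mul_cfc hsa (.of_nonneg hB0) (hAq.trans hqB.symm) (continuous_expNegFun ht)]
  calc _ ≤ ‖q‖ * ‖cfc (expNegFun t) B‖ := norm_mul_le _ _
    _ ≤ 1 * Real.exp (-t * (b⁻¹ - 1)) := by
      gcongr
      exact norm_cfc_expNegFun_le hB0 hb hAb ht.le
    _ = _ := one_mul _

/-- If the simple eigenvalue `c` is separated from the rest of the spectrum, which lies below `b`,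
then the part of `A` orthogonal to the eigenvector is bounded by `b`: the projection onto the
eigenvector is obtained from `A` by the functional calculus, with a function that vanishes below `b`
and is `1` at `c`. -/
lemma norm_sub_rankOne_le {A : F →L[ℂ] F} (hA : 0 ≤ A) {x : F} (hx : ‖x‖ = 1)
    {b c : ℝ} (hb : 0 ≤ b) (hbc : b < c) (hAx : A x = (c : ℂ) • x)
    (hspec : ∀ r ∈ spectrum ℝ A, r = c ∨ r ≤ b)
    (hsimple : ∀ y, A y = (c : ℂ) • y → ∃ a : ℂ, y = a • x) :
    ‖A - (c : ℂ) • InnerProductSpace.rankOne ℂ x x‖ ≤ b := by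
  have hsa : IsSelfAdjoint A := .of_nonneg hA
  set p : F →L[ℂ] F := InnerProductSpace.rankOne ℂ x x with hp
  have hpsa : IsSelfAdjoint p := (InnerProductSpace.isStarProjection_rankOne_self hx).isSelfAdjoint
  set χ : ℝ → ℝ := fun r => max 0 ((r - b) / (c - b)) with hχ
  have hχc : Continuous χ := by fun_prop
  have hχ0 (r : ℝ) (hr : r ≤ b) : χ r = 0 :=
    max_eq_left (div_nonpos_of_nonpos_of_nonneg (by linarith) (by linarith))
  have hχ1 : χ c = 1 := by
    simp only [hχ]; rw [div_self (by linarith)]; simp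
  have h1 : A * cfc χ A = (c : ℂ) • cfc χ A := by
    have e1 : A * cfc χ A = cfc (fun r : ℝ => r * χ r) A := by
      rw [cfc_mul (fun r : ℝ => r) χ A (by fun_prop) hχc.continuousOn, cfc_id' ℝ A]
    have e2 : (c : ℂ) • cfc χ A = cfc (fun r : ℝ => c * χ r) A := by
      rw [cfc_const_mul c χ A hχc.continuousOn, Complex.coe_smul]
    rw [e1, e2]
    refine cfc_congr fun r hr => ?_
    rcases hspec r hr with rfl | h
    · rfl
    · simp [hχ0 r h]
  have h2 : p * cfc χ A = cfc χ A := by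
    ext y
    obtain ⟨a, ha⟩ := hsimple (cfc χ A y) (by
      simpa using congrArg (fun B : F →L[ℂ] F => B y) h1)
    simp [hp, ha, inner_self_eq_norm_sq_to_K, hx]
  have h3 : cfc χ A * p = p := by
    ext y
    simp [hp, cfc_apply_eigenvector hsa hAx hχc, hχ1]
  have hχp : cfc χ A = p := by
    have h4 : IsSelfAdjoint (cfc χ A) := cfc_predicate χ A
    have := congrArg star h2
    rw [star_mul, h4.star_eq, hpsa.star_eq, h3] at this
    exact this.symm
  have e : A - (c : ℂ) • p = cfc (fun r : ℝ => r - c * χ r) A := by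
    rw [cfc_sub (fun r : ℝ => r) (fun r => c * χ r) A (by fun_prop) (by fun_prop), cfc_id' ℝ A,
      cfc_const_mul c χ A hχc.continuousOn, hχp, Complex.coe_smul]
  rw [e]
  refine norm_cfc_le hb fun r hr => ?_
  rcases hspec r hr with rfl | h
  · simp [hχ1, hb]
  · rw [hχ0 r h, mul_zero, sub_zero, Real.norm_of_nonneg (spectrum_subset_of_nonneg hA hr).1]
    exact h

end BoundedOperators

/-! ### Resolvents of positive self-adjoint operators -/

section UnboundedOperators

variable {F : Type*} [NormedAddCommGroup F] [InnerProductSpace ℂ F] [CompleteSpace F]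

omit [CompleteSpace F] in
lemma IsResolventOf.unique {A : F →ₗ.[ℂ] F} {ξ : ℂ} {R S : F →L[ℂ] F} (hR : IsResolventOf A ξ R)
    (hS : IsResolventOf A ξ S) : R = S := by
  ext y
  exact ((hS _ y).2 ((hR _ y).1 rfl)).symm

omit [CompleteSpace F] in
lemma isResolventOf_opResolvent {A : F →ₗ.[ℂ] F} {ξ : ℂ} (h : ξ ∉ opSpectrum A) :
    IsResolventOf A ξ (opResolvent A ξ) := by
  have h' : ∃ R : F →L[ℂ] F, IsResolventOf A ξ R := not_not.1 h
  rw [opResolvent, dif_pos h']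
  exact h'.choose_spec

omit [CompleteSpace F] in
lemma IsResolventOf.opResolvent_eq {A : F →ₗ.[ℂ] F} {ξ : ℂ} {R : F →L[ℂ] F}
    (hR : IsResolventOf A ξ R) : opResolvent A ξ = R :=
  (isResolventOf_opResolvent (fun h => h ⟨R, hR⟩)).unique hR

omit [CompleteSpace F] in
/-- The resolvent identity. -/
lemma IsResolventOf.resolvent_identity {A : F →ₗ.[ℂ] F} {ξ η : ℂ} {R S : F →L[ℂ] F}
    (hS : IsResolventOf A ξ S) (hR : IsResolventOf A η R) :
    S - R = (ξ - η) • (S * R) := by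
  ext y
  have h := (hR _ y).1 rfl
  have h2 : S (y + (η - ξ) • R y) = R y := (hS _ _).2 (by
    convert h using 2
    rw [sub_smul]; abel)
  rw [map_add, map_smul] at h2
  simp only [sub_apply, smul_apply, mul_apply_eq_comp]
  rw [eq_sub_of_add_eq h2, ← neg_sub ξ η, neg_smul]; abel

lemma IsPositiveSelfAdjoint.norm_sq_le {A : F →ₗ.[ℂ] F} (hA : IsPositiveSelfAdjoint A)
    {x y : F} (h : (x, y - x) ∈ A.graph) : ‖x‖ ^ 2 ≤ (inner ℂ y x).re := by
  obtain ⟨z, hz1, hz2⟩ := (LinearPMap.mem_graph_iff A).1 h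
  simp only at hz1 hz2
  have h1 := hA.nonneg z
  rw [hz2, hz1, inner_sub_left, Complex.sub_re] at h1
  have h2 : (inner ℂ x x).re = ‖x‖ ^ 2 := inner_self_eq_norm_sq (𝕜 := ℂ) x
  linarith

lemma IsPositiveSelfAdjoint.norm_le {A : F →ₗ.[ℂ] F} (hA : IsPositiveSelfAdjoint A)
    {x y : F} (h : (x, y - x) ∈ A.graph) : ‖x‖ ≤ ‖y‖ := by
  have h1 := hA.norm_sq_le h
  have h2 : (inner ℂ y x).re ≤ ‖y‖ * ‖x‖ := re_inner_le_norm (𝕜 := ℂ) y x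
  rcases (norm_nonneg x).eq_or_lt with h0 | h0
  · rw [← h0]; positivity
  · nlinarith

/-- `A + 1` is onto for a positive self-adjoint operator `A`: its range is closed, because `A + 1`
is bounded below and `A` is closed, and a vector orthogonal to it is an eigenvector of `A` with
eigenvalue `-1`. -/
lemma IsPositiveSelfAdjoint.exists_add_one {A : F →ₗ.[ℂ] F} (hA : IsPositiveSelfAdjoint A)
    (y : F) : ∃ x : F, (x, y - x) ∈ A.graph := by
  have hdense := hA.selfAdjoint.dense_domain
  have hclosed : IsClosed (A.graph : Set (F × F)) := hA.selfAdjoint.isClosed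
  let V : Submodule ℂ F := A.graph.map (LinearMap.fst ℂ F F + LinearMap.snd ℂ F F)
  have hV (v : F) : v ∈ V ↔ ∃ x : F, (x, v - x) ∈ A.graph := by
    constructor
    · rintro ⟨⟨x, z⟩, h, rfl⟩
      exact ⟨x, by simpa using h⟩
    · rintro ⟨x, h⟩
      exact ⟨_, h, by simp⟩
  have hVc : IsClosed (V : Set F) := by
    rw [← isSeqClosed_iff_isClosed]
    intro v w hv hvw
    choose x hx using fun m => (hV (v m)).1 (hv m)
    have hcauchy : CauchySeq x := by
      refine Metric.cauchySeq_iff.2 fun ε hε => ?_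
      obtain ⟨N, hN⟩ := Metric.cauchySeq_iff.1 hvw.cauchySeq ε hε
      refine ⟨N, fun m hm l hl => lt_of_le_of_lt ?_ (hN m hm l hl)⟩
      rw [dist_eq_norm, dist_eq_norm]
      refine hA.norm_le ?_
      have := A.graph.sub_mem (hx m) (hx l)
      rwa [Prod.mk_sub_mk, sub_sub_sub_comm] at this
    obtain ⟨z, hz⟩ := cauchySeq_tendsto_of_complete hcauchy
    exact (hV w).2 ⟨z, hclosed.mem_of_tendsto (hz.prodMk_nhds (hvw.sub hz))
      (Eventually.of_forall hx)⟩
  have hVo : Vᗮ = ⊥ := by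
    rw [Submodule.eq_bot_iff]
    intro z hz
    rw [Submodule.mem_orthogonal] at hz
    have h1 (x : A.domain) : inner ℂ (-z) (x : F) = inner ℂ z (A x) := by
      have h := hz (A x + x) ((hV _).2 ⟨x, by
        rw [add_sub_cancel_right]; exact LinearPMap.mem_graph A x⟩)
      have h' : inner ℂ z (A x + (x : F)) = 0 := by
        rw [← inner_conj_symm, h, map_zero]
      rw [inner_add_right] at h'
      rw [inner_neg_left]
      exact (eq_neg_of_add_eq_zero_left h').symm
    have hdom : z ∈ A.adjoint.domain := LinearPMap.mem_adjoint_domain_of_exists z ⟨-z, h1⟩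
    have hval := LinearPMap.adjoint_apply_eq hdense ⟨z, hdom⟩ h1
    have hg : (z, -z) ∈ A.adjoint.graph := by
      rw [← hval]; exact LinearPMap.mem_graph A.adjoint ⟨z, hdom⟩
    rw [show A.adjoint = A from hA.selfAdjoint] at hg
    have h2 : ‖z‖ ≤ ‖(0 : F)‖ := hA.norm_le (by simpa using hg)
    simpa using h2
  have htop : V = ⊤ := by
    have : CompleteSpace V := hVc.completeSpace_coe
    exact (Submodule.orthogonal_eq_bot_iff (K := V)).1 hVo
  exact (hV y).1 (htop ▸ Submodule.mem_top)

lemma IsPositiveSelfAdjoint.exists_isResolventOf {A : F →ₗ.[ℂ] F} (hA : IsPositiveSelfAdjoint A) :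
    ∃ R : F →L[ℂ] F, IsResolventOf A (-1) R := by
  choose f hf using hA.exists_add_one
  have huniq {x y : F} (h : (x, y - x) ∈ A.graph) : f y = x := by
    rw [← sub_eq_zero, ← norm_le_zero_iff, ← norm_zero (E := F)]
    refine hA.norm_le ?_
    have := A.graph.sub_mem (hf y) h
    rwa [Prod.mk_sub_mk, sub_sub_sub_comm, sub_self] at this
  let R : F →L[ℂ] F := LinearMap.mkContinuous
    { toFun := f
      map_add' := fun x y => huniq (by
        have := A.graph.add_mem (hf x) (hf y)
        rwa [Prod.mk_add_mk, sub_add_sub_comm] at this)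
      map_smul' := fun c x => huniq (by
        have := A.graph.smul_mem c (hf x)
        rwa [Prod.smul_mk, smul_sub] at this) } 1
    (fun x => by rw [one_mul]; exact hA.norm_le (hf x))
  refine ⟨R, fun x y => ?_⟩
  rw [neg_one_smul, ← sub_eq_add_neg]
  exact ⟨fun h => h ▸ hf y, fun h => huniq h⟩

section Resolvent

variable {A : F →ₗ.[ℂ] F}

lemma IsPositiveSelfAdjoint.neg_one_notMem (hA : IsPositiveSelfAdjoint A) :
    (-1 : ℂ) ∉ opSpectrum A := not_not.2 hA.exists_isResolventOf

lemma IsPositiveSelfAdjoint.opResolvent_apply_eq_iff (hA : IsPositiveSelfAdjoint A) (x y : F) :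
    opResolvent A (-1) y = x ↔ (x, y - x) ∈ A.graph := by
  rw [isResolventOf_opResolvent hA.neg_one_notMem x y, neg_one_smul, ← sub_eq_add_neg]

lemma IsPositiveSelfAdjoint.norm_opResolvent_le (hA : IsPositiveSelfAdjoint A) :
    ‖opResolvent A (-1)‖ ≤ 1 :=
  ContinuousLinearMap.opNorm_le_bound _ zero_le_one fun y => by
    rw [one_mul]; exact hA.norm_le ((hA.opResolvent_apply_eq_iff _ y).1 rfl)

lemma IsPositiveSelfAdjoint.opResolvent_nonneg (hA : IsPositiveSelfAdjoint A) :
    0 ≤ opResolvent A (-1) := by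
  rw [ContinuousLinearMap.nonneg_iff_isPositive, ContinuousLinearMap.isPositive_iff_complex]
  set R := opResolvent A (-1)
  have hsymm (y z : F) : inner ℂ (R y) z = inner ℂ y (R z) := by
    obtain ⟨u, hu1, hu2⟩ := (LinearPMap.mem_graph_iff A).1
      ((hA.opResolvent_apply_eq_iff (R y) y).1 rfl)
    obtain ⟨v, hv1, hv2⟩ := (LinearPMap.mem_graph_iff A).1
      ((hA.opResolvent_apply_eq_iff (R z) z).1 rfl)
    simp only at hu1 hu2 hv1 hv2
    have hadj : A.adjoint = A := hA.selfAdjoint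
    have hfa := LinearPMap.adjoint_isFormalAdjoint (T := A) hA.selfAdjoint.dense_domain
    rw [hadj] at hfa
    have h := hfa u v
    rw [hu2, hv2, hu1, hv1, inner_sub_left, inner_sub_right] at h
    exact (sub_left_injective h).symm
  intro y
  have him : (starRingEnd ℂ) (inner ℂ (R y) y) = inner ℂ (R y) y := by
    rw [inner_conj_symm, hsymm]
  refine ⟨?_, ?_⟩
  · exact Complex.conj_eq_iff_re.1 him
  · have h1 := hA.norm_sq_le ((hA.opResolvent_apply_eq_iff (R y) y).1 rfl)
    rw [hsymm]
    exact (sq_nonneg _).trans h1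

lemma IsPositiveSelfAdjoint.opResolvent_ne_zero [Nontrivial F] (hA : IsPositiveSelfAdjoint A) :
    opResolvent A (-1) ≠ 0 := by
  intro h0
  obtain ⟨y, hy⟩ := exists_ne (0 : F)
  have h := (hA.opResolvent_apply_eq_iff 0 y).1 (by rw [h0]; rfl)
  obtain ⟨u, hu1, hu2⟩ := (LinearPMap.mem_graph_iff A).1 h
  simp only [sub_zero] at hu1 hu2
  have : u = 0 := Subtype.ext hu1
  rw [this, LinearPMap.map_zero] at hu2
  exact hy hu2.symm

/-- The spectral mapping theorem for the resolvent at `-1`. -/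
lemma IsPositiveSelfAdjoint.mem_spectrum_opResolvent_iff (hA : IsPositiveSelfAdjoint A)
    {r : ℝ} (hr : r ≠ 0) :
    r ∈ spectrum ℝ (opResolvent A (-1)) ↔ ((r⁻¹ - 1 : ℝ) : ℂ) ∈ opSpectrum A := by
  set R := opResolvent A (-1) with hRdef
  have hR : IsResolventOf A (-1) R := isResolventOf_opResolvent hA.neg_one_notMem
  have hrc : (r : ℂ) ≠ 0 := by exact_mod_cast hr
  set ξ : ℂ := ((r⁻¹ - 1 : ℝ) : ℂ) with hξ
  have hξ' : ξ = (r : ℂ)⁻¹ - 1 := by rw [hξ]; push_cast; ring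
  have halg : algebraMap ℝ (F →L[ℂ] F) r = (r : ℂ) • 1 := by
    rw [Algebra.algebraMap_eq_smul_one, Complex.coe_smul]
  rw [← not_iff_not, spectrum.notMem_iff, halg]
  simp only [opSpectrum, Set.mem_ofPred_eq, not_not]
  constructor
  · rintro ⟨u, hu⟩
    have hmul : ∀ z, (↑u⁻¹ : F →L[ℂ] F) ((r : ℂ) • z - R z) = z := fun z => by
      have := congrArg (fun B : F →L[ℂ] F => B z) u.inv_mul
      simpa [hu] using this
    have hmul' : ∀ z, (r : ℂ) • (↑u⁻¹ : F →L[ℂ] F) z - R ((↑u⁻¹ : F →L[ℂ] F) z) = z := fun z => by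
      have := congrArg (fun B : F →L[ℂ] F => B z) u.mul_inv
      simpa [hu] using this
    -- `(A - ξ)⁻¹ = r (r - R)⁻¹ R` for `ξ = r⁻¹ - 1`.
    refine ⟨(r : ℂ) • ((↑u⁻¹ : F →L[ℂ] F) * R), fun x y => ?_⟩
    have e : (x, y + ξ • x) ∈ A.graph ↔ R (y + (r : ℂ)⁻¹ • x) = x := by
      rw [hA.opResolvent_apply_eq_iff, hξ', sub_smul, one_smul, add_sub]
    have e2 : (r : ℂ) • R y = (r : ℂ) • x - R x ↔ R (y + (r : ℂ)⁻¹ • x) = x := by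
      rw [map_add, map_smul, ← (smul_right_injective F hrc).eq_iff (a := R y + _), smul_add,
        smul_inv_smul₀ hrc, ← eq_sub_iff_add_eq]
    rw [e, ← e2]
    simp only [smul_apply, mul_apply_eq_comp]
    constructor
    · intro h
      rw [← h]
      have h2 := hmul' (R y)
      simp only [map_smul]
      rw [← smul_sub, h2]
    · intro h
      rw [← map_smul, h, hmul]
  · rintro ⟨S, hS⟩
    have h1 := hS.resolvent_identity hR
    have h2 := hR.resolvent_identity hS
    have hξ1 : ξ - -1 = (r : ℂ)⁻¹ := by rw [hξ']; ring
    have hξ2 : -1 - ξ = -(r : ℂ)⁻¹ := by rw [hξ']; ring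
    rw [hξ1] at h1
    rw [hξ2] at h2
    have h1' : S * R = (r : ℂ) • (S - R) := by rw [h1, smul_inv_smul₀ hrc]
    have h2' : R * S = (r : ℂ) • (S - R) := by
      rw [← neg_sub R S, h2, neg_smul, neg_neg, smul_inv_smul₀ hrc]
    -- `(r - R)⁻¹ = r⁻¹ (1 + r⁻¹ S)`, by the resolvent identity.
    refine ⟨⟨(r : ℂ) • 1 - R, (r : ℂ)⁻¹ • (1 + (r : ℂ)⁻¹ • S), ?_, ?_⟩, rfl⟩
    · simp only [mul_add, sub_mul, mul_smul_comm, smul_mul_assoc, one_mul, mul_one, h2']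
      match_scalars <;> field_simp <;> ring
    · simp only [add_mul, mul_sub, mul_smul_comm, smul_mul_assoc, one_mul, mul_one, h1']
      match_scalars <;> field_simp <;> ring

/-- The ground state energy is a function of the norm of the resolvent. -/
lemma IsPositiveSelfAdjoint.infSpec_eq [Nontrivial F] (hA : IsPositiveSelfAdjoint A) :
    infSpec A = ‖opResolvent A (-1)‖⁻¹ - 1 := by
  set R := opResolvent A (-1) with hR
  have hpos : 0 < ‖R‖ := norm_pos_iff.2 hA.opResolvent_ne_zero
  refine IsLeast.csInf_eq ⟨?_, fun x hx => ?_⟩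
  · exact (hA.mem_spectrum_opResolvent_iff hpos.ne').1
      (CStarAlgebra.norm_mem_spectrum_of_nonneg hA.opResolvent_nonneg)
  · simp only [Set.mem_ofPred_eq] at hx
    have hx1 : x + 1 ≠ 0 := fun h => hA.neg_one_notMem (by
      have : x = -1 := by linarith
      rw [this] at hx
      simpa using hx)
    have h1 : ((((x + 1)⁻¹)⁻¹ - 1 : ℝ) : ℂ) ∈ opSpectrum A := by simpa using hx
    have h2 := spectrum_subset_of_nonneg hA.opResolvent_nonneg
      ((hA.mem_spectrum_opResolvent_iff (inv_ne_zero hx1)).2 h1)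
    have h3 : 0 < (x + 1)⁻¹ := lt_of_le_of_ne h2.1 (inv_ne_zero hx1).symm
    have h4 := inv_anti₀ h3 h2.2
    rw [inv_inv] at h4
    linarith

lemma IsPositiveSelfAdjoint.norm_opResolvent_eq [Nontrivial F] (hA : IsPositiveSelfAdjoint A) :
    ‖opResolvent A (-1)‖ = (1 + infSpec A)⁻¹ := by
  rw [hA.infSpec_eq, add_sub_cancel, inv_inv]

lemma IsPositiveSelfAdjoint.infSpec_nonneg [Nontrivial F] (hA : IsPositiveSelfAdjoint A) :
    0 ≤ infSpec A := by
  rw [hA.infSpec_eq, sub_nonneg]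
  exact (one_le_inv₀ (norm_pos_iff.2 hA.opResolvent_ne_zero)).2 hA.norm_opResolvent_le

lemma IsPositiveSelfAdjoint.opResolvent_eigenvector_iff (hA : IsPositiveSelfAdjoint A) {x : F}
    {e : ℝ} (he : 0 ≤ e) : (x, (e : ℂ) • x) ∈ A.graph ↔
      opResolvent A (-1) x = (((1 + e)⁻¹ : ℝ) : ℂ) • x := by
  have h1 : (((1 + e : ℝ)) : ℂ) ≠ 0 := by exact_mod_cast (by linarith : (1 + e) ≠ 0)
  have h2 := hA.opResolvent_apply_eq_iff x (((1 + e : ℝ) : ℂ) • x)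
  have h3 : ((1 + e : ℝ) : ℂ) • x - x = (e : ℂ) • x := by
    push_cast; rw [add_smul, one_smul, add_sub_cancel_left]
  rw [h3] at h2
  rw [← h2, map_smul, Complex.ofReal_inv, eq_inv_smul_iff₀ h1]

end Resolvent

end UnboundedOperators

open scoped BoundedContinuousFunction

/-! ### Decomposable operators -/

section Decomposable

variable {X : Type*} [TopologicalSpace X] [SecondCountableTopology X] [MeasurableSpace X]
  [OpensMeasurableSpace X] {μ : Measure X}
variable {F : Type*} [NormedAddCommGroup F] [InnerProductSpace ℂ F] [CompleteSpace F]

omit [CompleteSpace F] in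
lemma memLp_apply (S : X →ᵇ (F →L[ℂ] F)) (f : Lp F 2 μ) : MemLp (fun x => S x (f x)) 2 μ := by
  refine MemLp.of_le_mul (c := ‖S‖) (Lp.memLp f) ?_ ?_
  · exact isBoundedBilinearMap_apply.continuous.comp_aestronglyMeasurable
      (S.continuous.stronglyMeasurable.aestronglyMeasurable.prodMk (Lp.aestronglyMeasurable f))
  · exact Eventually.of_forall fun x => (S x).le_of_opNorm_le (S.norm_coe_le_norm x) _

/-- The decomposable operator `∫^⊕ S(x) dμ(x)` on `L²(μ; F)` with bounded continuous fibers. -/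
noncomputable def decomposable (μ : Measure X) (S : X →ᵇ (F →L[ℂ] F)) : Lp F 2 μ →L[ℂ] Lp F 2 μ :=
  LinearMap.mkContinuous
    { toFun := fun f => (memLp_apply S f).toLp
      map_add' := fun f g => by
        ext1
        filter_upwards [(memLp_apply S (f + g)).coeFn_toLp, (memLp_apply S f).coeFn_toLp,
          (memLp_apply S g).coeFn_toLp, Lp.coeFn_add f g,
          Lp.coeFn_add ((memLp_apply S f).toLp) ((memLp_apply S g).toLp)] with x h1 h2 h3 h4 h5
        rw [h1, h5, Pi.add_apply, h2, h3, h4, Pi.add_apply, map_add]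
      map_smul' := fun c f => by
        ext1
        filter_upwards [(memLp_apply S (c • f)).coeFn_toLp, (memLp_apply S f).coeFn_toLp,
          Lp.coeFn_smul c f, Lp.coeFn_smul c ((memLp_apply S f).toLp)] with x h1 h2 h3 h4
        rw [h1, RingHom.id_apply, h4, Pi.smul_apply, h2, h3, Pi.smul_apply, map_smul] }
    ‖S‖ fun f => Lp.norm_le_mul_norm_of_ae_le_mul (by
      filter_upwards [(memLp_apply S f).coeFn_toLp] with x h1
      exact h1 ▸ (S x).le_of_opNorm_le (S.norm_coe_le_norm x) _)

omit [CompleteSpace F] in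
lemma coeFn_decomposable (S : X →ᵇ (F →L[ℂ] F)) (f : Lp F 2 μ) :
    decomposable μ S f =ᵐ[μ] fun x => S x (f x) := (memLp_apply S f).coeFn_toLp

/-- `S ↦ ∫^⊕ S(x) dμ(x)` as a homomorphism of C⋆-algebras. -/
noncomputable def decomposableHom (F : Type*) [NormedAddCommGroup F] [InnerProductSpace ℂ F]
    [CompleteSpace F] (μ : Measure X) :
    (X →ᵇ (F →L[ℂ] F)) →⋆ₐ[ℂ] (Lp F 2 μ →L[ℂ] Lp F 2 μ) where
  toFun := decomposable μ
  map_one' := by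
    ext f : 2
    filter_upwards [coeFn_decomposable (1 : X →ᵇ (F →L[ℂ] F)) f] with x h
    rw [h]; rfl
  map_mul' S T := by
    ext f : 2
    filter_upwards [coeFn_decomposable (S * T) f, coeFn_decomposable S (decomposable μ T f),
      coeFn_decomposable T f] with x h1 h2 h3
    rw [h1, mul_apply_eq_comp, h2, h3]; rfl
  map_zero' := by
    ext f : 2
    filter_upwards [coeFn_decomposable (0 : X →ᵇ (F →L[ℂ] F)) f, Lp.coeFn_zero F 2 μ] with x h h0
    exact h.trans h0.symm
  map_add' S T := by
    ext f : 2
    filter_upwards [coeFn_decomposable (S + T) f, coeFn_decomposable S f,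
      coeFn_decomposable T f, Lp.coeFn_add (decomposable μ S f) (decomposable μ T f)]
      with x h1 h2 h3 h4
    refine h1.trans (Eq.trans ?_ h4.symm)
    rw [Pi.add_apply, h2, h3]; rfl
  commutes' c := by
    ext f : 2
    filter_upwards [coeFn_decomposable (algebraMap ℂ (X →ᵇ (F →L[ℂ] F)) c) f,
      Lp.coeFn_smul c f] with x h h2
    rw [h, Algebra.algebraMap_eq_smul_one (A := Lp F 2 μ →L[ℂ] Lp F 2 μ), smul_apply,
      one_apply_eq_self, h2, Pi.smul_apply]
    simp [Algebra.algebraMap_eq_smul_one]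
  map_star' S := by
    refine (ContinuousLinearMap.eq_adjoint_iff _ _).2 fun f g => ?_
    rw [L2.inner_def, L2.inner_def]
    refine integral_congr_ae ?_
    filter_upwards [coeFn_decomposable (star S) f, coeFn_decomposable S g] with x h1 h2
    rw [h1, h2, BoundedContinuousFunction.star_apply, ContinuousLinearMap.star_eq_adjoint,
      ContinuousLinearMap.adjoint_inner_left]

/-- Evaluation of bounded continuous operator-valued functions at a point. -/
noncomputable def evalHom (F : Type*) [NormedAddCommGroup F] [InnerProductSpace ℂ F]
    [CompleteSpace F] (x : X) : (X →ᵇ (F →L[ℂ] F)) →⋆ₐ[ℂ] (F →L[ℂ] F) where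
  toFun S := S x
  map_one' := rfl
  map_mul' _ _ := rfl
  map_zero' := rfl
  map_add' _ _ := rfl
  commutes' _ := rfl
  map_star' _ := rfl

variable {K : Type*} [NormedAddCommGroup K] [InnerProductSpace ℂ K] [CompleteSpace K]

/-- The operator `Π* (∫^⊕ S(x) dμ(x)) Π`, as a homomorphism of C⋆-algebras in `S`. -/
noncomputable def fiberHom (Pi : K ≃ₗᵢ[ℂ] Lp F 2 μ) :
    (X →ᵇ (F →L[ℂ] F)) →⋆ₐ[ℂ] (K →L[ℂ] K) :=
  (Pi.symm.conjStarAlgEquiv : (Lp F 2 μ →L[ℂ] Lp F 2 μ) →⋆ₐ[ℂ] (K →L[ℂ] K)).comp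
    (decomposableHom F μ)

lemma coeFn_fiberHom (Pi : K ≃ₗᵢ[ℂ] Lp F 2 μ) (S : X →ᵇ (F →L[ℂ] F)) (f : K) :
    Pi (fiberHom Pi S f) =ᵐ[μ] fun x => S x (Pi f x) := by
  have h : Pi (fiberHom Pi S f) = decomposable μ S (Pi f) := Pi.apply_symm_apply _
  rw [h]
  exact coeFn_decomposable S (Pi f)

open scoped CStarAlgebra in
/-- An element realizing the functional calculus simultaneously in the images of a family of
homomorphisms. -/
lemma exists_map_eq_cfc {𝒜 ℬ 𝒞 ι : Type*} [CStarAlgebra 𝒜] [CStarAlgebra ℬ] [CStarAlgebra 𝒞]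
    (φ : ι → 𝒜 →⋆ₐ[ℂ] ℬ) (θ : 𝒜 →⋆ₐ[ℂ] 𝒞) {a : 𝒜} (ha : IsSelfAdjoint a) {f : ℝ → ℝ}
    (hf : Continuous f) : ∃ b : 𝒜, (∀ i, φ i b = cfc f (φ i a)) ∧ θ b = cfc f (θ a) :=
  ⟨cfc f a, fun i => StarAlgHomClass.map_cfc (S := ℂ) (φ i) f a hf.continuousOn (map_continuous _)
    ha (ha.map (φ i)), StarAlgHomClass.map_cfc (S := ℂ) θ f a hf.continuousOn (map_continuous _)
    ha (ha.map θ)⟩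

/-- The functional calculus of a decomposable operator acts fiberwise. -/
lemma exists_fiberwise_cfc (Pi : K ≃ₗᵢ[ℂ] Lp F 2 μ) {S : X →ᵇ (F →L[ℂ] F)}
    (hS : IsSelfAdjoint S) {f : ℝ → ℝ} (hf : Continuous f) :
    ∃ B : X →ᵇ (F →L[ℂ] F), (∀ x, B x = cfc f (S x)) ∧ fiberHom Pi B = cfc f (fiberHom Pi S) :=
  exists_map_eq_cfc (𝒜 := X →ᵇ (F →L[ℂ] F)) (fun x => evalHom F x) (fiberHom Pi) hS hf

end Decomposable

/-! ### The characteristic function in momentum space -/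

lemma isSelfAdjoint_expNeg {F : Type*} [NormedAddCommGroup F] [InnerProductSpace ℂ F]
    [CompleteSpace F] (A : F →ₗ.[ℂ] F) (t : ℝ) : IsSelfAdjoint (expNeg A t) := by
  unfold expNeg
  split_ifs
  · exact .one _
  · exact cfc_predicate _ _

lemma expNeg_of_pos {F : Type*} [NormedAddCommGroup F] [InnerProductSpace ℂ F]
    [CompleteSpace F] (A : F →ₗ.[ℂ] F) {t : ℝ} (ht : 0 < t) :
    expNeg A t = cfc (expNegFun t) (opResolvent A (-1)) := if_neg ht.ne'

section Fibers

variable {d : ℕ} {F : Type*} [NormedAddCommGroup F] [InnerProductSpace ℂ F] [CompleteSpace F]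
variable {K : Type*} [NormedAddCommGroup K] [InnerProductSpace ℂ K] [CompleteSpace K]
  {Pi : K ≃ₗᵢ[ℂ] Lp F 2 (volume : Measure (Mom d))} {H : K →ₗ.[ℂ] K} {Hf : Mom d → F →ₗ.[ℂ] F}

/-- The bounded continuous family of resolvents `(H(P) + 1)⁻¹`. -/
noncomputable def resolventFamily (hpos : ∀ P, IsPositiveSelfAdjoint (Hf P))
    (hcont : Continuous fun P => opResolvent (Hf P) (-1)) : Mom d →ᵇ (F →L[ℂ] F) :=
  BoundedContinuousFunction.ofNormedAddCommGroup (fun P => opResolvent (Hf P) (-1)) hcont 1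
    fun P => (hpos P).norm_opResolvent_le

/-- The resolvent of the direct integral is the direct integral of the resolvents. -/
lemma IsDirectIntegral.isResolventOf_fiberHom (hHf : IsDirectIntegral Pi H Hf)
    (hpos : ∀ P, IsPositiveSelfAdjoint (Hf P))
    (hcont : Continuous fun P => opResolvent (Hf P) (-1)) :
    IsResolventOf H (-1) (fiberHom Pi (resolventFamily hpos hcont)) := by
  intro x y
  rw [neg_one_smul, ← sub_eq_add_neg, hHf, ← Pi.injective.eq_iff, Lp.ext_iff]
  have h1 := coeFn_fiberHom Pi (resolventFamily hpos hcont) y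
  have h2 : Pi (y - x) =ᵐ[volume] fun P => Pi y P - Pi x P := by
    rw [map_sub]; exact Lp.coeFn_sub _ _
  refine eventually_congr ?_
  filter_upwards [h1, h2] with P h1 h2
  rw [h1, h2]
  exact (hpos P).opResolvent_apply_eq_iff _ _

/-- The semigroup of the direct integral is the direct integral of the semigroups, which depend
continuously on the fiber. -/
lemma IsDirectIntegral.exists_fiberHom_eq_expNeg (hHf : IsDirectIntegral Pi H Hf)
    (hpos : ∀ P, IsPositiveSelfAdjoint (Hf P))
    (hcont : Continuous fun P => opResolvent (Hf P) (-1)) {t : ℝ} (ht : 0 ≤ t) :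
    ∃ B : Mom d →ᵇ (F →L[ℂ] F), (∀ P, B P = expNeg (Hf P) t) ∧
      fiberHom Pi B = expNeg H t := by
  rcases ht.eq_or_lt with rfl | ht
  · refine ⟨1, fun P => ?_, ?_⟩
    · rw [expNeg, if_pos rfl]; rfl
    · rw [map_one, expNeg, if_pos rfl]
  · have hsa : IsSelfAdjoint (resolventFamily hpos hcont) := by
      ext1 P
      exact IsSelfAdjoint.of_nonneg (hpos P).opResolvent_nonneg
    obtain ⟨B, hB1, hB2⟩ := exists_fiberwise_cfc Pi hsa (continuous_expNegFun ht)
    refine ⟨B, fun P => ?_, ?_⟩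
    · rw [hB1, expNeg_of_pos _ ht]; rfl
    · rw [hB2, expNeg_of_pos _ ht,
        (hHf.isResolventOf_fiberHom hpos hcont).opResolvent_eq]

omit [CompleteSpace F] [CompleteSpace K] in
lemma coeFn_shiftU (k : Mom d) (f : K) :
    Pi (shiftU Pi k f) =ᵐ[volume] fun P => Pi f (P + k) := by
  have h : Pi (shiftU Pi k f) = Lp.compMeasurePreserving (fun P : Mom d => P + k)
      (measurePreserving_add_right volume k) (Pi f) := Pi.apply_symm_apply _
  rw [h]
  exact Lp.coeFn_compMeasurePreserving _ _

omit [CompleteSpace F] [CompleteSpace K] in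
lemma shiftU_shiftU_neg (k : Mom d) (f : K) : shiftU Pi k (shiftU Pi (-k) f) = f := by
  apply Pi.injective
  ext1
  have h := (measurePreserving_add_right volume k).quasiMeasurePreserving.ae
    (coeFn_shiftU (Pi := Pi) (-k) f)
  filter_upwards [coeFn_shiftU (Pi := Pi) k (shiftU Pi (-k) f), h] with P h1 h2
  rw [h1, h2, add_neg_cancel_right]

omit [CompleteSpace F] in
lemma adjoint_shiftU (k : Mom d) :
    ContinuousLinearMap.adjoint (shiftU Pi k) = shiftU Pi (-k) := by
  refine ((ContinuousLinearMap.eq_adjoint_iff _ _).2 fun x y => ?_).symm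
  have h : inner ℂ (shiftU Pi k (shiftU Pi (-k) x)) (shiftU Pi k y) =
      inner ℂ (shiftU Pi (-k) x) y :=
    (Pi.symm.toLinearIsometry.comp
      ((Lp.compMeasurePreservingₗᵢ ℂ (fun P : Mom d => P + k)
        (measurePreserving_add_right volume k)).comp Pi.toLinearIsometry)).inner_map_map _ _
  rw [← h, shiftU_shiftU_neg]

/-- The integrand of the unnormalized characteristic function in momentum space. -/
noncomputable def fiberIntegrand (Hf : Mom d → F →ₗ.[ℂ] F) (Φ : Mom d → F) (T : ℝ) (k : Mom d)
    (t : ℝ) (P : Mom d) : ℂ :=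
  inner ℂ (expNeg (Hf P) T (Φ P)) (expNeg (Hf (P + k)) t (expNeg (Hf P) T (Φ P)))

/-- The unnormalized characteristic function as an integral over momentum space. -/
lemma IsDirectIntegral.integrable_and_charFunUnnormalized_eq (hHf : IsDirectIntegral Pi H Hf)
    (hpos : ∀ P, IsPositiveSelfAdjoint (Hf P))
    (hcont : Continuous fun P => opResolvent (Hf P) (-1)) {φ : K} {Φ : Mom d → F}
    (hΦ : ∀ᵐ P : Mom d, Pi φ P = Φ P) {T t : ℝ} (hT : 0 ≤ T) (ht : 0 ≤ t) (k : Mom d) :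
    Integrable (fiberIntegrand Hf Φ T k t) ∧
      charFunUnnormalized Pi H φ T k t = ∫ P, fiberIntegrand Hf Φ T k t P := by
  obtain ⟨A, hA, hA'⟩ := hHf.exists_fiberHom_eq_expNeg hpos hcont hT
  obtain ⟨B, hB, hB'⟩ := hHf.exists_fiberHom_eq_expNeg hpos hcont ht
  set f : K := expNeg H T φ with hf
  set g : K := shiftU Pi k (expNeg H t (shiftU Pi (-k) f)) with hg
  have hfP : ∀ᵐ P : Mom d, Pi f P = expNeg (Hf P) T (Φ P) := by
    filter_upwards [coeFn_fiberHom Pi A φ, hΦ] with P h1 h2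
    rw [hf, ← hA', h1, hA, h2]
  have hshift := (measurePreserving_add_right (volume : Measure (Mom d)) k).quasiMeasurePreserving
  have hgP : ∀ᵐ P : Mom d, Pi g P = expNeg (Hf (P + k)) t (expNeg (Hf P) T (Φ P)) := by
    filter_upwards [coeFn_shiftU (Pi := Pi) k (expNeg H t (shiftU Pi (-k) f)),
      hshift.ae (coeFn_fiberHom Pi B (shiftU Pi (-k) f)),
      hshift.ae (coeFn_shiftU (Pi := Pi) (-k) f), hfP] with P h1 h2 h3 h4
    rw [hg, h1, ← hB', h2, h3, hB, add_neg_cancel_right, h4]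
  have hfg : (fun P => inner ℂ (Pi f P) (Pi g P)) =ᵐ[volume] fiberIntegrand Hf Φ T k t := by
    filter_upwards [hfP, hgP] with P h1 h2
    rw [h1, h2]; rfl
  refine ⟨(L2.integrable_inner (𝕜 := ℂ) (Pi f) (Pi g)).congr hfg, ?_⟩
  have h1 : charFunUnnormalized Pi H φ T k t = inner ℂ f g := by
    rw [charFunUnnormalized, adjoint_shiftU, ← (isSelfAdjoint_expNeg H T).adjoint_eq,
      ContinuousLinearMap.adjoint_inner_right, (isSelfAdjoint_expNeg H T).adjoint_eq]
  rw [h1, ← Pi.inner_map_map, L2.inner_def]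
  exact integral_congr_ae hfg

end Fibers

/-! ### Ground states near a minimum -/

section LocalAnalysis

variable {d : ℕ} {F : Type*} [NormedAddCommGroup F] [InnerProductSpace ℂ F] [CompleteSpace F]

/-- The local properties, near the momentum `P₀`, of a family of normalized ground states `ψ P` of
`H(P)`: the projections onto them are strongly continuous at `P₀`, and the ground state at `P₀` is
simple. -/
structure IsLocalGroundState (Hf : Mom d → F →ₗ.[ℂ] F) (ψ : Mom d → F) (P₀ : Mom d) : Prop where
  norm_eq : ∀ᶠ P in 𝓝 P₀, ‖ψ P‖ = 1
  eigenvector : ∀ᶠ P in 𝓝 P₀, (ψ P, (infSpec (Hf P) : ℂ) • ψ P) ∈ (Hf P).graph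
  simple : ∀ x : F, (x, (infSpec (Hf P₀) : ℂ) • x) ∈ (Hf P₀).graph → ∃ c : ℂ, x = c • ψ P₀
  continuousAt : ∀ x : F, ContinuousAt (fun P => (inner ℂ (ψ P) x : ℂ) • ψ P) P₀

/-- The projection onto the line spanned by the ground state `ψ P`, for `‖ψ P‖ = 1`. -/
noncomputable def groundProj (ψ : Mom d → F) (P : Mom d) : F →L[ℂ] F :=
  InnerProductSpace.rankOne ℂ (ψ P) (ψ P)

/-- The limit of the integrand, divided by `exp (-2 T E(P))`, at the momentum `P`. -/
noncomputable def groundDensity (Hf : Mom d → F →ₗ.[ℂ] F) (ψ Φ : Mom d → F) (k : Mom d) (t : ℝ)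
    (P : Mom d) : ℂ :=
  ((‖(inner ℂ (Φ P) (ψ P) : ℂ)‖ ^ 2 : ℝ) : ℂ) * groundExpectation Hf ψ P k t

variable {Hf : Mom d → F →ₗ.[ℂ] F} {ψ Φ : Mom d → F} {P₀ : Mom d}

omit [CompleteSpace F] in
lemma inner_groundProj_apply (B : F →L[ℂ] F) (P : Mom d) (x : F) :
    inner ℂ (groundProj ψ P x) (B (groundProj ψ P x)) =
      ((‖(inner ℂ x (ψ P) : ℂ)‖ ^ 2 : ℝ) : ℂ) * inner ℂ (ψ P) (B (ψ P)) := by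
  simp only [groundProj, InnerProductSpace.rankOne_apply, map_smul, inner_smul_left,
    inner_smul_right, inner_conj_symm]
  rw [← mul_assoc, mul_comm (inner ℂ (ψ P) x), ← inner_conj_symm (ψ P) x, Complex.mul_conj]
  rw [Complex.normSq_eq_norm_sq]

lemma groundDensity_eq (k : Mom d) (t : ℝ) (P : Mom d) : groundDensity Hf ψ Φ k t P =
    inner ℂ (groundProj ψ P (Φ P)) (expNeg (Hf (P + k)) t (groundProj ψ P (Φ P))) :=
  (inner_groundProj_apply _ _ _).symm

omit [CompleteSpace F] in
lemma norm_groundProj_apply_le {P : Mom d} (h : ‖ψ P‖ = 1) (x : F) : ‖groundProj ψ P x‖ ≤ ‖x‖ := by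
  refine (ContinuousLinearMap.le_opNorm _ _).trans ?_
  rw [groundProj, InnerProductSpace.norm_rankOne, h]
  simp

omit [CompleteSpace F] in
/-- Near `P₀` the ground states can be replaced by nonzero multiples `w P` that are continuous at
`P₀`, namely by their projections of the vector `ψ P₀`. -/
lemma IsLocalGroundState.exists_continuousAt_smul (h : IsLocalGroundState Hf ψ P₀) :
    ∃ w : Mom d → F, ContinuousAt w P₀ ∧ w P₀ = ψ P₀ ∧ ∀ᶠ P in 𝓝 P₀, ∃ c : ℂ,
      w P = c • ψ P ∧ ‖c‖ ^ 2 = ‖w P‖ ^ 2 ∧ ‖w P‖ ^ 2 ≠ 0 := by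
  have h0 : ‖ψ P₀‖ = 1 := h.norm_eq.self_of_nhds
  have hw := h.continuousAt (ψ P₀)
  have hw0 : (inner ℂ (ψ P₀) (ψ P₀) : ℂ) • ψ P₀ = ψ P₀ := by
    rw [inner_self_eq_norm_sq_to_K, h0]; simp
  refine ⟨_, hw, hw0, ?_⟩
  have hne : ∀ᶠ P in 𝓝 P₀, ‖(inner ℂ (ψ P) (ψ P₀) : ℂ) • ψ P‖ ≠ 0 := by
    refine hw.norm.eventually_ne ?_
    rw [hw0, h0]
    exact one_ne_zero
  filter_upwards [h.norm_eq, hne] with P h1 h2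
  refine ⟨_, rfl, ?_, pow_ne_zero 2 h2⟩
  rw [norm_smul, h1, mul_one]

/-- The ground state projections are norm continuous: near `P₀` they are the projections onto the
images of the single vector `ψ P₀`, which depend continuously on `P` although `ψ` need not. -/
lemma IsLocalGroundState.continuousAt_groundProj (h : IsLocalGroundState Hf ψ P₀) :
    ContinuousAt (groundProj ψ) P₀ := by
  obtain ⟨w, hw, hw0, hev⟩ := h.exists_continuousAt_smul
  have h0 : ‖ψ P₀‖ = 1 := h.norm_eq.self_of_nhds
  have hc : ContinuousAt (fun P => (((‖w P‖ ^ 2 : ℝ) : ℂ))⁻¹ •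
      InnerProductSpace.rankOne ℂ (w P) (w P)) P₀ := by
    have h1 : ContinuousAt (fun P => (((‖w P‖ ^ 2 : ℝ) : ℂ))⁻¹) P₀ := by
      refine ContinuousAt.inv₀ (Complex.continuous_ofReal.continuousAt.comp (hw.norm.pow 2)) ?_
      rw [hw0, h0]; simp
    have hr : Continuous (fun z : F × F => InnerProductSpace.rankOne ℂ z.1 z.2) := by
      have h : Continuous fun z : F × F =>
          ContinuousLinearMap.smulRightL ℂ F F (innerSL ℂ z.2) z.1 := by fun_prop
      exact h
    exact h1.smul (hr.continuousAt.comp (f := fun P => (w P, w P)) (hw.prodMk hw))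
  refine hc.congr ?_
  filter_upwards [hev] with P ⟨c, hcw, hcn, hne⟩
  have hne' : (((‖w P‖ ^ 2 : ℝ) : ℂ)) ≠ 0 := by exact_mod_cast hne
  rw [inv_smul_eq_iff₀ hne']
  ext x
  simp only [groundProj, InnerProductSpace.rankOne_apply, hcw, smul_apply, inner_smul_left,
    smul_smul]
  rw [← hcw, ← hcn, ← Complex.normSq_eq_norm_sq, ← Complex.mul_conj]
  ring_nf

section

variable (hpos : ∀ P, IsPositiveSelfAdjoint (Hf P))
  (hcont : Continuous fun P => opResolvent (Hf P) (-1))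
include hpos

lemma norm_expNeg_le_one {t : ℝ} (ht : 0 ≤ t) (P : Mom d) : ‖expNeg (Hf P) t‖ ≤ 1 := by
  rcases ht.eq_or_lt with rfl | ht
  · rw [expNeg, if_pos rfl]
    exact ContinuousLinearMap.norm_id_le
  · rw [expNeg_of_pos _ ht]
    refine (norm_cfc_expNegFun_le (hpos P).opResolvent_nonneg one_pos
      (hpos P).norm_opResolvent_le ht.le).trans ?_
    simp

lemma expNeg_apply_eigenvector {P : Mom d} [Nontrivial F] {x : F} {T : ℝ} (hT : 0 < T)
    (hx : (x, (infSpec (Hf P) : ℂ) • x) ∈ (Hf P).graph) :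
    expNeg (Hf P) T x = ((Real.exp (-T * infSpec (Hf P)) : ℝ) : ℂ) • x := by
  have hE := (hpos P).infSpec_nonneg
  rw [expNeg_of_pos _ hT, cfc_apply_eigenvector (.of_nonneg (hpos P).opResolvent_nonneg)
    (((hpos P).opResolvent_eigenvector_iff hE).1 hx) (continuous_expNegFun hT),
    expNegFun_of_pos (by positivity), inv_inv, add_sub_cancel_left]

lemma norm_expNeg_le [Nontrivial F] {T : ℝ} (hT : 0 < T) (P : Mom d) :
    ‖expNeg (Hf P) T‖ ≤ Real.exp (-T * infSpec (Hf P)) := by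
  have hE := (hpos P).infSpec_nonneg
  have h := norm_cfc_expNegFun_le (hpos P).opResolvent_nonneg
    (c := (1 + infSpec (Hf P))⁻¹) (by positivity) (hpos P).norm_opResolvent_eq.le hT.le
  rwa [inv_inv, add_sub_cancel_left, ← expNeg_of_pos _ hT] at h

lemma norm_fiberIntegrand_le [Nontrivial F] {T t : ℝ} (hT : 0 < T) (ht : 0 ≤ t) (k P : Mom d) :
    ‖fiberIntegrand Hf Φ T k t P‖ ≤ Real.exp (-(2 * T) * infSpec (Hf P)) * ‖Φ P‖ ^ 2 := by
  have h1 : ‖expNeg (Hf P) T (Φ P)‖ ≤ Real.exp (-T * infSpec (Hf P)) * ‖Φ P‖ :=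
    ContinuousLinearMap.le_of_opNorm_le _ (norm_expNeg_le hpos hT P) _
  have h2 := ContinuousLinearMap.le_of_opNorm_le _ (norm_expNeg_le_one hpos ht (P + k))
    (expNeg (Hf P) T (Φ P))
  calc _ ≤ ‖expNeg (Hf P) T (Φ P)‖ * (1 * ‖expNeg (Hf P) T (Φ P)‖) :=
        (norm_inner_le_norm _ _).trans (by gcongr)
    _ = ‖expNeg (Hf P) T (Φ P)‖ ^ 2 := by ring
    _ ≤ (Real.exp (-T * infSpec (Hf P)) * ‖Φ P‖) ^ 2 := by gcongr
    _ = _ := by rw [mul_pow, ← Real.exp_nat_mul]; push_cast; ring_nf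

include hcont in
lemma continuous_expNeg {t : ℝ} (ht : 0 ≤ t) : Continuous fun P => expNeg (Hf P) t := by
  rcases ht.eq_or_lt with rfl | ht
  · simp only [expNeg, if_true]
    exact continuous_const
  · have hsa : IsSelfAdjoint (resolventFamily hpos hcont) := by
      ext1 P
      exact IsSelfAdjoint.of_nonneg (hpos P).opResolvent_nonneg
    obtain ⟨B, hB, -⟩ := exists_map_eq_cfc (fun P => evalHom F P) (evalHom F (0 : Mom d)) hsa
      (continuous_expNegFun ht)
    have : (fun P => expNeg (Hf P) t) = B := by
      ext1 P
      rw [expNeg_of_pos _ ht]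
      exact (hB P).symm
    rw [this]
    exact B.continuous

include hcont in
lemma continuous_infSpec [Nontrivial F] : Continuous fun P => infSpec (Hf P) := by
  simp_rw [fun P => (hpos P).infSpec_eq]
  exact (hcont.norm.inv₀ fun P => norm_ne_zero_iff.2 (hpos P).opResolvent_ne_zero).sub
    continuous_const

include hcont in
lemma IsLocalGroundState.continuousAt_groundExpectation (h : IsLocalGroundState Hf ψ P₀) {t : ℝ}
    (ht : 0 ≤ t) (k : Mom d) : ContinuousAt (fun P => groundExpectation Hf ψ P k t) P₀ := by
  obtain ⟨w, hw, hw0, hev⟩ := h.exists_continuousAt_smul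
  have h0 : ‖ψ P₀‖ = 1 := h.norm_eq.self_of_nhds
  have hB : Continuous fun P => expNeg (Hf (P + k)) t :=
    (continuous_expNeg hpos hcont ht).comp (continuous_add_const k)
  have hc : ContinuousAt (fun P => (((‖w P‖ ^ 2 : ℝ) : ℂ))⁻¹ *
      inner ℂ (w P) (expNeg (Hf (P + k)) t (w P))) P₀ := by
    have h1 : ContinuousAt (fun P => (((‖w P‖ ^ 2 : ℝ) : ℂ))⁻¹) P₀ := by
      refine ContinuousAt.inv₀ (Complex.continuous_ofReal.continuousAt.comp (hw.norm.pow 2)) ?_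
      rw [hw0, h0]; simp
    exact h1.mul (hw.inner (𝕜 := ℂ) (hB.continuousAt.clm_apply hw))
  refine hc.congr ?_
  filter_upwards [hev] with P ⟨c, hcw, hcn, hne⟩
  have hne' : (((‖w P‖ ^ 2 : ℝ) : ℂ)) ≠ 0 := by exact_mod_cast hne
  rw [inv_mul_eq_iff_eq_mul₀ hne', ← hcn, hcw, map_smul, inner_smul_left, inner_smul_right,
    ← mul_assoc, ← Complex.normSq_eq_norm_sq, mul_comm _ c, Complex.mul_conj]
  rfl

include hcont in
lemma IsLocalGroundState.continuousAt_groundDensity (h : IsLocalGroundState Hf ψ P₀)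
    (hΦ : ContinuousAt (fun P => ‖(inner ℂ (Φ P) (ψ P) : ℂ)‖) P₀) {t : ℝ} (ht : 0 ≤ t)
    (k : Mom d) : ContinuousAt (groundDensity Hf ψ Φ k t) P₀ :=
  (Complex.continuous_ofReal.continuousAt.comp (hΦ.pow 2)).mul
    (h.continuousAt_groundExpectation hpos hcont ht k)

end

end LocalAnalysis

/-! ### Decay of the excited part near a minimum -/

section LocalAnalysis

variable {d : ℕ} {F : Type*} [NormedAddCommGroup F] [InnerProductSpace ℂ F] [CompleteSpace F]
  {Hf : Mom d → F →ₗ.[ℂ] F} {ψ Φ : Mom d → F} {P₀ : Mom d}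

/-- The semigroup `exp (-T (H(P) - E(P)))`. -/
noncomputable def scaledExp (Hf : Mom d → F →ₗ.[ℂ] F) (T : ℝ) (P : Mom d) : F →L[ℂ] F :=
  ((Real.exp (T * infSpec (Hf P)) : ℝ) : ℂ) • expNeg (Hf P) T

lemma fiberIntegrand_eq_scaledExp (T : ℝ) (k : Mom d) (t : ℝ) (P : Mom d) :
    ((Real.exp (2 * T * infSpec (Hf P)) : ℝ) : ℂ) * fiberIntegrand Hf Φ T k t P =
      inner ℂ (scaledExp Hf T P (Φ P)) (expNeg (Hf (P + k)) t (scaledExp Hf T P (Φ P))) := by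
  simp only [fiberIntegrand, scaledExp, smul_apply, map_smul, inner_smul_left, inner_smul_right,
    Complex.conj_ofReal]
  rw [← mul_assoc, ← Complex.ofReal_mul, ← Real.exp_add]
  ring_nf

omit [CompleteSpace F] in
/-- The difference of two diagonal matrix elements of a contraction. -/
lemma norm_inner_apply_sub_le {B : F →L[ℂ] F} (hB : ‖B‖ ≤ 1) (v u : F) :
    ‖(inner ℂ v (B v) - inner ℂ u (B u) : ℂ)‖ ≤ 2 * ‖u‖ * ‖v - u‖ + ‖v - u‖ ^ 2 := by
  have hBx (x : F) : ‖B x‖ ≤ ‖x‖ := by simpa using B.le_of_opNorm_le hB x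
  have e : (inner ℂ v (B v) - inner ℂ u (B u) : ℂ) =
      inner ℂ (v - u) (B (v - u)) + inner ℂ (v - u) (B u) + inner ℂ u (B (v - u)) := by
    simp only [map_sub, inner_sub_left, inner_sub_right]; ring
  rw [e]
  refine (norm_add₃_le).trans ?_
  have h1 : ‖(inner ℂ (v - u) (B (v - u)) : ℂ)‖ ≤ ‖v - u‖ * ‖v - u‖ :=
    (norm_inner_le_norm _ _).trans (by gcongr; exact hBx _)
  have h2 : ‖(inner ℂ (v - u) (B u) : ℂ)‖ ≤ ‖v - u‖ * ‖u‖ :=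
    (norm_inner_le_norm _ _).trans (by gcongr; exact hBx _)
  have h3 : ‖(inner ℂ u (B (v - u)) : ℂ)‖ ≤ ‖u‖ * ‖v - u‖ :=
    (norm_inner_le_norm _ _).trans (by gcongr; exact hBx _)
  nlinarith

variable [Nontrivial F] (hpos : ∀ P, IsPositiveSelfAdjoint (Hf P))
  (hcont : Continuous fun P => opResolvent (Hf P) (-1))
include hpos

lemma norm_scaledExp_le_one {T : ℝ} (hT : 0 < T) (P : Mom d) : ‖scaledExp Hf T P‖ ≤ 1 := by
  rw [scaledExp, norm_smul, Complex.norm_real, Real.norm_of_nonneg (Real.exp_pos _).le]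
  calc _ ≤ Real.exp (T * infSpec (Hf P)) * Real.exp (-T * infSpec (Hf P)) := by
        gcongr; exact norm_expNeg_le hpos hT P
    _ = 1 := by rw [← Real.exp_add]; simp

lemma scaledExp_groundProj_apply {P : Mom d}
    (hP : (ψ P, (infSpec (Hf P) : ℂ) • ψ P) ∈ (Hf P).graph) {T : ℝ} (hT : 0 < T) (x : F) :
    scaledExp Hf T P (groundProj ψ P x) = groundProj ψ P x := by
  simp only [groundProj, InnerProductSpace.rankOne_apply, map_smul, scaledExp, smul_apply]
  rw [expNeg_apply_eigenvector hpos hT hP, smul_smul (((Real.exp _ : ℝ) : ℂ)), ← Complex.ofReal_mul,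
    ← Real.exp_add]
  simp

omit [Nontrivial F] hpos in
lemma scaledExp_add {s T : ℝ} (hs : 0 < s) (hT : 0 < T) (P : Mom d) :
    scaledExp Hf (s + T) P = scaledExp Hf s P * scaledExp Hf T P := by
  rw [scaledExp, scaledExp, scaledExp, smul_mul_smul_comm, expNeg_of_pos _ hs, expNeg_of_pos _ hT,
    expNeg_of_pos _ (by positivity), cfc_expNegFun_add _ hs hT, ← Complex.ofReal_mul,
    ← Real.exp_add, add_mul]

include hcont in
lemma continuous_scaledExp {T : ℝ} (hT : 0 ≤ T) : Continuous (scaledExp Hf T) :=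
  (Complex.continuous_ofReal.comp (Real.continuous_exp.comp
    (continuous_const.mul (continuous_infSpec hpos hcont)))).smul (continuous_expNeg hpos hcont hT)

include hcont in
/-- If the components of the boundary vector are continuous at a minimum, the evolved components
approach their projections onto the ground states uniformly near the minimum. -/
lemma IsLocalGroundState.eventually_norm_sub_le_of_continuousAt
    (h : IsLocalGroundState Hf ψ P₀) (hΦ : ContinuousAt Φ P₀) {ε : ℝ} (hε : 0 < ε) :
    ∃ T₀ > (0 : ℝ), ∀ᶠ P in 𝓝 P₀, ∀ T ≥ T₀,
      ‖scaledExp Hf T P (Φ P) - groundProj ψ P (Φ P)‖ ≤ ε := by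
  set y : Mom d → F := fun P => Φ P - groundProj ψ P (Φ P) with hy
  have hyc : ContinuousAt y P₀ := hΦ.sub (h.continuousAt_groundProj.clm_apply hΦ)
  have h0 : ‖ψ P₀‖ = 1 := h.norm_eq.self_of_nhds
  have hE0 := (hpos P₀).infSpec_nonneg
  have horth : ∀ x : F, opResolvent (Hf P₀) (-1) x = (((1 + infSpec (Hf P₀))⁻¹ : ℝ) : ℂ) • x →
      inner ℂ x (y P₀) = 0 := by
    intro x hx
    obtain ⟨c, rfl⟩ := h.simple x (((hpos P₀).opResolvent_eigenvector_iff hE0).2 hx)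
    simp only [hy, groundProj, InnerProductSpace.rankOne_apply, inner_smul_left, inner_sub_right,
      inner_smul_right, inner_self_eq_norm_sq_to_K, h0]
    simp only [Complex.coe_algebraMap, Complex.ofReal_one, one_pow, mul_one]
    ring
  have hlim := tendsto_exp_smul_cfc_expNegFun_apply (hpos P₀).opResolvent_nonneg
    (c := (1 + infSpec (Hf P₀))⁻¹) (by positivity) (inv_le_one_of_one_le₀ (by linarith))
    (hpos P₀).norm_opResolvent_eq.le horth
  obtain ⟨T₀, hT₀, hT₀1⟩ := ((hlim.eventually_lt_const hε).and (eventually_gt_atTop 0)).exists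
  rw [← expNeg_of_pos _ hT₀1, inv_inv, add_sub_cancel_left] at hT₀
  have hev : ∀ᶠ P in 𝓝 P₀, ‖scaledExp Hf T₀ P (y P)‖ < ε :=
    ((continuous_scaledExp hpos hcont hT₀1.le).continuousAt.clm_apply hyc).norm.eventually_lt
      continuousAt_const hT₀
  refine ⟨T₀, hT₀1, ?_⟩
  filter_upwards [hev, h.eigenvector] with P h1 h2 T hT
  -- The rescaled semigroup is a contraction, so smallness at `T₀` persists at later times.
  have h3 : ‖scaledExp Hf T P (y P)‖ ≤ ε := by
    rcases hT.lt_or_eq with hT | rfl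
    · rw [← sub_add_cancel T T₀, scaledExp_add (sub_pos.2 hT) hT₀1, mul_apply_eq_comp]
      refine (ContinuousLinearMap.le_of_opNorm_le _
        (norm_scaledExp_le_one hpos (sub_pos.2 hT) P) _).trans ?_
      rw [one_mul]; exact h1.le
    · exact h1.le
  rwa [hy, map_sub, scaledExp_groundProj_apply hpos h2 (hT₀1.trans_le hT)] at h3

include hcont in
/-- If the ground state energy is isolated at a minimum, the evolved components approach their
projections onto the ground states exponentially fast near the minimum. -/
lemma IsLocalGroundState.eventually_norm_sub_le_of_isolated
    (h : IsLocalGroundState Hf ψ P₀) {g : ℝ} (hg : 0 < g)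
    (hiso : ∀ x : ℝ, (x : ℂ) ∈ opSpectrum (Hf P₀) →
      x = infSpec (Hf P₀) ∨ infSpec (Hf P₀) + g ≤ x) :
    ∃ g' > (0 : ℝ), ∀ᶠ P in 𝓝 P₀, ∀ T > 0,
      ‖scaledExp Hf T P (Φ P) - groundProj ψ P (Φ P)‖ ≤ Real.exp (-g' * T) * ‖Φ P‖ := by
  set E : Mom d → ℝ := fun P => infSpec (Hf P) with hE
  have hE0 (P : Mom d) : 0 ≤ E P := (hpos P).infSpec_nonneg
  have hEc : Continuous E := continuous_infSpec hpos hcont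
  set c : Mom d → ℝ := fun P => (1 + E P)⁻¹ with hc
  have hcc : Continuous c := (continuous_const.add hEc).inv₀ fun P =>
    (by have := hE0 P; linarith : (0 : ℝ) < 1 + E P).ne'
  set b : ℝ := (1 + E P₀ + g)⁻¹ with hb
  have hb0 : 0 < b := by have := hE0 P₀; positivity
  have hbc : b < c P₀ := inv_strictAnti₀ (by have := hE0 P₀; positivity) (by linarith)
  have hspec : ∀ r ∈ spectrum ℝ (opResolvent (Hf P₀) (-1)), r = c P₀ ∨ r ≤ b := by
    intro r hr
    have hr0 := (spectrum_subset_of_nonneg (hpos P₀).opResolvent_nonneg hr).1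
    rcases hr0.eq_or_lt with rfl | hr0
    · exact Or.inr hb0.le
    rcases hiso _ (((hpos P₀).mem_spectrum_opResolvent_iff hr0.ne').1 hr) with h1 | h1
    · left
      rw [hc, ← inv_inv r]
      simp only [hE]
      rw [← h1]; ring_nf
    · right
      rw [hb, ← inv_inv r]
      refine inv_anti₀ (by have := hE0 P₀; positivity) ?_
      simp only [hE]
      linarith
  -- The resolvent without its ground state part is bounded by `b` at `P₀`, hence nearby by some
  -- `b₁ > b`, while `c P`, the largest spectral value, stays above some `b₂ > b₁`.
  set N : Mom d → F →L[ℂ] F := fun P => opResolvent (Hf P) (-1) - (c P : ℂ) • groundProj ψ P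
  have hN0 : ‖N P₀‖ ≤ b := norm_sub_rankOne_le (hpos P₀).opResolvent_nonneg
    h.norm_eq.self_of_nhds hb0.le hbc
    (((hpos P₀).opResolvent_eigenvector_iff (hE0 P₀)).1 h.eigenvector.self_of_nhds) hspec
    fun x hx => h.simple x (((hpos P₀).opResolvent_eigenvector_iff (hE0 P₀)).2 hx)
  have hNc : ContinuousAt N P₀ := hcont.continuousAt.sub
    ((Complex.continuous_ofReal.comp hcc).continuousAt.smul h.continuousAt_groundProj)
  obtain ⟨b₁, hb₁, hb₁c⟩ := exists_between hbc
  obtain ⟨b₂, hb₂, hb₂c⟩ := exists_between hb₁c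
  have hb₁0 := hb0.trans hb₁
  refine ⟨b₁⁻¹ - b₂⁻¹, sub_pos.2 (inv_strictAnti₀ hb₁0 hb₂), ?_⟩
  filter_upwards [hNc.norm.eventually_lt continuousAt_const (hN0.trans_lt hb₁),
    continuousAt_const.eventually_lt hcc.continuousAt hb₂c, h.norm_eq, h.eigenvector]
    with P h1 h2 h3 h4 T hT
  have h5 := norm_cfc_expNegFun_mul_one_sub_le (hpos P).opResolvent_nonneg h3
    (((hpos P).opResolvent_eigenvector_iff (hE0 P)).1 h4) hb₁0 h1.le hT
  have h6 : 1 + E P < b₂⁻¹ := by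
    rw [← inv_inv (1 + E P)]
    exact inv_strictAnti₀ (hb₁0.trans hb₂) h2
  have h7 : scaledExp Hf T P (Φ P) - groundProj ψ P (Φ P) = ((Real.exp (T * E P) : ℝ) : ℂ) •
      (cfc (expNegFun T) (opResolvent (Hf P) (-1)) * (1 - groundProj ψ P)) (Φ P) := by
    conv_lhs => rw [← scaledExp_groundProj_apply hpos h4 hT (Φ P), ← map_sub]
    rw [← expNeg_of_pos _ hT]
    rfl
  rw [h7, norm_smul, Complex.norm_real, Real.norm_of_nonneg (Real.exp_pos _).le]
  calc _ ≤ Real.exp (T * E P) * (Real.exp (-T * (b₁⁻¹ - 1)) * ‖Φ P‖) := by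
        gcongr
        exact ContinuousLinearMap.le_of_opNorm_le _ h5 _
    _ = Real.exp (T * E P + -T * (b₁⁻¹ - 1)) * ‖Φ P‖ := by rw [Real.exp_add]; ring
    _ ≤ Real.exp (-(b₁⁻¹ - b₂⁻¹) * T) * ‖Φ P‖ := by
        gcongr
        nlinarith

include hcont in
/-- The integrand near a minimum: up to a small error and an exponentially decaying one, it is
`exp (-2 T E(P))` times the density of the ground state contribution at the minimum. -/
lemma IsLocalGroundState.eventually_norm_fiberIntegrand_sub_le
    (h : IsLocalGroundState Hf ψ P₀)
    (hov : ContinuousAt (fun P => ‖(inner ℂ (Φ P) (ψ P) : ℂ)‖) P₀)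
    (hΦ : ContinuousAt Φ P₀ ∨ ∃ g > (0 : ℝ), ∀ x : ℝ, (x : ℂ) ∈ opSpectrum (Hf P₀) →
      x = infSpec (Hf P₀) ∨ infSpec (Hf P₀) + g ≤ x)
    {t : ℝ} (ht : 0 ≤ t) (k : Mom d) {ε : ℝ} (hε : 0 < ε) :
    ∃ g > (0 : ℝ), ∃ T₀ > (0 : ℝ), ∀ᶠ P in 𝓝 P₀, ∀ T ≥ T₀,
      ‖((Real.exp (2 * T * infSpec (Hf P)) : ℝ) : ℂ) * fiberIntegrand Hf Φ T k t P -
        groundDensity Hf ψ Φ k t P₀‖ ≤ ε + 3 * (Real.exp (-g * T) * ‖Φ P‖ ^ 2) := by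
  have hdens : ∀ᶠ P in 𝓝 P₀,
      ‖groundDensity Hf ψ Φ k t P - groundDensity Hf ψ Φ k t P₀‖ < ε / 2 := by
    have := (h.continuousAt_groundDensity hpos hcont hov ht k).eventually
      (Metric.ball_mem_nhds _ (half_pos hε))
    filter_upwards [this] with P hP
    rwa [← dist_eq_norm]
  have hmain (P : Mom d) (T : ℝ) := norm_inner_apply_sub_le
    (norm_expNeg_le_one hpos ht (P + k)) (scaledExp Hf T P (Φ P)) (groundProj ψ P (Φ P))
  simp_rw [← fiberIntegrand_eq_scaledExp, ← groundDensity_eq] at hmain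
  have htri (P : Mom d) (z : ℂ) {a : ℝ}
      (h1 : ‖groundDensity Hf ψ Φ k t P - groundDensity Hf ψ Φ k t P₀‖ < ε / 2)
      (h2 : ‖z - groundDensity Hf ψ Φ k t P‖ ≤ a) :
      ‖z - groundDensity Hf ψ Φ k t P₀‖ ≤ ε / 2 + a := by
    refine (norm_sub_le_norm_sub_add_norm_sub z (groundDensity Hf ψ Φ k t P) _).trans ?_
    linarith
  rcases hΦ with hΦ | ⟨g, hg, hiso⟩
  -- Both errors are small near `P₀`; the exponential term, with any rate, is not needed.
  · set M : ℝ := ‖Φ P₀‖ + 1 with hM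
    have hM0 : 0 < M := by positivity
    have hMev : ∀ᶠ P in 𝓝 P₀, ‖Φ P‖ < M :=
      hΦ.norm.eventually_lt continuousAt_const (lt_add_one _)
    set η : ℝ := min 1 (ε / 2 / (2 * M + 1)) with hη
    have hη0 : 0 < η := by positivity
    have hη1 : η ≤ 1 := min_le_left _ _
    have hη2 : η * (2 * M + 1) ≤ ε / 2 := by
      rw [← le_div_iff₀ (by positivity)]; exact min_le_right _ _
    obtain ⟨T₀, hT₀, hev⟩ := h.eventually_norm_sub_le_of_continuousAt hpos hcont hΦ hη0
    refine ⟨1, one_pos, T₀, hT₀, ?_⟩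
    filter_upwards [hdens, hMev, hev, h.norm_eq] with P h1 h2 h3 h4 T hT
    have h5 : ‖groundProj ψ P (Φ P)‖ ≤ M := (norm_groundProj_apply_le h4 _).trans h2.le
    refine (htri P _ h1 (hmain P T)).trans ?_
    have h6 := h3 T hT
    have h7 := norm_nonneg (scaledExp Hf T P (Φ P) - groundProj ψ P (Φ P))
    have h8 : 2 * ‖groundProj ψ P (Φ P)‖ * ‖scaledExp Hf T P (Φ P) - groundProj ψ P (Φ P)‖ ≤
        2 * M * η := by gcongr
    have h9 : ‖scaledExp Hf T P (Φ P) - groundProj ψ P (Φ P)‖ ^ 2 ≤ η := by nlinarith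
    have h10 : 0 ≤ 3 * (Real.exp (-1 * T) * ‖Φ P‖ ^ 2) := by positivity
    nlinarith
  · obtain ⟨g', hg', hev⟩ := h.eventually_norm_sub_le_of_isolated (Φ := Φ) hpos hcont hg hiso
    refine ⟨g', hg', 1, one_pos, ?_⟩
    filter_upwards [hdens, hev, h.norm_eq] with P h1 h3 h4 T hT
    have hT0 : 0 < T := by linarith
    have h5 : ‖groundProj ψ P (Φ P)‖ ≤ ‖Φ P‖ := norm_groundProj_apply_le h4 _
    refine (htri P _ h1 (hmain P T)).trans ?_
    have h6 := h3 T hT0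
    have h8 : 2 * ‖groundProj ψ P (Φ P)‖ * ‖scaledExp Hf T P (Φ P) - groundProj ψ P (Φ P)‖ ≤
        2 * ‖Φ P‖ * (Real.exp (-g' * T) * ‖Φ P‖) := by gcongr
    have h9 : ‖scaledExp Hf T P (Φ P) - groundProj ψ P (Φ P)‖ ^ 2 ≤
        Real.exp (-g' * T) * ‖Φ P‖ ^ 2 := by
      calc _ ≤ (Real.exp (-g' * T) * ‖Φ P‖) ^ 2 := by gcongr
        _ = Real.exp (-g' * T) * (Real.exp (-g' * T) * ‖Φ P‖ ^ 2) := by ring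
        _ ≤ 1 * (Real.exp (-g' * T) * ‖Φ P‖ ^ 2) := by
          gcongr
          exact Real.exp_le_one_iff.2 (by nlinarith)
        _ = _ := one_mul _
    nlinarith

end LocalAnalysis

/-! ### Polar coordinates and the method of Laplace -/

section Polar

/-- Integration in polar coordinates of a function that is a product of an angular and a radial
part. -/
lemma integral_eq_of_polar {𝕜 : Type*} [RCLike 𝕜] {d : ℕ} (hd : 1 ≤ d) {h : Mom d → 𝕜}
    {f : ℝ → 𝕜} {g : Metric.sphere (0 : Mom d) 1 → 𝕜}
    (hfg : ∀ (u : Metric.sphere (0 : Mom d) 1) (r : ℝ), 0 < r → h (r • (u : Mom d)) = g u * f r) :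
    ∫ P, h P = (∫ u, g u ∂((volume : Measure (Mom d)).toSphere)) *
      ∫ r in Set.Ioi (0 : ℝ), ((r ^ (d - 1) : ℝ) : 𝕜) * f r := by
  have : Nonempty (Fin d) := ⟨⟨0, hd⟩⟩
  have hmp := (volume : Measure (Mom d)).measurePreserving_homeomorphUnitSphereProd
  rw [finrank_euclideanSpace_fin] at hmp
  calc ∫ P, h P = ∫ P : ({(0 : Mom d)}ᶜ : Set (Mom d)), h P ∂(volume.comap Subtype.val) := by
        rw [integral_subtype_comap (measurableSet_singleton _).compl fun P => h P,
          restrict_compl_singleton]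
    _ = ∫ z : Metric.sphere (0 : Mom d) 1 × Set.Ioi (0 : ℝ), g z.1 * f z.2
          ∂((volume : Measure (Mom d)).toSphere.prod (Measure.volumeIoiPow (d - 1))) := by
        rw [← hmp.integral_comp (Homeomorph.measurableEmbedding _)]
        refine integral_congr_ae (Eventually.of_forall fun P => ?_)
        simp only
        rw [← hfg _ _ (homeomorphUnitSphereProd (Mom d) P).2.2]
        congr 1
        have h1 := homeomorphUnitSphereProd_symm_apply_coe (E := Mom d)
          (homeomorphUnitSphereProd (Mom d) P)
        rw [Homeomorph.symm_apply_apply] at h1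
        exact h1
    _ = (∫ u, g u ∂((volume : Measure (Mom d)).toSphere)) *
          ∫ r : Set.Ioi (0 : ℝ), f r ∂(Measure.volumeIoiPow (d - 1)) :=
        integral_prod_mul g fun r : Set.Ioi (0 : ℝ) => f r
    _ = _ := by
        congr 1
        simp only [Measure.volumeIoiPow, ENNReal.ofReal]
        rw [integral_withDensity_eq_integral_smul, ← integral_subtype_comap measurableSet_Ioi
          fun r : ℝ => ((r ^ (d - 1) : ℝ) : 𝕜) * f r]
        · refine integral_congr_ae (Eventually.of_forall fun r => ?_)
          simp only
          rw [NNReal.smul_def, Real.coe_toNNReal _ (pow_nonneg r.2.out.le _),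
            RCLike.real_smul_eq_coe_mul]
        · exact ((measurable_subtype_coe).pow_const _).real_toNNReal

end Polar

section Laplace

/-- A nonnegative function that vanishes at `q` to order `n` with a nonzero coefficient has a
positive coefficient, and the power may be replaced by a power of the distance. -/
lemma pos_and_tendsto_div_abs_pow {e : ℝ → ℝ} {q a : ℝ} {n : ℕ} (hq : 0 ≤ q) (ha : a ≠ 0)
    (he : ∀ r, 0 ≤ e r)
    (hequiv : Asymptotics.IsEquivalent (𝓝[{R | 0 ≤ q + R}] 0) (fun R => e (q + R))
      (fun R => a * R ^ n)) :
    0 < a ∧ Tendsto (fun R => e (q + R) / |R| ^ n) (𝓝[{R | 0 ≤ q + R} \ {0}] 0) (𝓝 a) := by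
  obtain ⟨φ, hφ, hφe⟩ := hequiv.exists_eq_mul
  have hφpos : ∀ᶠ R in 𝓝[{R | 0 ≤ q + R}] 0, 0 < φ R := hφ.eventually_const_lt one_pos
  have hle : 𝓝[>] (0 : ℝ) ≤ 𝓝[{R | 0 ≤ q + R}] 0 :=
    nhdsWithin_mono _ fun R (hR : 0 < R) => add_nonneg hq hR.le
  have ha0 : 0 < a := by
    obtain ⟨R, ⟨h1, h2⟩, h3⟩ := (((hφpos.and hφe).filter_mono hle).and
      self_mem_nhdsWithin).exists
    have hR : 0 < R := h3
    refine lt_of_le_of_ne ?_ ha.symm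
    have h4 := he (q + R)
    rw [show e (q + R) = φ R * (a * R ^ n) from h2] at h4
    by_contra hneg
    have : φ R * (a * R ^ n) < 0 :=
      mul_neg_of_pos_of_neg h1 (mul_neg_of_neg_of_pos (not_le.1 hneg) (pow_pos hR n))
    linarith
  refine ⟨ha0, ?_⟩
  have hle' : 𝓝[{R | 0 ≤ q + R} \ {0}] (0 : ℝ) ≤ 𝓝[{R | 0 ≤ q + R}] 0 :=
    nhdsWithin_mono _ Set.sdiff_subset
  have hlim : Tendsto (fun R => φ R * a) (𝓝[{R | 0 ≤ q + R} \ {0}] 0) (𝓝 a) := by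
    simpa using (hφ.mono_left hle').mul_const a
  refine hlim.congr' ?_
  filter_upwards [hφpos.filter_mono hle', hφe.filter_mono hle', self_mem_nhdsWithin]
    with R h1 h2 h3
  have h4 := he (q + R)
  have h2' : e (q + R) = φ R * (a * R ^ n) := h2
  rw [h2'] at h4 ⊢
  have h5 : 0 ≤ R ^ n := by
    have := (mul_nonneg_iff_of_pos_left h1).1 h4
    exact (mul_nonneg_iff_of_pos_left ha0).1 this
  have h6 : |R| ^ n = R ^ n := by rw [← abs_pow, abs_of_nonneg h5]
  have h7 : R ^ n ≠ 0 := pow_ne_zero _ h3.2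
  rw [h6]
  field_simp

/-- The integrand `exp (-2 T e(r))`, restricted to the positive radii in the shell of thickness `δ`
around `q`, in the rescaled variable `s` with `r = q + T ^ (-1 / n) s`. -/
noncomputable def laplaceKernel (e : ℝ → ℝ) (q δ : ℝ) (n : ℕ) (T s : ℝ) : ℝ :=
  {s : ℝ | 0 < q + T ^ (-(n : ℝ)⁻¹) * s ∧ |T ^ (-(n : ℝ)⁻¹) * s| < δ}.indicator
    (fun s => Real.exp (-(2 * T) * e (q + T ^ (-(n : ℝ)⁻¹) * s))) s

/-- The limit `exp (-2 a |s| ^ n)` of the rescaled integrand; it lives on a half line if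
`q = 0`. -/
noncomputable def laplaceLimit (q a : ℝ) (n : ℕ) (s : ℝ) : ℝ :=
  {s : ℝ | 0 < q ∨ 0 < s}.indicator (fun s => Real.exp (-(2 * a) * |s| ^ n)) s

lemma mul_rpow_neg_inv_pow {T : ℝ} (hT : 0 < T) {n : ℕ} (hn : n ≠ 0) :
    T * (T ^ (-(n : ℝ)⁻¹)) ^ n = 1 := by
  rw [← Real.rpow_natCast, ← Real.rpow_mul hT.le, neg_mul, inv_mul_cancel₀ (by exact_mod_cast hn),
    Real.rpow_neg_one, mul_inv_cancel₀ hT.ne']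

lemma measurable_laplaceKernel {e : ℝ → ℝ} (he : Continuous e) (q δ : ℝ) (n : ℕ) (T : ℝ) :
    Measurable (laplaceKernel e q δ n T) := by
  refine Measurable.indicator (by fun_prop) ?_
  refine MeasurableSet.inter ?_ ?_
  · exact measurableSet_lt (f := fun _ => (0 : ℝ)) (g := fun s => q + T ^ (-(n : ℝ)⁻¹) * s)
      measurable_const (by fun_prop)
  · exact measurableSet_lt (f := fun s => |T ^ (-(n : ℝ)⁻¹) * s|) (g := fun _ => δ)
      (by fun_prop) measurable_const

lemma laplaceKernel_nonneg (e : ℝ → ℝ) (q δ : ℝ) (n : ℕ) (T s : ℝ) :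
    0 ≤ laplaceKernel e q δ n T s :=
  Set.indicator_nonneg (fun _ _ => (Real.exp_pos _).le) _

lemma sq_sub_one_le_abs_pow {n : ℕ} (hn : 2 ≤ n) (s : ℝ) : s ^ 2 - 1 ≤ |s| ^ n := by
  rcases le_total 1 |s| with h | h
  · have := pow_le_pow_right₀ h hn
    rw [sq_abs] at this
    linarith
  · have h4 : s ^ 2 ≤ 1 := by rw [← sq_abs]; exact pow_le_one₀ (abs_nonneg s) h
    have : 0 ≤ |s| ^ n := by positivity
    linarith

/-- A Gaussian bound, uniform in `T`: orders `n ≥ 2` decay at least like the order `2`. -/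
lemma laplaceKernel_le {e : ℝ → ℝ} {q a δ : ℝ} {n : ℕ} (hn : 2 ≤ n) (ha : 0 < a)
    (hbound : ∀ R, |R| < δ → 0 ≤ q + R → a / 2 * |R| ^ n ≤ e (q + R)) {T : ℝ} (hT : 0 < T)
    (s : ℝ) : laplaceKernel e q δ n T s ≤ Real.exp a * Real.exp (-a * s ^ 2) := by
  unfold laplaceKernel
  refine Set.indicator_apply_le' (fun hs => ?_) (fun _ => by positivity)
  obtain ⟨hs1, hs2⟩ := hs
  rw [← Real.exp_add, Real.exp_le_exp]
  have h1 := hbound _ hs2 hs1.le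
  rw [abs_mul, abs_of_pos (Real.rpow_pos_of_pos hT _), mul_pow] at h1
  have h2 := mul_rpow_neg_inv_pow hT (n := n) (by omega)
  have h3 := sq_sub_one_le_abs_pow hn s
  have h5 : a * |s| ^ n ≤ 2 * T * e (q + T ^ (-(n : ℝ)⁻¹) * s) := by
    calc a * |s| ^ n = 2 * T * (a / 2 * ((T ^ (-(n : ℝ)⁻¹)) ^ n * |s| ^ n)) := by
          linear_combination (-a * |s| ^ n) * h2
      _ ≤ _ := by gcongr
  nlinarith

lemma tendsto_rpow_neg_inv_mul {n : ℕ} (hn : 2 ≤ n) (s : ℝ) :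
    Tendsto (fun T : ℝ => T ^ (-(n : ℝ)⁻¹) * s) atTop (𝓝 0) := by
  have := (tendsto_rpow_neg_atTop (y := (n : ℝ)⁻¹) (by positivity)).mul_const s
  simpa using this

lemma tendsto_laplaceKernel {e : ℝ → ℝ} {q a δ : ℝ} {n : ℕ} (hn : 2 ≤ n) (hq : 0 ≤ q)
    (hδ : 0 < δ)
    (hlim : Tendsto (fun R => e (q + R) / |R| ^ n) (𝓝[{R | 0 ≤ q + R} \ {0}] 0) (𝓝 a))
    {s : ℝ} (hs : s ≠ 0) :
    Tendsto (fun T => laplaceKernel e q δ n T s) atTop (𝓝 (laplaceLimit q a n s)) := by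
  have hR := tendsto_rpow_neg_inv_mul hn s
  by_cases hqs : 0 < q ∨ 0 < s
  · have hmem : ∀ᶠ T : ℝ in atTop, 0 < q + T ^ (-(n : ℝ)⁻¹) * s := by
      rcases hqs with h | h
      · have h2 : Tendsto (fun T : ℝ => q + T ^ (-(n : ℝ)⁻¹) * s) atTop (𝓝 q) := by
          simpa using hR.const_add q
        exact h2.eventually_const_lt h
      · filter_upwards [eventually_gt_atTop 0] with T hT
        have := Real.rpow_pos_of_pos hT (-(n : ℝ)⁻¹)
        positivity
    have hmem2 : ∀ᶠ T : ℝ in atTop, |T ^ (-(n : ℝ)⁻¹) * s| < δ := by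
      have := hR.abs
      rw [abs_zero] at this
      exact this.eventually_lt_const hδ
    have hR' : Tendsto (fun T : ℝ => T ^ (-(n : ℝ)⁻¹) * s) atTop
        (𝓝[{R | 0 ≤ q + R} \ {0}] 0) := by
      refine tendsto_nhdsWithin_iff.2 ⟨hR, ?_⟩
      filter_upwards [hmem, eventually_gt_atTop 0] with T h1 h2
      exact ⟨h1.le, mul_ne_zero (Real.rpow_pos_of_pos h2 _).ne' hs⟩
    have hL : laplaceLimit q a n s = Real.exp (-(2 * a) * |s| ^ n) :=
      Set.indicator_of_mem (s := {s : ℝ | 0 < q ∨ 0 < s}) hqs _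
    rw [hL]
    have h1 : Tendsto (fun T : ℝ => Real.exp (-(2 * (e (q + T ^ (-(n : ℝ)⁻¹) * s) /
        |T ^ (-(n : ℝ)⁻¹) * s| ^ n)) * |s| ^ n)) atTop (𝓝 (Real.exp (-(2 * a) * |s| ^ n))) :=
      (Real.continuous_exp.tendsto _).comp (((hlim.comp hR').const_mul 2).neg.mul_const _)
    refine h1.congr' ?_
    filter_upwards [hmem, hmem2, eventually_gt_atTop 0] with T h2 h3 h4
    rw [laplaceKernel, Set.indicator_of_mem
      (s := {s : ℝ | 0 < q + T ^ (-(n : ℝ)⁻¹) * s ∧ |T ^ (-(n : ℝ)⁻¹) * s| < δ}) ⟨h2, h3⟩]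
    congr 1
    have h5 := mul_rpow_neg_inv_pow h4 (n := n) (by omega)
    have h6 : (T ^ (-(n : ℝ)⁻¹)) ^ n ≠ 0 := fun h => by rw [h, mul_zero] at h5; exact zero_ne_one h5
    have h7 : |s| ^ n ≠ 0 := pow_ne_zero _ (abs_ne_zero.2 hs)
    rw [abs_mul, abs_of_pos (Real.rpow_pos_of_pos h4 _), mul_pow]
    rw [div_eq_mul_inv, mul_inv, ← eq_inv_of_mul_eq_one_left h5]
    field_simp
  · have hL : laplaceLimit q a n s = 0 :=
      Set.indicator_of_notMem (s := {s : ℝ | 0 < q ∨ 0 < s}) hqs _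
    rw [hL]
    refine tendsto_const_nhds.congr' ?_
    push Not at hqs
    have hq0 : q = 0 := le_antisymm hqs.1 hq
    filter_upwards [eventually_gt_atTop 0] with T hT
    rw [laplaceKernel, Set.indicator_of_notMem]
    rintro ⟨h1, -⟩
    rw [hq0, zero_add] at h1
    exact absurd (pos_of_mul_pos_right h1 (Real.rpow_pos_of_pos hT _).le) (not_lt.2 hqs.2)

lemma integrable_abs_pow_mul_exp {a : ℝ} (ha : 0 < a) (j : ℕ) :
    Integrable fun s : ℝ => |s| ^ j * Real.exp (-a * s ^ 2) := by
  have h := (integrable_rpow_mul_exp_neg_mul_sq ha (s := j) (by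
    have : (0 : ℝ) ≤ j := j.cast_nonneg
    linarith)).norm
  refine h.congr (Eventually.of_forall fun s => ?_)
  simp [Real.rpow_natCast]

/-- Laplace's method in the rescaled variable, by dominated convergence. -/
lemma tendsto_integral_mul_laplaceKernel {e : ℝ → ℝ} (hec : Continuous e) {q a δ : ℝ} {n : ℕ}
    (hn : 2 ≤ n) (hq : 0 ≤ q) (ha : 0 < a) (hδ : 0 < δ)
    (hbound : ∀ R, |R| < δ → 0 ≤ q + R → a / 2 * |R| ^ n ≤ e (q + R))
    (hlim : Tendsto (fun R => e (q + R) / |R| ^ n) (𝓝[{R | 0 ≤ q + R} \ {0}] 0) (𝓝 a))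
    {w : ℝ → ℝ → ℝ} {w₀ : ℝ → ℝ} (hwm : ∀ T, Measurable (w T)) {C : ℝ} {j : ℕ}
    (hw : ∀ T > 0, ∀ s, laplaceKernel e q δ n T s ≠ 0 → |w T s| ≤ C * |s| ^ j)
    (hwlim : ∀ s, Tendsto (fun T => w T s) atTop (𝓝 (w₀ s))) :
    Tendsto (fun T => ∫ s, w T s * laplaceKernel e q δ n T s) atTop
      (𝓝 (∫ s, w₀ s * laplaceLimit q a n s)) := by
  refine tendsto_integral_filter_of_dominated_convergence
    (fun s => |C| * Real.exp a * (|s| ^ j * Real.exp (-a * s ^ 2))) ?_ ?_ ?_ ?_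
  · exact Eventually.of_forall fun T =>
      ((hwm T).mul (measurable_laplaceKernel hec q δ n T)).aestronglyMeasurable
  · filter_upwards [eventually_gt_atTop 0] with T hT
    refine Eventually.of_forall fun s => ?_
    rw [norm_mul, Real.norm_eq_abs, Real.norm_of_nonneg (laplaceKernel_nonneg _ _ _ _ _ _)]
    by_cases h0 : laplaceKernel e q δ n T s = 0
    · rw [h0, mul_zero]; positivity
    · calc _ ≤ (|C| * |s| ^ j) * (Real.exp a * Real.exp (-a * s ^ 2)) := by
            refine mul_le_mul ((hw T hT s h0).trans ?_) (laplaceKernel_le hn ha hbound hT s)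
              (laplaceKernel_nonneg _ _ _ _ _ _) (by positivity)
            gcongr
            exact le_abs_self C
        _ = _ := by ring
  · exact (integrable_abs_pow_mul_exp ha j).const_mul _
  · have : ∀ᵐ s : ℝ, s ≠ 0 := by simp [ae_iff]
    filter_upwards [this] with s hs
    exact (hwlim s).mul (tendsto_laplaceKernel hn hq hδ hlim hs)

/-- The integral over a thin shell in the radial variable and the rescaled integral. -/
lemma integral_shell_eq (e : ℝ → ℝ) (q δ : ℝ) (n m : ℕ) {T : ℝ} (hT : 0 < T) :
    ∫ r in Set.Ioi (0 : ℝ), r ^ m *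
        {r : ℝ | |r - q| < δ}.indicator (fun r => Real.exp (-(2 * T) * e r)) r =
      T ^ (-(n : ℝ)⁻¹) * ∫ s, (q + T ^ (-(n : ℝ)⁻¹) * s) ^ m * laplaceKernel e q δ n T s := by
  set b := T ^ (-(n : ℝ)⁻¹) with hb
  have hb0 : 0 < b := Real.rpow_pos_of_pos hT _
  rw [← integral_indicator measurableSet_Ioi]
  set G : ℝ → ℝ := (Set.Ioi (0 : ℝ)).indicator fun r => r ^ m *
    {r : ℝ | |r - q| < δ}.indicator (fun r => Real.exp (-(2 * T) * e r)) r with hG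
  have h1 : ∀ s, (q + b * s) ^ m * laplaceKernel e q δ n T s = G (q + b * s) := by
    intro s
    simp only [laplaceKernel, hG, Set.indicator_apply, Set.mem_ofPred_eq, Set.mem_Ioi, ← hb,
      add_sub_cancel_left]
    by_cases h1 : 0 < q + b * s <;> by_cases h2 : |b * s| < δ <;>
      simp only [h1, h2, and_true, and_false, if_true, if_false, mul_zero]
  simp_rw [h1]
  rw [Measure.integral_comp_mul_left (fun x => G (q + x)) b, integral_add_left_eq_self,
    abs_of_pos (inv_pos.2 hb0), smul_eq_mul, mul_inv_cancel_left₀ hb0.ne']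

/-- The exponent `α` such that the contribution of a shell of minima of radius `q` and order `n`
decays like `T ^ (-α)`. -/
noncomputable def shellExponent (q : ℝ) (d n : ℕ) : ℝ :=
  if q = 0 then (d : ℝ) / n else 1 / n

/-- **Laplace's method** for the radial integral over a thin shell around a minimum. The limit does
not depend on the thickness of the shell. -/
lemma exists_tendsto_shell {e : ℝ → ℝ} (hec : Continuous e) (he : ∀ r, 0 ≤ e r) {q a : ℝ} {n : ℕ}
    (hn : 2 ≤ n) (hq : 0 ≤ q) (ha : a ≠ 0) {d : ℕ} (hd : 1 ≤ d)
    (hequiv : Asymptotics.IsEquivalent (𝓝[{R | 0 ≤ q + R}] 0) (fun R => e (q + R))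
      (fun R => a * R ^ n)) :
    ∃ δ₀ > (0 : ℝ), ∃ c > (0 : ℝ), ∀ δ > 0, δ ≤ δ₀ →
      Tendsto (fun T : ℝ => T ^ shellExponent q d n * ∫ r in Set.Ioi (0 : ℝ), r ^ (d - 1) *
        {r : ℝ | |r - q| < δ}.indicator (fun r => Real.exp (-(2 * T) * e r)) r) atTop (𝓝 c) := by
  obtain ⟨ha0, hlim⟩ := pos_and_tendsto_div_abs_pow hq ha he hequiv
  obtain ⟨δ₀, hδ₀, hbound⟩ : ∃ δ₀ > (0 : ℝ), ∀ R, |R| < δ₀ → 0 ≤ q + R →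
      a / 2 * |R| ^ n ≤ e (q + R) := by
    have h1 := hlim.eventually_const_lt (half_lt_self ha0)
    obtain ⟨δ₀, hδ₀, h2⟩ := Metric.mem_nhdsWithin_iff.1 h1
    refine ⟨δ₀, hδ₀, fun R hR hqR => ?_⟩
    rcases eq_or_ne R 0 with rfl | hR0
    · simpa [show n ≠ 0 by omega] using he (q + 0)
    · have h3 : a / 2 < e (q + R) / |R| ^ n := h2 ⟨by simpa using hR, hqR, hR0⟩
      rw [lt_div_iff₀ (pow_pos (abs_pos.2 hR0) n)] at h3
      exact h3.le
  have hlap_pos (s : ℝ) (hs : 0 < s) : 0 < laplaceLimit q a n s := by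
    rw [laplaceLimit, Set.indicator_of_mem (s := {s : ℝ | 0 < q ∨ 0 < s}) (Or.inr hs)]
    exact Real.exp_pos _
  have hlap_nonneg (s : ℝ) : 0 ≤ laplaceLimit q a n s :=
    Set.indicator_nonneg (fun _ _ => (Real.exp_pos _).le) _
  have hlap_le (s : ℝ) : laplaceLimit q a n s ≤ Real.exp (2 * a) * Real.exp (-(2 * a) * s ^ 2) := by
    refine Set.indicator_apply_le' (fun _ => ?_) (fun _ => by positivity)
    rw [← Real.exp_add, Real.exp_le_exp]
    have h3 := sq_sub_one_le_abs_pow hn s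
    nlinarith
  have hlap_meas : Measurable (laplaceLimit q a n) := by
    refine Measurable.indicator (by fun_prop) ?_
    exact (MeasurableSet.const (0 < q)).union measurableSet_Ioi
  have hpos (j : ℕ) (w : ℝ → ℝ) (hw : Measurable w) {C : ℝ} (hwC : ∀ s, |w s| ≤ C * |s| ^ j)
      (hw0 : ∀ s, 0 ≤ w s * laplaceLimit q a n s) (hwpos : ∀ s > 0, 0 < w s) :
      0 < ∫ s, w s * laplaceLimit q a n s := by
    have hint : Integrable fun s => w s * laplaceLimit q a n s := by
      refine ((integrable_abs_pow_mul_exp (a := 2 * a) (by positivity) j).const_mul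
        (C * Real.exp (2 * a))).mono' (hw.mul hlap_meas).aestronglyMeasurable
        (Eventually.of_forall fun s => ?_)
      rw [norm_mul, Real.norm_eq_abs, Real.norm_of_nonneg (hlap_nonneg s)]
      calc _ ≤ (C * |s| ^ j) * (Real.exp (2 * a) * Real.exp (-(2 * a) * s ^ 2)) :=
            mul_le_mul (hwC s) (hlap_le s) (hlap_nonneg s) ((abs_nonneg _).trans (hwC s))
        _ = _ := by ring
    rw [integral_pos_iff_support_of_nonneg hw0 hint]
    refine lt_of_lt_of_le ?_ (measure_mono (s := Set.Ioi (0 : ℝ)) fun s hs => ?_)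
    · simp
    · exact (mul_pos (hwpos s hs) (hlap_pos s hs)).ne'
  rcases hq.eq_or_lt with rfl | hq0
  -- At `q = 0` the volume element scales as well and gives the additional factor `T ^ (-(d-1)/n)`.
  · refine ⟨δ₀, hδ₀, ∫ s, |s| ^ (d - 1) * laplaceLimit 0 a n s,
      hpos (d - 1) (fun s => |s| ^ (d - 1)) (by fun_prop) (C := 1)
        (fun s => by rw [one_mul, abs_of_nonneg (by positivity)])
        (fun s => mul_nonneg (by positivity) (hlap_nonneg s))
        (fun s hs => pow_pos (abs_pos.2 (ne_of_gt hs)) _), fun δ hδ hδδ₀ => ?_⟩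
    refine (tendsto_integral_mul_laplaceKernel hec hn le_rfl ha0 hδ
      (fun R hR => hbound R (hR.trans_le hδδ₀)) hlim (w := fun _ s => |s| ^ (d - 1))
      (fun _ => by fun_prop) (C := 1) (j := d - 1)
      (fun T _ s _ => by rw [one_mul, abs_of_nonneg (by positivity)])
      (fun s => tendsto_const_nhds)).congr' ?_
    filter_upwards [eventually_gt_atTop 0] with T hT
    rw [integral_shell_eq e 0 δ n (d - 1) hT, ← mul_assoc, ← integral_const_mul]
    refine integral_congr_ae (Eventually.of_forall fun s => ?_)
    simp only [zero_add]
    by_cases h0 : laplaceKernel e 0 δ n T s = 0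
    · rw [h0, mul_zero, mul_zero, mul_zero]
    have hb : 0 < T ^ (-(n : ℝ)⁻¹) := Real.rpow_pos_of_pos hT _
    have hs : 0 < s := by
      have h1 : s ∈ {s : ℝ | 0 < 0 + T ^ (-(n : ℝ)⁻¹) * s ∧ |T ^ (-(n : ℝ)⁻¹) * s| < δ} := by
        by_contra h; exact h0 (Set.indicator_of_notMem h _)
      have h2 := h1.1
      rw [zero_add] at h2
      exact pos_of_mul_pos_right h2 hb.le
    rw [abs_of_pos hs, ← mul_assoc, mul_pow, ← mul_assoc, mul_assoc (T ^ shellExponent 0 d n),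
      ← pow_succ', Nat.sub_add_cancel hd, shellExponent, if_pos rfl, ← Real.rpow_natCast _ d,
      ← Real.rpow_mul hT.le, ← Real.rpow_add hT]
    rw [show (d : ℝ) / n + -(n : ℝ)⁻¹ * d = 0 by ring, Real.rpow_zero, one_mul]
  · refine ⟨δ₀, hδ₀, ∫ s, q ^ (d - 1) * laplaceLimit q a n s,
      hpos 0 (fun _ => q ^ (d - 1)) (by fun_prop) (C := q ^ (d - 1))
        (fun s => by rw [pow_zero, mul_one, abs_of_nonneg (by positivity)])
        (fun s => mul_nonneg (by positivity) (hlap_nonneg s))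
        (fun s hs => by positivity), fun δ hδ hδδ₀ => ?_⟩
    refine (tendsto_integral_mul_laplaceKernel hec hn hq ha0 hδ
      (fun R hR => hbound R (hR.trans_le hδδ₀)) hlim
      (w := fun T s => (q + T ^ (-(n : ℝ)⁻¹) * s) ^ (d - 1))
      (fun _ => by fun_prop) (C := (q + δ) ^ (d - 1)) (j := 0)
      (fun T _ s h0 => ?_) (fun s => ?_)).congr' ?_
    · have h1 : s ∈ {s : ℝ | 0 < q + T ^ (-(n : ℝ)⁻¹) * s ∧ |T ^ (-(n : ℝ)⁻¹) * s| < δ} := by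
        by_contra h; exact h0 (Set.indicator_of_notMem h _)
      rw [pow_zero, mul_one, abs_pow]
      gcongr
      refine (abs_add_le _ _).trans ?_
      rw [abs_of_pos hq0]
      linarith [h1.2]
    · have := ((tendsto_rpow_neg_inv_mul hn s).const_add q).pow (d - 1)
      rwa [add_zero] at this
    · filter_upwards [eventually_gt_atTop 0] with T hT
      rw [integral_shell_eq e q δ n (d - 1) hT, ← mul_assoc, shellExponent, if_neg hq0.ne',
        ← Real.rpow_add hT, one_div, add_neg_cancel, Real.rpow_zero, one_mul]

end Laplace

/-! ### Spheres of minima -/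

section Setup

variable {d : ℕ} {F : Type*} [NormedAddCommGroup F] [InnerProductSpace ℂ F] [CompleteSpace F]
  {K : Type*} [NormedAddCommGroup K] [InnerProductSpace ℂ K]
  {Pi : K ≃ₗᵢ[ℂ] Lp F 2 (volume : Measure (Mom d))}
  {Hf : Mom d → F →ₗ.[ℂ] F} {Er : ℝ → ℝ} {L : ℕ} {Q : Fin (L + 1) → ℝ} {n : Fin (L + 1) → ℕ}
  {Δ : Fin (L + 1) → Set ℝ} {ψ Φ : Mom d → F} {φ : K}

lemma exists_mom_norm_eq (hd : 1 ≤ d) {r : ℝ} (hr : 0 ≤ r) : ∃ P : Mom d, ‖P‖ = r := by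
  have : Nonempty (Fin d) := ⟨⟨0, hd⟩⟩
  exact exists_norm_eq (Mom d) hr

namespace StandingAssumptions

variable (hSA : StandingAssumptions Hf Er Q n Δ ψ)
include hSA

lemma continuous_opResolvent : Continuous fun P => opResolvent (Hf P) (-1) := by
  rw [continuous_iff_continuousAt]
  intro P
  obtain ⟨N, hN, -, han⟩ := hSA.analytic_family P (-1) (hSA.positive P).neg_one_notMem
  exact (han P (mem_of_mem_nhds hN)).continuousAt

lemma Q_nonneg' (ℓ : Fin (L + 1)) : 0 ≤ Q ℓ :=
  hSA.Q_nonneg.trans (hSA.Q_strictMono.monotone (Fin.zero_le ℓ))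

lemma mem_nhds {ℓ : Fin (L + 1)} {P : Mom d} (hP : ‖P‖ = Q ℓ) :
    {P' : Mom d | ‖P'‖ ∈ Δ ℓ} ∈ 𝓝 P :=
  continuous_norm.continuousAt.preimage_mem_nhds (by rw [hP]; exact hSA.Δ_nhds ℓ)

lemma isLocalGroundState {ℓ : Fin (L + 1)} {P : Mom d} (hP : ‖P‖ = Q ℓ) :
    IsLocalGroundState Hf ψ P where
  norm_eq := Filter.mem_of_superset (hSA.mem_nhds hP) fun P' h => hSA.ψ_norm ℓ P' h
  eigenvector := Filter.mem_of_superset (hSA.mem_nhds hP) fun P' h => hSA.ψ_eigenvector ℓ P' h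
  simple := hSA.simple ℓ P (show P ∈ {P' : Mom d | ‖P'‖ ∈ Δ ℓ} from
    mem_of_mem_nhds (hSA.mem_nhds hP))
  continuousAt x := (hSA.projection_continuous ℓ x).continuousAt (hSA.mem_nhds hP)

lemma nontrivial (hd : 1 ≤ d) : Nontrivial F := by
  obtain ⟨P, hP⟩ := exists_mom_norm_eq hd hSA.Q_nonneg
  refine ⟨ψ P, 0, fun h => ?_⟩
  have := (hSA.isLocalGroundState hP).norm_eq.self_of_nhds
  rw [h, norm_zero] at this
  exact zero_ne_one this

lemma infSpec_eq_zero {ℓ : Fin (L + 1)} {P : Mom d} (hP : ‖P‖ = Q ℓ) : infSpec (Hf P) = 0 := by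
  rw [hSA.radial, hP, hSA.Er_Q]

lemma overlap_continuousAt (hφ : AdmissibleVector Pi Hf Q Δ ψ φ Φ) {ℓ : Fin (L + 1)} {P : Mom d}
    (hP : ‖P‖ = Q ℓ) : ContinuousAt (fun P => ‖(inner ℂ (Φ P) (ψ P) : ℂ)‖) P :=
  (hφ.overlap_continuous ℓ).continuousAt (hSA.mem_nhds hP)

/-- The profile `Er` is only controlled on `[0, ∞)`; its even extension is continuous. -/
lemma continuous_Er_abs (hd : 1 ≤ d) : Continuous fun r : ℝ => Er |r| := by
  have := hSA.nontrivial hd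
  obtain ⟨u, hu⟩ := exists_mom_norm_eq hd zero_le_one
  have h : (fun r : ℝ => Er |r|) = fun r : ℝ => infSpec (Hf (r • u)) := by
    ext r
    rw [hSA.radial, norm_smul, hu, mul_one, Real.norm_eq_abs]
  rw [h]
  exact (continuous_infSpec hSA.positive hSA.continuous_opResolvent).comp (by fun_prop)

lemma Er_abs_nonneg (hd : 1 ≤ d) (r : ℝ) : 0 ≤ Er |r| := by
  have := hSA.nontrivial hd
  obtain ⟨P, hP⟩ := exists_mom_norm_eq hd (abs_nonneg r)
  rw [← hP, ← hSA.radial]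
  exact (hSA.positive P).infSpec_nonneg

/-- Away from the minima the ground state energy is bounded below by a positive constant. -/
lemma exists_infSpec_ge (hd : 1 ≤ d) {δ : ℝ} (hδ : 0 < δ) :
    ∃ κ > (0 : ℝ), ∀ P : Mom d, (∀ ℓ, δ ≤ |‖P‖ - Q ℓ|) → κ ≤ infSpec (Hf P) := by
  have := hSA.nontrivial hd
  obtain ⟨κ₀, hκ₀, R, hR⟩ := hSA.positive_at_infinity
  have hEc := continuous_infSpec hSA.positive hSA.continuous_opResolvent
  set S : Set (Mom d) := Metric.closedBall 0 R ∩ {P | ∀ ℓ, δ ≤ |‖P‖ - Q ℓ|} with hS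
  have hclosed : IsClosed {P : Mom d | ∀ ℓ, δ ≤ |‖P‖ - Q ℓ|} := by
    simp only [Set.ofPred_forall]
    exact isClosed_iInter fun ℓ => isClosed_le continuous_const (by fun_prop)
  have hcomp : IsCompact S := (isCompact_closedBall 0 R).inter_right hclosed
  have hpos : ∀ P, (∀ ℓ, δ ≤ |‖P‖ - Q ℓ|) → 0 < infSpec (Hf P) := by
    intro P hP
    refine lt_of_le_of_ne (hSA.positive P).infSpec_nonneg fun h0 => ?_
    obtain ⟨ℓ, hℓ⟩ := (hSA.minima P).1 fun P' => h0 ▸ (hSA.positive P').infSpec_nonneg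
    have := hP ℓ
    rw [hℓ, sub_self, abs_zero] at this
    linarith
  rcases S.eq_empty_or_nonempty with hne | hne
  · refine ⟨κ₀, hκ₀, fun P hP => hR P ?_⟩
    by_contra hlt
    have : P ∈ S := ⟨by simpa using (not_le.1 hlt).le, hP⟩
    rw [hne] at this
    exact this
  · obtain ⟨P₁, hP₁, hmin⟩ := hcomp.exists_isMinOn hne hEc.continuousOn
    refine ⟨min κ₀ (infSpec (Hf P₁)), lt_min hκ₀ (hpos P₁ hP₁.2), fun P hP => ?_⟩
    rcases le_total R ‖P‖ with h | h
    · exact (min_le_left _ _).trans (hR P h)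
    · exact (min_le_right _ _).trans (hmin ⟨by simpa using h, hP⟩)

lemma exists_tendsto_shell (hd : 1 ≤ d) (ℓ : Fin (L + 1)) :
    ∃ c > (0 : ℝ), ∀ᶠ δ in 𝓝[>] (0 : ℝ), Tendsto (fun T : ℝ => T ^ shellExponent (Q ℓ) d (n ℓ) *
      ∫ r in Set.Ioi (0 : ℝ), r ^ (d - 1) *
        {r : ℝ | |r - Q ℓ| < δ}.indicator (fun r => Real.exp (-(2 * T) * Er |r|)) r)
      atTop (𝓝 c) := by
  obtain ⟨a, ha, hequiv⟩ := hSA.order ℓ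
  have hequiv' : Asymptotics.IsEquivalent (𝓝[{R | 0 ≤ Q ℓ + R}] 0)
      (fun R => (fun r => Er |r|) (Q ℓ + R)) (fun R => a * R ^ n ℓ) := by
    refine hequiv.congr_left ?_
    filter_upwards [self_mem_nhdsWithin] with R hR
    exact (congrArg Er (abs_of_nonneg hR)).symm
  obtain ⟨δ₀, hδ₀, c, hc, h⟩ := _root_.exists_tendsto_shell (hSA.continuous_Er_abs hd)
    (hSA.Er_abs_nonneg hd) (hSA.two_le_n ℓ) (hSA.Q_nonneg' ℓ) ha hd hequiv'
  refine ⟨c, hc, ?_⟩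
  filter_upwards [Ioc_mem_nhdsGT hδ₀] with δ hδ
  exact h δ hδ.1 hδ.2

lemma continuousAt_groundDensity (hd : 1 ≤ d) (hφ : AdmissibleVector Pi Hf Q Δ ψ φ Φ)
    {ℓ : Fin (L + 1)} {P : Mom d} (hP : ‖P‖ = Q ℓ) {t : ℝ} (ht : 0 ≤ t) (k : Mom d) :
    ContinuousAt (groundDensity Hf ψ Φ k t) P := by
  have := hSA.nontrivial hd
  exact (hSA.isLocalGroundState hP).continuousAt_groundDensity hSA.positive
    hSA.continuous_opResolvent (hSA.overlap_continuousAt hφ hP) ht k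

/-- The local estimates on the integrand are uniform in a thin shell around a sphere of minima,
by compactness of the sphere. -/
lemma eventually_norm_fiberIntegrand_sub_le (hd : 1 ≤ d)
    (hφ : AdmissibleVector Pi Hf Q Δ ψ φ Φ) (ℓ : Fin (L + 1)) {t : ℝ} (ht : 0 ≤ t) (k : Mom d)
    {ε : ℝ} (hε : 0 < ε) :
    ∀ᶠ δ in 𝓝[>] (0 : ℝ), ∀ᶠ g in 𝓝[>] (0 : ℝ), ∀ᶠ T in atTop, ∀ u ∈ Metric.sphere (0 : Mom d) 1,
      ∀ r : ℝ, |r - Q ℓ| < δ →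
        ‖((Real.exp (2 * T * infSpec (Hf (r • u))) : ℝ) : ℂ) * fiberIntegrand Hf Φ T k t (r • u) -
          groundDensity Hf ψ Φ k t (Q ℓ • u)‖ ≤ ε + 3 * (Real.exp (-g * T) * ‖Φ (r • u)‖ ^ 2) := by
  have := hSA.nontrivial hd
  refine (isCompact_sphere (0 : Mom d) 1).induction_on (p := fun s : Set (Mom d) =>
    ∀ᶠ δ in 𝓝[>] (0 : ℝ), ∀ᶠ g in 𝓝[>] (0 : ℝ), ∀ᶠ T in atTop, ∀ u ∈ s,
      ∀ r : ℝ, |r - Q ℓ| < δ →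
        ‖((Real.exp (2 * T * infSpec (Hf (r • u))) : ℝ) : ℂ) * fiberIntegrand Hf Φ T k t (r • u) -
          groundDensity Hf ψ Φ k t (Q ℓ • u)‖ ≤ ε + 3 * (Real.exp (-g * T) * ‖Φ (r • u)‖ ^ 2))
    ?_ ?_ ?_ ?_
  · simp
  · intro s s' hs h
    filter_upwards [h] with δ h
    filter_upwards [h] with g h
    filter_upwards [h] with T h
    exact fun u hu => h u (hs hu)
  · intro s s' h h'
    filter_upwards [h, h'] with δ h h'
    filter_upwards [h, h'] with g h h'
    filter_upwards [h, h'] with T h h'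
    rintro u (hu | hu)
    · exact h u hu
    · exact h' u hu
  · intro u₀ hu₀
    have hu₀' : ‖u₀‖ = 1 := by simpa using hu₀
    have hP₀ : ‖Q ℓ • u₀‖ = Q ℓ := by
      rw [norm_smul, hu₀', mul_one, Real.norm_of_nonneg (hSA.Q_nonneg' ℓ)]
    obtain ⟨g₀, hg₀, T₀, hT₀, hev⟩ :=
      (hSA.isLocalGroundState hP₀).eventually_norm_fiberIntegrand_sub_le hSA.positive
        hSA.continuous_opResolvent (hSA.overlap_continuousAt hφ hP₀)
        (hφ.continuous_or_isolated ℓ _ hP₀) ht k (half_pos hε)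
    have hdens : ∀ᶠ u in 𝓝 u₀, ‖groundDensity Hf ψ Φ k t (Q ℓ • u₀) -
        groundDensity Hf ψ Φ k t (Q ℓ • u)‖ < ε / 2 := by
      have h1 : ContinuousAt (fun u => groundDensity Hf ψ Φ k t (Q ℓ • u)) u₀ :=
        (hSA.continuousAt_groundDensity hd hφ hP₀ ht k).comp (f := fun u => Q ℓ • u) (by fun_prop)
      filter_upwards [h1.eventually (Metric.ball_mem_nhds _ (half_pos hε))] with u hu
      rwa [← dist_eq_norm, dist_comm]
    have hcont : Tendsto (fun z : ℝ × Mom d => z.1 • z.2) (𝓝 (Q ℓ) ×ˢ 𝓝 u₀) (𝓝 (Q ℓ • u₀)) := by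
      rw [← nhds_prod_eq]
      exact continuous_smul.tendsto (Q ℓ, u₀)
    obtain ⟨pr, hpr, pu, hpu, hprod⟩ := eventually_prod_iff.1 (hcont.eventually hev)
    obtain ⟨δ₀, hδ₀, hball⟩ := Metric.eventually_nhds_iff.1 hpr
    refine ⟨{u | pu u ∧ ‖groundDensity Hf ψ Φ k t (Q ℓ • u₀) -
        groundDensity Hf ψ Φ k t (Q ℓ • u)‖ < ε / 2}, mem_nhdsWithin_of_mem_nhds
        (hpu.and hdens), ?_⟩
    filter_upwards [Ioc_mem_nhdsGT hδ₀] with δ hδ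
    filter_upwards [Ioc_mem_nhdsGT hg₀] with g hg
    filter_upwards [eventually_ge_atTop T₀] with T hT u hu r hr
    have h1 := hprod (hball (show dist r (Q ℓ) < δ₀ by
      rw [Real.dist_eq]; exact hr.trans_le hδ.2)) hu.1 T hT
    have h2 : Real.exp (-g₀ * T) ≤ Real.exp (-g * T) := by
      have : 0 < T := hT₀.trans_le hT
      rw [Real.exp_le_exp]
      nlinarith [hg.2]
    have h3 : 3 * (Real.exp (-g₀ * T) * ‖Φ (r • u)‖ ^ 2) ≤
        3 * (Real.exp (-g * T) * ‖Φ (r • u)‖ ^ 2) := by gcongr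
    have h4 := norm_sub_le_norm_sub_add_norm_sub (((Real.exp (2 * T * infSpec (Hf (r • u))) : ℝ) :
      ℂ) * fiberIntegrand Hf Φ T k t (r • u)) (groundDensity Hf ψ Φ k t (Q ℓ • u₀))
      (groundDensity Hf ψ Φ k t (Q ℓ • u))
    have h5 := hu.2
    linarith

end StandingAssumptions

end Setup

/-! ### Asymptotics of the unnormalized characteristic function -/

section Asymptotics

variable {d : ℕ} {F : Type*} [NormedAddCommGroup F] [InnerProductSpace ℂ F] [CompleteSpace F]
  {K : Type*} [NormedAddCommGroup K] [InnerProductSpace ℂ K] [CompleteSpace K]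
  {Pi : K ≃ₗᵢ[ℂ] Lp F 2 (volume : Measure (Mom d))} {H : K →ₗ.[ℂ] K}
  {Hf : Mom d → F →ₗ.[ℂ] F} {Er : ℝ → ℝ} {L : ℕ} {Q : Fin (L + 1) → ℝ} {n : Fin (L + 1) → ℕ}
  {Δ : Fin (L + 1) → Set ℝ} {ψ Φ : Mom d → F} {φ : K}

/-- The weight `exp (-2 T E(P))`, restricted to the shell of thickness `δ` around the sphere of
radius `q`. -/
noncomputable def shellWeight (Hf : Mom d → F →ₗ.[ℂ] F) (q δ T : ℝ) (P : Mom d) : ℝ :=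
  {P : Mom d | |‖P‖ - q| < δ}.indicator (fun P => Real.exp (-(2 * T) * infSpec (Hf P))) P

/-- The radial integral of the weight over a shell, where `Er` is the radial profile of `E`. -/
noncomputable def shellIntegral (Er : ℝ → ℝ) (d : ℕ) (q δ T : ℝ) : ℝ :=
  ∫ r in Set.Ioi (0 : ℝ), r ^ (d - 1) *
    {r : ℝ | |r - q| < δ}.indicator (fun r => Real.exp (-(2 * T) * Er |r|)) r

/-- The ground state density on the sphere of radius `q`, extended radially. -/
noncomputable def radialExtension (Hf : Mom d → F →ₗ.[ℂ] F) (ψ Φ : Mom d → F) (k : Mom d)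
    (t q : ℝ) (P : Mom d) : ℂ :=
  groundDensity Hf ψ Φ k t ((q * ‖P‖⁻¹) • P)

omit [CompleteSpace F] in
lemma shellWeight_nonneg (q δ T : ℝ) (P : Mom d) : 0 ≤ shellWeight Hf q δ T P :=
  Set.indicator_nonneg (fun _ _ => (Real.exp_pos _).le) _

omit [CompleteSpace F] in
lemma shellWeight_of_mem {q δ T : ℝ} {P : Mom d} (hP : |‖P‖ - q| < δ) :
    shellWeight Hf q δ T P = Real.exp (-(2 * T) * infSpec (Hf P)) :=
  Set.indicator_of_mem (s := {P : Mom d | |‖P‖ - q| < δ}) hP _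

omit [CompleteSpace F] in
lemma shellWeight_of_notMem {q δ T : ℝ} {P : Mom d} (hP : ¬ |‖P‖ - q| < δ) :
    shellWeight Hf q δ T P = 0 :=
  Set.indicator_of_notMem (s := {P : Mom d | |‖P‖ - q| < δ}) hP _

lemma radialExtension_smul (k : Mom d) (t q : ℝ) {u : Mom d} (hu : ‖u‖ = 1) {r : ℝ} (hr : 0 < r) :
    radialExtension Hf ψ Φ k t q (r • u) = groundDensity Hf ψ Φ k t (q • u) := by
  rw [radialExtension, norm_smul, hu, mul_one, Real.norm_of_nonneg hr.le, smul_smul, mul_assoc,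
    inv_mul_cancel₀ hr.ne', mul_one]

lemma exists_eq_smul_of_ne_zero {P : Mom d} (hP : P ≠ 0) :
    ∃ u : Mom d, ‖u‖ = 1 ∧ P = ‖P‖ • u := by
  have h : ‖P‖ ≠ 0 := norm_ne_zero_iff.2 hP
  refine ⟨‖P‖⁻¹ • P, ?_, (smul_inv_smul₀ h P).symm⟩
  rw [norm_smul, norm_inv, norm_norm, inv_mul_cancel₀ h]

namespace StandingAssumptions

variable (hSA : StandingAssumptions Hf Er Q n Δ ψ)
include hSA

lemma shellWeight_smul (q δ T : ℝ) {u : Mom d} (hu : ‖u‖ = 1) {r : ℝ} (hr : 0 < r) :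
    shellWeight Hf q δ T (r • u) =
      {r : ℝ | |r - q| < δ}.indicator (fun r => Real.exp (-(2 * T) * Er |r|)) r := by
  have h : ‖r • u‖ = r := by rw [norm_smul, hu, mul_one, Real.norm_of_nonneg hr.le]
  simp only [shellWeight, Set.indicator_apply, Set.mem_ofPred_eq, h, hSA.radial, abs_of_pos hr]

lemma integral_shellWeight (hd : 1 ≤ d) (q δ T : ℝ) :
    ∫ P, shellWeight Hf q δ T P =
      (volume : Measure (Mom d)).toSphere.real Set.univ * shellIntegral Er d q δ T := by
  have h := integral_eq_of_polar (𝕜 := ℝ) hd (h := shellWeight Hf q δ T)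
    (f := {r : ℝ | |r - q| < δ}.indicator (fun r => Real.exp (-(2 * T) * Er |r|)))
    (g := fun _ => 1) fun u r hr => by
      rw [one_mul, hSA.shellWeight_smul q δ T (by simp) hr]
  rw [h, integral_const, smul_eq_mul, mul_one]
  rfl

lemma integral_shellWeight_mul (hd : 1 ≤ d) (q δ T : ℝ) (k : Mom d) (t : ℝ) :
    ∫ P, (shellWeight Hf q δ T P : ℂ) * radialExtension Hf ψ Φ k t q P =
      (shellIntegral Er d q δ T : ℂ) * sphereNumerator Hf ψ Φ q k t := by
  have h := integral_eq_of_polar (𝕜 := ℂ) hd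
    (h := fun P => (shellWeight Hf q δ T P : ℂ) * radialExtension Hf ψ Φ k t q P)
    (f := fun r => (({r : ℝ | |r - q| < δ}.indicator
      (fun r => Real.exp (-(2 * T) * Er |r|)) r : ℝ) : ℂ))
    (g := fun u => groundDensity Hf ψ Φ k t (q • (u : Mom d))) fun u r hr => by
      rw [hSA.shellWeight_smul q δ T (by simp) hr,
        radialExtension_smul k t q (by simp) hr, mul_comm]
  rw [h, mul_comm]
  congr 1
  rw [shellIntegral, ← integral_complex_ofReal]
  refine integral_congr_ae (Eventually.of_forall fun r => ?_)
  simp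

lemma integrable_shellWeight (hd : 1 ≤ d) (q δ : ℝ) {T : ℝ} (hT : 0 ≤ T) :
    Integrable (shellWeight Hf q δ T) := by
  have := hSA.nontrivial hd
  have hEc := continuous_infSpec hSA.positive hSA.continuous_opResolvent
  have hmeas : MeasurableSet {P : Mom d | |‖P‖ - q| < δ} :=
    measurableSet_lt (f := fun P : Mom d => |‖P‖ - q|) (g := fun _ => δ) (by fun_prop)
      measurable_const
  have hfin : volume {P : Mom d | |‖P‖ - q| < δ} < ⊤ := by
    refine (measure_mono (t := Metric.closedBall (0 : Mom d) (q + δ)) fun P hP => ?_).trans_lt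
      measure_closedBall_lt_top
    rw [mem_closedBall_zero_iff]
    have := (abs_lt.1 (show |‖P‖ - q| < δ from hP)).2
    linarith
  refine IntegrableOn.integrable_indicator ?_ hmeas
  refine Measure.integrableOn_of_bounded (M := 1) hfin.ne
    (Real.continuous_exp.comp (continuous_const.mul hEc)).aestronglyMeasurable
    (Eventually.of_forall fun P => ?_)
  rw [Real.norm_of_nonneg (Real.exp_pos _).le, Real.exp_le_one_iff]
  have := (hSA.positive P).infSpec_nonneg
  nlinarith

omit [CompleteSpace K] in
lemma continuous_groundDensity_sphere (hd : 1 ≤ d) (hφ : AdmissibleVector Pi Hf Q Δ ψ φ Φ)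
    (ℓ : Fin (L + 1)) {t : ℝ} (ht : 0 ≤ t) (k : Mom d) :
    Continuous fun u : Metric.sphere (0 : Mom d) 1 =>
      groundDensity Hf ψ Φ k t (Q ℓ • (u : Mom d)) := by
  rw [continuous_iff_continuousAt]
  intro u
  have hu : ‖Q ℓ • (u : Mom d)‖ = Q ℓ := by
    rw [norm_smul, mem_sphere_zero_iff_norm.1 u.2, mul_one, Real.norm_of_nonneg (hSA.Q_nonneg' ℓ)]
  exact (hSA.continuousAt_groundDensity hd hφ hu ht k).comp
    (f := fun u : Metric.sphere (0 : Mom d) 1 => Q ℓ • (u : Mom d)) (by fun_prop)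

omit [CompleteSpace K] in
lemma integrable_shellWeight_mul (hd : 1 ≤ d) (hφ : AdmissibleVector Pi Hf Q Δ ψ φ Φ)
    (ℓ : Fin (L + 1)) {t : ℝ} (ht : 0 ≤ t) (k : Mom d) (δ : ℝ) {T : ℝ} (hT : 0 ≤ T) :
    Integrable fun P =>
      (shellWeight Hf (Q ℓ) δ T P : ℂ) * radialExtension Hf ψ Φ k t (Q ℓ) P := by
  have : Nonempty (Fin d) := ⟨⟨0, hd⟩⟩
  obtain ⟨C, hC⟩ := isCompact_univ.exists_bound_of_continuousOn
    (hSA.continuous_groundDensity_sphere hd hφ ℓ ht k).continuousOn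
  have hI := hSA.integrable_shellWeight hd (Q ℓ) δ hT
  refine (hI.ofReal (𝕜 := ℂ)).mul_bdd (c := C) ?_ ?_
  · have h1 : ContinuousOn (radialExtension Hf ψ Φ k t (Q ℓ)) {(0 : Mom d)}ᶜ := by
      intro P hP
      have hP0 : ‖P‖ ≠ 0 := norm_ne_zero_iff.2 hP
      have hn : ‖(Q ℓ * ‖P‖⁻¹) • P‖ = Q ℓ := by
        rw [norm_smul, Real.norm_of_nonneg (mul_nonneg (hSA.Q_nonneg' ℓ) (by positivity)),
          mul_assoc, inv_mul_cancel₀ hP0, mul_one]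
      refine ContinuousAt.continuousWithinAt ?_
      refine (hSA.continuousAt_groundDensity hd hφ hn ht k).comp
        (f := fun P : Mom d => (Q ℓ * ‖P‖⁻¹) • P) ?_
      exact (continuousAt_const.mul (continuous_norm.continuousAt.inv₀ hP0)).smul continuousAt_id
    have h2 := h1.aestronglyMeasurable (μ := volume) (measurableSet_singleton _).compl
    rwa [restrict_compl_singleton] at h2
  · have h0 : ∀ᵐ P : Mom d, P ≠ 0 := by simp [ae_iff]
    filter_upwards [h0] with P hP
    obtain ⟨u, hu, hPu⟩ := exists_eq_smul_of_ne_zero hP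
    rw [hPu, radialExtension_smul k t _ hu (norm_pos_iff.2 hP)]
    exact hC ⟨u, by simpa using hu⟩ (Set.mem_univ _)

/-- The pointwise comparison of the integrand with its contributions from disjoint shells. -/
lemma norm_fiberIntegrand_sub_sum_le (hd : 1 ≤ d) {t : ℝ} (ht : 0 ≤ t) (k : Mom d)
    {ε δ g κ T : ℝ} (hε : 0 < ε) (hT : 0 < T)
    (hdisj : ∀ ℓ ℓ' : Fin (L + 1), ℓ ≠ ℓ' → 2 * δ ≤ |Q ℓ - Q ℓ'|)
    (hκ : ∀ P : Mom d, (∀ ℓ, δ ≤ |‖P‖ - Q ℓ|) → κ ≤ infSpec (Hf P))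
    (hloc : ∀ ℓ, ∀ u ∈ Metric.sphere (0 : Mom d) 1, ∀ r : ℝ, |r - Q ℓ| < δ →
        ‖((Real.exp (2 * T * infSpec (Hf (r • u))) : ℝ) : ℂ) * fiberIntegrand Hf Φ T k t (r • u) -
          groundDensity Hf ψ Φ k t (Q ℓ • u)‖ ≤ ε + 3 * (Real.exp (-g * T) * ‖Φ (r • u)‖ ^ 2))
    {P : Mom d} (hP : P ≠ 0) :
    ‖fiberIntegrand Hf Φ T k t P -
        ∑ ℓ, (shellWeight Hf (Q ℓ) δ T P : ℂ) * radialExtension Hf ψ Φ k t (Q ℓ) P‖ ≤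
      ∑ ℓ, ε * shellWeight Hf (Q ℓ) δ T P +
        (3 * Real.exp (-g * T) + Real.exp (-(2 * κ) * T)) * ‖Φ P‖ ^ 2 := by
  have := hSA.nontrivial hd
  have hE := (hSA.positive P).infSpec_nonneg
  have hsum0 : 0 ≤ ∑ ℓ, ε * shellWeight Hf (Q ℓ) δ T P :=
    Finset.sum_nonneg fun ℓ _ => mul_nonneg hε.le (shellWeight_nonneg _ _ _ _)
  by_cases hmem : ∃ ℓ, |‖P‖ - Q ℓ| < δ
  · obtain ⟨ℓ, hℓ⟩ := hmem
    have hother : ∀ ℓ', ℓ' ≠ ℓ → shellWeight Hf (Q ℓ') δ T P = 0 := fun ℓ' hne =>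
      shellWeight_of_notMem fun h' => by
        have h1 := hdisj ℓ' ℓ hne
        have h2 := abs_sub_le (Q ℓ') ‖P‖ (Q ℓ)
        rw [abs_sub_comm (Q ℓ') ‖P‖] at h2
        linarith
    rw [Finset.sum_eq_single ℓ (fun ℓ' _ h => by rw [hother ℓ' h]; simp) (by simp),
      Finset.sum_eq_single ℓ (fun ℓ' _ h => by rw [hother ℓ' h]; simp) (by simp),
      shellWeight_of_mem hℓ]
    obtain ⟨u, hu, hPu⟩ := exists_eq_smul_of_ne_zero hP
    have h1 := hloc ℓ u (by simpa using hu) ‖P‖ hℓ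
    have h2 := radialExtension_smul (Hf := Hf) (ψ := ψ) (Φ := Φ) k t (Q ℓ) hu (norm_pos_iff.2 hP)
    rw [← hPu] at h1 h2
    rw [← h2] at h1
    set w := Real.exp (-(2 * T) * infSpec (Hf P)) with hw
    have hw1 : w ≤ 1 := Real.exp_le_one_iff.2 (by nlinarith)
    have hw0 : 0 < w := Real.exp_pos _
    have hww : w * Real.exp (2 * T * infSpec (Hf P)) = 1 := by
      rw [hw, ← Real.exp_add]; simp
    have e : fiberIntegrand Hf Φ T k t P - (w : ℂ) * radialExtension Hf ψ Φ k t (Q ℓ) P =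
        (w : ℂ) * (((Real.exp (2 * T * infSpec (Hf P)) : ℝ) : ℂ) * fiberIntegrand Hf Φ T k t P -
          radialExtension Hf ψ Φ k t (Q ℓ) P) := by
      rw [mul_sub, ← mul_assoc, ← Complex.ofReal_mul, hww, Complex.ofReal_one, one_mul]
    rw [e, norm_mul, Complex.norm_real, Real.norm_of_nonneg hw0.le]
    have h3 : 0 ≤ 3 * (Real.exp (-g * T) * ‖Φ P‖ ^ 2) := by positivity
    have h4 : 0 ≤ Real.exp (-(2 * κ) * T) * ‖Φ P‖ ^ 2 := by positivity
    calc _ ≤ w * (ε + 3 * (Real.exp (-g * T) * ‖Φ P‖ ^ 2)) := by gcongr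
      _ ≤ ε * w + 3 * (Real.exp (-g * T) * ‖Φ P‖ ^ 2) := by nlinarith
      _ ≤ _ := by nlinarith
  · push Not at hmem
    have hz : ∑ ℓ, (shellWeight Hf (Q ℓ) δ T P : ℂ) * radialExtension Hf ψ Φ k t (Q ℓ) P = 0 :=
      Finset.sum_eq_zero fun ℓ _ => by
        rw [shellWeight_of_notMem (not_lt.2 (hmem ℓ))]; simp
    rw [hz, sub_zero]
    refine (norm_fiberIntegrand_le hSA.positive hT ht k P).trans ?_
    have h1 : Real.exp (-(2 * T) * infSpec (Hf P)) ≤ Real.exp (-(2 * κ) * T) := by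
      rw [Real.exp_le_exp]
      nlinarith [hκ P hmem]
    have h2 : 0 ≤ 3 * Real.exp (-g * T) * ‖Φ P‖ ^ 2 := by positivity
    calc _ ≤ Real.exp (-(2 * κ) * T) * ‖Φ P‖ ^ 2 := by gcongr
      _ ≤ _ := by nlinarith

/-- The comparison of the unnormalized characteristic function with the contributions of the
shells. -/
lemma norm_charFunUnnormalized_sub_sum_le (hd : 1 ≤ d) (hHf : IsDirectIntegral Pi H Hf)
    (hφ : AdmissibleVector Pi Hf Q Δ ψ φ Φ) {t : ℝ} (ht : 0 ≤ t) (k : Mom d)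
    {ε δ g κ T : ℝ} (hε : 0 < ε) (hT : 0 < T)
    (hdisj : ∀ ℓ ℓ' : Fin (L + 1), ℓ ≠ ℓ' → 2 * δ ≤ |Q ℓ - Q ℓ'|)
    (hκ : ∀ P : Mom d, (∀ ℓ, δ ≤ |‖P‖ - Q ℓ|) → κ ≤ infSpec (Hf P))
    (hloc : ∀ ℓ, ∀ u ∈ Metric.sphere (0 : Mom d) 1, ∀ r : ℝ, |r - Q ℓ| < δ →
        ‖((Real.exp (2 * T * infSpec (Hf (r • u))) : ℝ) : ℂ) * fiberIntegrand Hf Φ T k t (r • u) -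
          groundDensity Hf ψ Φ k t (Q ℓ • u)‖ ≤ ε + 3 * (Real.exp (-g * T) * ‖Φ (r • u)‖ ^ 2)) :
    ‖charFunUnnormalized Pi H φ T k t -
        ∑ ℓ, (shellIntegral Er d (Q ℓ) δ T : ℂ) * sphereNumerator Hf ψ Φ (Q ℓ) k t‖ ≤
      ∑ ℓ, ε * ((volume : Measure (Mom d)).toSphere.real Set.univ *
          shellIntegral Er d (Q ℓ) δ T) +
        (3 * Real.exp (-g * T) + Real.exp (-(2 * κ) * T)) * ∫ P, ‖Φ P‖ ^ 2 := by
  have : Nonempty (Fin d) := ⟨⟨0, hd⟩⟩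
  obtain ⟨hint, heq⟩ := hHf.integrable_and_charFunUnnormalized_eq hSA.positive
    hSA.continuous_opResolvent hφ.components hT.le ht k
  have hI (ℓ : Fin (L + 1)) := hSA.integrable_shellWeight hd (Q ℓ) δ hT.le
  have hIm (ℓ : Fin (L + 1)) := hSA.integrable_shellWeight_mul hd hφ ℓ ht k δ hT.le
  have hΦ : Integrable fun P => ‖Φ P‖ ^ 2 := by
    have h1 : MemLp Φ 2 := (memLp_congr_ae hφ.components).1 (Lp.memLp (Pi φ))
    exact (memLp_two_iff_integrable_sq_norm h1.1).1 h1
  have h1 : charFunUnnormalized Pi H φ T k t -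
      ∑ ℓ, (shellIntegral Er d (Q ℓ) δ T : ℂ) * sphereNumerator Hf ψ Φ (Q ℓ) k t =
      ∫ P, (fiberIntegrand Hf Φ T k t P -
        ∑ ℓ, (shellWeight Hf (Q ℓ) δ T P : ℂ) * radialExtension Hf ψ Φ k t (Q ℓ) P) := by
    rw [integral_sub hint (integrable_finsetSum _ fun ℓ _ => hIm ℓ),
      integral_finsetSum _ fun ℓ _ => hIm ℓ, heq]
    congr 1
    exact Finset.sum_congr rfl fun ℓ _ => (hSA.integral_shellWeight_mul hd _ _ _ _ _).symm
  have h2 : ∑ ℓ, ε * ((volume : Measure (Mom d)).toSphere.real Set.univ *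
          shellIntegral Er d (Q ℓ) δ T) +
        (3 * Real.exp (-g * T) + Real.exp (-(2 * κ) * T)) * ∫ P, ‖Φ P‖ ^ 2 =
      ∫ P, (∑ ℓ, ε * shellWeight Hf (Q ℓ) δ T P +
        (3 * Real.exp (-g * T) + Real.exp (-(2 * κ) * T)) * ‖Φ P‖ ^ 2) := by
    rw [integral_add (integrable_finsetSum _ fun ℓ _ => (hI ℓ).const_mul ε) (hΦ.const_mul _),
      integral_finsetSum _ fun ℓ _ => (hI ℓ).const_mul ε, integral_const_mul]
    congr 1
    refine Finset.sum_congr rfl fun ℓ _ => ?_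
    rw [integral_const_mul, hSA.integral_shellWeight hd]
  rw [h1, h2]
  have h0 : ∀ᵐ P : Mom d, P ≠ 0 := by simp [ae_iff]
  refine norm_integral_le_of_norm_le ((integrable_finsetSum _ fun ℓ _ => (hI ℓ).const_mul ε).add
    (hΦ.const_mul _)) ?_
  filter_upwards [h0] with P hP
  exact hSA.norm_fiberIntegrand_sub_sum_le hd ht k hε hT hdisj hκ hloc hP

/-- The leading asymptotics of the unnormalized characteristic function: it is a combination of
the contributions of the spheres of minima that decay most slowly, with universal weights. -/
lemma exists_tendsto_charFunUnnormalized (hd : 1 ≤ d) (hHf : IsDirectIntegral Pi H Hf) :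
    ∃ c : Fin (L + 1) → ℝ, (∀ ℓ, 0 < c ℓ) ∧
      ∀ (φ : K) (Φ : Mom d → F), AdmissibleVector Pi Hf Q Δ ψ φ Φ →
        ∀ (k : Mom d) (t : ℝ), 0 ≤ t → ∀ α : ℝ, (∀ ℓ, α ≤ shellExponent (Q ℓ) d (n ℓ)) →
          Tendsto (fun T : ℝ => ((T ^ α : ℝ) : ℂ) * charFunUnnormalized Pi H φ T k t) atTop
            (𝓝 (∑ ℓ with shellExponent (Q ℓ) d (n ℓ) = α,
              (c ℓ : ℂ) * sphereNumerator Hf ψ Φ (Q ℓ) k t)) := by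
  choose c hc hclim using hSA.exists_tendsto_shell hd
  refine ⟨c, hc, fun φ Φ hφ k t ht α hα => ?_⟩
  set A := (volume : Measure (Mom d)).toSphere.real Set.univ with hA
  -- Shells with an exponent above `α` do not contribute in the limit.
  set c' : Fin (L + 1) → ℝ := fun ℓ => if shellExponent (Q ℓ) d (n ℓ) = α then c ℓ else 0 with hc'
  have hc'0 (ℓ : Fin (L + 1)) : 0 ≤ c' ℓ := by
    simp only [hc']; split_ifs
    exacts [(hc ℓ).le, le_rfl]
  have hlim : ∀ᶠ δ in 𝓝[>] (0 : ℝ), ∀ ℓ,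
      Tendsto (fun T : ℝ => T ^ α * shellIntegral Er d (Q ℓ) δ T) atTop (𝓝 (c' ℓ)) := by
    refine eventually_all.2 fun ℓ => ?_
    filter_upwards [hclim ℓ] with δ hδ
    have hsplit : (fun T : ℝ => T ^ (-(shellExponent (Q ℓ) d (n ℓ) - α)) *
        (T ^ shellExponent (Q ℓ) d (n ℓ) * shellIntegral Er d (Q ℓ) δ T)) =ᶠ[atTop]
        fun T : ℝ => T ^ α * shellIntegral Er d (Q ℓ) δ T := by
      filter_upwards [eventually_gt_atTop 0] with T hT
      rw [← mul_assoc, ← Real.rpow_add hT]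
      ring_nf
    refine Tendsto.congr' hsplit ?_
    by_cases hαℓ : shellExponent (Q ℓ) d (n ℓ) = α
    · simp only [hc', hαℓ, if_true, sub_self, neg_zero, Real.rpow_zero, one_mul]
      exact hαℓ ▸ hδ
    · have h1 := (tendsto_rpow_neg_atTop
        (sub_pos.2 (lt_of_le_of_ne (hα ℓ) (Ne.symm hαℓ)))).mul hδ
      rw [zero_mul] at h1
      rw [show c' ℓ = 0 from if_neg hαℓ]
      exact h1
  have htarget : ∑ ℓ with shellExponent (Q ℓ) d (n ℓ) = α,
      (c ℓ : ℂ) * sphereNumerator Hf ψ Φ (Q ℓ) k t =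
      ∑ ℓ, (c' ℓ : ℂ) * sphereNumerator Hf ψ Φ (Q ℓ) k t := by
    rw [Finset.sum_filter]
    refine Finset.sum_congr rfl fun ℓ _ => ?_
    simp only [hc']
    split_ifs <;> simp
  rw [htarget, Metric.tendsto_atTop']
  intro η hη
  -- The relative error is chosen so small that it stays below `η / 2` in the limit.
  set B : ℝ := ∑ ℓ, A * c' ℓ with hB
  have hA0 : 0 ≤ A := measureReal_nonneg
  have hB0 : 0 ≤ B := Finset.sum_nonneg fun ℓ _ => mul_nonneg hA0 (hc'0 ℓ)
  set ε : ℝ := η / (4 * (B + 1)) with hε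
  have hε0 : 0 < ε := by positivity
  have hεB : ε * B < η / 2 := by
    rw [hε, div_mul_eq_mul_div, div_lt_iff₀ (by positivity)]
    nlinarith
  have hdisj : ∀ᶠ δ in 𝓝[>] (0 : ℝ), ∀ ℓ ℓ' : Fin (L + 1), ℓ ≠ ℓ' → 2 * δ ≤ |Q ℓ - Q ℓ'| := by
    refine eventually_all.2 fun ℓ => eventually_all.2 fun ℓ' => ?_
    by_cases h : ℓ = ℓ'
    · simp [h]
    · have hpos : 0 < |Q ℓ - Q ℓ'| := abs_pos.2 (sub_ne_zero.2 (hSA.Q_strictMono.injective.ne h))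
      filter_upwards [Ioc_mem_nhdsGT (half_pos hpos)] with δ hδ _
      linarith [hδ.2]
  have hloc := eventually_all.2 fun ℓ =>
    hSA.eventually_norm_fiberIntegrand_sub_le hd hφ ℓ ht k hε0
  obtain ⟨δ, ⟨⟨hδlim, hδdisj⟩, hδloc⟩, hδ0⟩ :=
    (((hlim.and hdisj).and hloc).and self_mem_nhdsWithin).exists
  obtain ⟨κ, hκ0, hκ⟩ := hSA.exists_infSpec_ge hd (show (0 : ℝ) < δ from hδ0)
  obtain ⟨g, hgloc, hg0⟩ := ((eventually_all.2 hδloc).and self_mem_nhdsWithin).exists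
  have hTloc := eventually_all.2 hgloc
  have hg0' : 0 < g := hg0
  set J : ℝ := ∫ P, ‖Φ P‖ ^ 2 with hJ
  have hmain : Tendsto (fun T : ℝ => ∑ ℓ, ((T ^ α * shellIntegral Er d (Q ℓ) δ T : ℝ) : ℂ) *
      sphereNumerator Hf ψ Φ (Q ℓ) k t) atTop
      (𝓝 (∑ ℓ, (c' ℓ : ℂ) * sphereNumerator Hf ψ Φ (Q ℓ) k t)) :=
    tendsto_finsetSum _ fun ℓ _ =>
      ((Complex.continuous_ofReal.tendsto _).comp (hδlim ℓ)).mul_const _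
  have herr : Tendsto (fun T : ℝ => ∑ ℓ, ε * (A * (T ^ α * shellIntegral Er d (Q ℓ) δ T)) +
      (3 * (T ^ α * Real.exp (-g * T)) + T ^ α * Real.exp (-(2 * κ) * T)) * J) atTop
      (𝓝 (ε * B)) := by
    have h1 : Tendsto (fun T : ℝ => ∑ ℓ, ε * (A * (T ^ α * shellIntegral Er d (Q ℓ) δ T))) atTop
        (𝓝 (∑ ℓ, ε * (A * c' ℓ))) :=
      tendsto_finsetSum _ fun ℓ _ => ((hδlim ℓ).const_mul A).const_mul ε
    have h2 := tendsto_rpow_mul_exp_neg_mul_atTop_nhds_zero α g hg0'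
    have h3 := tendsto_rpow_mul_exp_neg_mul_atTop_nhds_zero α (2 * κ) (by positivity)
    have h4 := h1.add (((h2.const_mul 3).add h3).mul_const J)
    rw [mul_zero, zero_add, zero_mul, add_zero, ← Finset.mul_sum] at h4
    exact h4
  have hfinal : ∀ᶠ T : ℝ in atTop, dist (((T ^ α : ℝ) : ℂ) * charFunUnnormalized Pi H φ T k t)
      (∑ ℓ, (c' ℓ : ℂ) * sphereNumerator Hf ψ Φ (Q ℓ) k t) < η := by
    filter_upwards [hTloc, herr.eventually_lt_const hεB,
      hmain.eventually (Metric.ball_mem_nhds _ (half_pos hη)), eventually_gt_atTop 0]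
      with T h1 h2 h3 hT
    have h4 := hSA.norm_charFunUnnormalized_sub_sum_le hd hHf hφ ht k hε0 hT hδdisj hκ h1
    have hTα : 0 < T ^ α := Real.rpow_pos_of_pos hT α
    have h5 : dist (((T ^ α : ℝ) : ℂ) * charFunUnnormalized Pi H φ T k t)
        (∑ ℓ, ((T ^ α * shellIntegral Er d (Q ℓ) δ T : ℝ) : ℂ) *
          sphereNumerator Hf ψ Φ (Q ℓ) k t) < η / 2 := by
      refine lt_of_le_of_lt ?_ h2
      have e : ∑ ℓ, ((T ^ α * shellIntegral Er d (Q ℓ) δ T : ℝ) : ℂ) *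
          sphereNumerator Hf ψ Φ (Q ℓ) k t = ((T ^ α : ℝ) : ℂ) *
          ∑ ℓ, (shellIntegral Er d (Q ℓ) δ T : ℂ) * sphereNumerator Hf ψ Φ (Q ℓ) k t := by
        rw [Finset.mul_sum]
        exact Finset.sum_congr rfl fun ℓ _ => by push_cast; ring
      rw [dist_eq_norm, e, ← mul_sub, norm_mul, Complex.norm_real, Real.norm_of_nonneg hTα.le]
      refine (mul_le_mul_of_nonneg_left h4 hTα.le).trans (le_of_eq ?_)
      rw [mul_add, Finset.mul_sum]
      congr 1
      · exact Finset.sum_congr rfl fun ℓ _ => by ring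
      · ring
    have h6 := dist_triangle (((T ^ α : ℝ) : ℂ) * charFunUnnormalized Pi H φ T k t)
      (∑ ℓ, ((T ^ α * shellIntegral Er d (Q ℓ) δ T : ℝ) : ℂ) *
          sphereNumerator Hf ψ Φ (Q ℓ) k t) (∑ ℓ, (c' ℓ : ℂ) * sphereNumerator Hf ψ Φ (Q ℓ) k t)
    have h7 : dist (∑ ℓ, ((T ^ α * shellIntegral Er d (Q ℓ) δ T : ℝ) : ℂ) *
          sphereNumerator Hf ψ Φ (Q ℓ) k t) (∑ ℓ, (c' ℓ : ℂ) * sphereNumerator Hf ψ Φ (Q ℓ) k t)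
          < η / 2 := h3
    linarith
  obtain ⟨N, hN⟩ := eventually_atTop.1 hfinal
  exact ⟨N, fun T hT => hN T hT.le⟩

end StandingAssumptions

end Asymptotics

/-! ### Limits of the normalized characteristic function -/

section Ratio

variable {d : ℕ} {F : Type*} [NormedAddCommGroup F] [InnerProductSpace ℂ F] [CompleteSpace F]
  {K : Type*} [NormedAddCommGroup K] [InnerProductSpace ℂ K] [CompleteSpace K]
  {Pi : K ≃ₗᵢ[ℂ] Lp F 2 (volume : Measure (Mom d))} {H : K →ₗ.[ℂ] K}
  {Hf : Mom d → F →ₗ.[ℂ] F} {Er : ℝ → ℝ} {L : ℕ} {Q : Fin (L + 1) → ℝ} {n : Fin (L + 1) → ℕ}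
  {Δ : Fin (L + 1) → Set ℝ} {ψ Φ : Mom d → F} {φ : K}

lemma sphereNumerator_zero (k : Mom d) (t : ℝ) : sphereNumerator Hf ψ Φ 0 k t =
    ((volume : Measure (Mom d)).toSphere.real Set.univ : ℂ) *
      (((‖(inner ℂ (Φ 0) (ψ 0) : ℂ)‖ ^ 2 : ℝ) : ℂ) * groundExpectation Hf ψ 0 k t) := by
  simp only [sphereNumerator, zero_smul, integral_const]
  rw [Complex.real_smul]

omit [CompleteSpace F] in
lemma sphereDenominator_zero : sphereDenominator ψ Φ 0 =
    (volume : Measure (Mom d)).toSphere.real Set.univ * ‖(inner ℂ (Φ 0) (ψ 0) : ℂ)‖ ^ 2 := by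
  simp only [sphereDenominator, zero_smul, integral_const, smul_eq_mul]

lemma toSphere_real_univ_pos (hd : 1 ≤ d) :
    0 < (volume : Measure (Mom d)).toSphere.real Set.univ := by
  have : Nonempty (Fin d) := ⟨⟨0, hd⟩⟩
  rw [measureReal_def, ENNReal.toReal_pos_iff]
  exact ⟨Measure.measure_univ_pos.2 (Measure.toSphere_ne_zero _), measure_lt_top _ _⟩

namespace StandingAssumptions

variable (hSA : StandingAssumptions Hf Er Q n Δ ψ)
include hSA

/-- At zero momentum transfer the numerator is the denominator, because the minimal energy is
zero. -/
lemma sphereNumerator_zero_momentum (hd : 1 ≤ d) (ℓ : Fin (L + 1)) {t : ℝ} (ht : 0 ≤ t) :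
    sphereNumerator Hf ψ Φ (Q ℓ) 0 t = (sphereDenominator ψ Φ (Q ℓ) : ℂ) := by
  have := hSA.nontrivial hd
  rw [sphereNumerator, sphereDenominator, ← integral_complex_ofReal]
  refine integral_congr_ae (Eventually.of_forall fun u => ?_)
  have hu : ‖Q ℓ • (u : Mom d)‖ = Q ℓ := by
    rw [norm_smul, mem_sphere_zero_iff_norm.1 u.2, mul_one, Real.norm_of_nonneg (hSA.Q_nonneg' ℓ)]
  have hloc := hSA.isLocalGroundState hu
  have h1 : groundExpectation Hf ψ (Q ℓ • (u : Mom d)) 0 t = 1 := by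
    have hψ : expNeg (Hf (Q ℓ • (u : Mom d))) t (ψ (Q ℓ • (u : Mom d))) =
        ψ (Q ℓ • (u : Mom d)) := by
      rcases ht.eq_or_lt with rfl | ht
      · rw [expNeg, if_pos rfl]; rfl
      · rw [expNeg_apply_eigenvector hSA.positive ht hloc.eigenvector.self_of_nhds,
          hSA.infSpec_eq_zero hu]
        simp
    rw [groundExpectation, add_zero, hψ, inner_self_eq_norm_sq_to_K, hloc.norm_eq.self_of_nhds]
    simp
  simp only
  rw [h1, mul_one]

omit [CompleteSpace K] in
lemma sphereDenominator_pos (hd : 1 ≤ d) (hφ : AdmissibleVector Pi Hf Q Δ ψ φ Φ)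
    (ℓ : Fin (L + 1)) : 0 < sphereDenominator ψ Φ (Q ℓ) := by
  have hne : Nonempty (Fin d) := ⟨⟨0, hd⟩⟩
  have hu (u : Metric.sphere (0 : Mom d) 1) : ‖Q ℓ • (u : Mom d)‖ = Q ℓ := by
    rw [norm_smul, mem_sphere_zero_iff_norm.1 u.2, mul_one, Real.norm_of_nonneg (hSA.Q_nonneg' ℓ)]
  have hpos (u : Metric.sphere (0 : Mom d) 1) :
      0 < ‖(inner ℂ (Φ (Q ℓ • (u : Mom d))) (ψ (Q ℓ • (u : Mom d))) : ℂ)‖ ^ 2 :=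
    pow_pos (norm_pos_iff.2 (hφ.overlap_ne_zero ℓ _ (hu u))) 2
  have hcont : Continuous fun u : Metric.sphere (0 : Mom d) 1 =>
      ‖(inner ℂ (Φ (Q ℓ • (u : Mom d))) (ψ (Q ℓ • (u : Mom d))) : ℂ)‖ ^ 2 := by
    refine Continuous.pow (continuous_iff_continuousAt.2 fun u => ?_) 2
    exact (hSA.overlap_continuousAt hφ (hu u)).comp
      (f := fun u : Metric.sphere (0 : Mom d) 1 => Q ℓ • (u : Mom d)) (by fun_prop)
  obtain ⟨u₀⟩ : Nonempty (Metric.sphere (0 : Mom d) 1) := by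
    obtain ⟨P, hP⟩ := exists_mom_norm_eq hd zero_le_one
    exact ⟨P, by simpa using hP⟩
  exact hcont.integral_pos_of_hasCompactSupport_nonneg_nonzero
    (HasCompactSupport.of_compactSpace _) (fun u => (hpos u).le) (hpos u₀).ne'

/-- The limit of the normalized characteristic function, with universal weights: the average over
those spheres of minima whose contribution decays most slowly. -/
lemma exists_tendsto_charFunNormalized (hd : 1 ≤ d) (hHf : IsDirectIntegral Pi H Hf) :
    ∃ c : Fin (L + 1) → ℝ, (∀ ℓ, 0 < c ℓ) ∧
      ∀ (φ : K) (Φ : Mom d → F), AdmissibleVector Pi Hf Q Δ ψ φ Φ →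
        ∀ (k : Mom d) (t : ℝ), 0 ≤ t → ∀ S : Finset (Fin (L + 1)), S.Nonempty → ∀ α : ℝ,
          (∀ ℓ ∈ S, shellExponent (Q ℓ) d (n ℓ) = α) →
          (∀ ℓ ∉ S, α < shellExponent (Q ℓ) d (n ℓ)) →
          Tendsto (fun T : ℝ => charFunNormalized Pi H φ T k t) atTop
            (𝓝 (sphereAverage Hf ψ Φ Q c S k t)) := by
  obtain ⟨c, hc, hlim⟩ := hSA.exists_tendsto_charFunUnnormalized hd hHf
  refine ⟨c, hc, fun φ Φ hφ k t ht S hS α hSα hSα' => ?_⟩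
  have hα : ∀ ℓ, α ≤ shellExponent (Q ℓ) d (n ℓ) := fun ℓ => by
    by_cases h : ℓ ∈ S
    exacts [(hSα ℓ h).ge, (hSα' ℓ h).le]
  have hfilter : Finset.univ.filter (fun ℓ => shellExponent (Q ℓ) d (n ℓ) = α) = S := by
    ext ℓ
    simp only [Finset.mem_filter, Finset.mem_univ, true_and]
    exact ⟨fun h => by_contra fun h' => (hSα' ℓ h').ne' h, hSα ℓ⟩
  have h1 := hlim φ Φ hφ k t ht α hα
  have h2 := hlim φ Φ hφ 0 t ht α hα
  rw [hfilter] at h1 h2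
  have hden : ∑ ℓ ∈ S, (c ℓ : ℂ) * sphereNumerator Hf ψ Φ (Q ℓ) 0 t =
      ((∑ ℓ ∈ S, c ℓ * sphereDenominator ψ Φ (Q ℓ) : ℝ) : ℂ) := by
    rw [Complex.ofReal_sum]
    refine Finset.sum_congr rfl fun ℓ _ => ?_
    rw [hSA.sphereNumerator_zero_momentum hd ℓ ht, Complex.ofReal_mul]
  have hpos : 0 < ∑ ℓ ∈ S, c ℓ * sphereDenominator ψ Φ (Q ℓ) :=
    Finset.sum_pos (fun ℓ _ => mul_pos (hc ℓ) (hSA.sphereDenominator_pos hd hφ ℓ)) hS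
  rw [hden] at h2
  refine (h1.div h2 (by exact_mod_cast hpos.ne')).congr' ?_
  filter_upwards [eventually_gt_atTop 0] with T hT
  have hTα : ((T ^ α : ℝ) : ℂ) ≠ 0 := by exact_mod_cast (Real.rpow_pos_of_pos hT α).ne'
  exact mul_div_mul_left _ _ hTα

omit [CompleteSpace K] in
/-- The average over the sphere of radius zero is the expectation at the origin. -/
lemma sphereAverage_singleton_zero (hd : 1 ≤ d) (hφ : AdmissibleVector Pi Hf Q Δ ψ φ Φ)
    (hQ : Q 0 = 0) {c : Fin (L + 1) → ℝ} (hc : 0 < c 0) (k : Mom d) (t : ℝ) :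
    sphereAverage Hf ψ Φ Q c {0} k t = groundExpectation Hf ψ 0 k t := by
  have hpos : 0 < c 0 * sphereDenominator ψ Φ (Q 0) :=
    mul_pos hc (hSA.sphereDenominator_pos hd hφ 0)
  rw [sphereAverage, Finset.sum_singleton, Finset.sum_singleton,
    div_eq_iff (by exact_mod_cast hpos.ne'), hQ, sphereNumerator_zero, sphereDenominator_zero]
  push_cast
  ring

omit hSA [CompleteSpace K] in
lemma sphereAverage_insert_zero (hQ : Q 0 = 0) (c : Fin (L + 1) → ℝ) {S : Finset (Fin (L + 1))}
    (hS : 0 ∉ S) (k : Mom d) (t : ℝ) :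
    sphereAverage Hf ψ Φ Q c (insert 0 S) k t =
      originSphereAverage Hf ψ Φ Q
        (Function.update c 0 (c 0 * (volume : Measure (Mom d)).toSphere.real Set.univ)) S k t := by
  have hne : ∀ ℓ ∈ S, ℓ ≠ 0 := fun ℓ h h0 => hS (h0 ▸ h)
  rw [sphereAverage, originSphereAverage, Finset.sum_insert hS, Finset.sum_insert hS,
    Function.update_self, hQ, sphereNumerator_zero, sphereDenominator_zero]
  congr 1
  · congr 1
    · push_cast; ring
    · exact Finset.sum_congr rfl fun ℓ h => by rw [Function.update_of_ne (hne ℓ h)]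
  · congr 1
    congr 1
    · ring
    · exact Finset.sum_congr rfl fun ℓ h => by rw [Function.update_of_ne (hne ℓ h)]

end StandingAssumptions

end Ratio

theorem mainTheorem4 {d : ℕ} (hd : 1 ≤ d)
    {F : Type*} [NormedAddCommGroup F] [InnerProductSpace ℂ F] [CompleteSpace F]
    {K : Type*} [NormedAddCommGroup K] [InnerProductSpace ℂ K] [CompleteSpace K]
    (Pi : K ≃ₗᵢ[ℂ] Lp F 2 (volume : Measure (Mom d)))
    (H : K →ₗ.[ℂ] K) (hH : IsSelfAdjoint H)
    (Hf : Mom d → F →ₗ.[ℂ] F) (hHf : IsDirectIntegral Pi H Hf)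
    (Er : ℝ → ℝ) {L : ℕ} (Q : Fin (L + 1) → ℝ) (n : Fin (L + 1) → ℕ)
    (Δ : Fin (L + 1) → Set ℝ) (ψ : Mom d → F)
    (hSA : StandingAssumptions Hf Er Q n Δ ψ) :
    -- the origin is the only global minimum
    (Q 0 = 0 → L = 0 →
      ∀ (φ : K) (Φ : Mom d → F), AdmissibleVector Pi Hf Q Δ ψ φ Φ →
        ∀ (k : Mom d) (t : ℝ), 0 ≤ t →
          Tendsto (fun T : ℝ => charFunNormalized Pi H φ T k t) atTop
            (𝓝 (groundExpectation Hf ψ 0 k t))) ∧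
    -- the origin is a global minimum and there are others
    (Q 0 = 0 → 0 < L →
      ∀ m : ℕ, m = (Finset.univ.filter (fun ℓ : Fin (L + 1) => ℓ ≠ 0)).sup n →
        -- case (a)
        ((n 0 : ℝ) / d < m →
          ∃ C : Fin (L + 1) → ℝ, (∀ ℓ, 0 < C ℓ) ∧
            ∀ (φ : K) (Φ : Mom d → F), AdmissibleVector Pi Hf Q Δ ψ φ Φ →
              ∀ (k : Mom d) (t : ℝ), 0 ≤ t →
                Tendsto (fun T : ℝ => charFunNormalized Pi H φ T k t) atTop
                  (𝓝 (sphereAverage Hf ψ Φ Q C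
                    (Finset.univ.filter (fun ℓ => ℓ ≠ 0 ∧ n ℓ = m)) k t))) ∧
        -- case (b)
        ((m : ℝ) = (n 0 : ℝ) / d →
          ∃ c : Fin (L + 1) → ℝ, (∀ ℓ, 0 < c ℓ) ∧
            ∀ (φ : K) (Φ : Mom d → F), AdmissibleVector Pi Hf Q Δ ψ φ Φ →
              ∀ (k : Mom d) (t : ℝ), 0 ≤ t →
                Tendsto (fun T : ℝ => charFunNormalized Pi H φ T k t) atTop
                  (𝓝 (originSphereAverage Hf ψ Φ Q c
                    (Finset.univ.filter (fun ℓ => ℓ ≠ 0 ∧ n ℓ = m)) k t))) ∧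
        -- case (c)
        ((m : ℝ) < (n 0 : ℝ) / d →
          ∀ (φ : K) (Φ : Mom d → F), AdmissibleVector Pi Hf Q Δ ψ φ Φ →
            ∀ (k : Mom d) (t : ℝ), 0 ≤ t →
              Tendsto (fun T : ℝ => charFunNormalized Pi H φ T k t) atTop
                (𝓝 (groundExpectation Hf ψ 0 k t)))) ∧
    -- the origin is not a global minimum
    (0 < Q 0 →
      ∃ C : Fin (L + 1) → ℝ, (∀ ℓ, 0 < C ℓ) ∧
        ∀ (φ : K) (Φ : Mom d → F), AdmissibleVector Pi Hf Q Δ ψ φ Φ →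
          ∀ (k : Mom d) (t : ℝ), 0 ≤ t →
            Tendsto (fun T : ℝ => charFunNormalized Pi H φ T k t) atTop
              (𝓝 (sphereAverage Hf ψ Φ Q C
                (Finset.univ.filter (fun ℓ => n ℓ = Finset.univ.sup n)) k t))) := by
  obtain ⟨c, hc, hlim⟩ := hSA.exists_tendsto_charFunNormalized hd hHf
  have hd0 : (0 : ℝ) < d := by exact_mod_cast hd
  have hn0 (ℓ : Fin (L + 1)) : (0 : ℝ) < n ℓ := by
    have := hSA.two_le_n ℓ
    exact_mod_cast (by omega : 0 < n ℓ)
  have hexp0 (h : Q 0 = 0) : shellExponent (Q 0) d (n 0) = (d : ℝ) / n 0 := if_pos h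
  have hexp (ℓ : Fin (L + 1)) (h : Q ℓ ≠ 0) : shellExponent (Q ℓ) d (n ℓ) = 1 / n ℓ := if_neg h
  have hQne (h : Q 0 = 0) (ℓ : Fin (L + 1)) (hℓ : ℓ ≠ 0) : Q ℓ ≠ 0 := fun h' =>
    hℓ (hSA.Q_strictMono.injective (h'.trans h.symm))
  have hanti {a b : ℕ} (ha : (0 : ℝ) < a) (hab : a < b) : (1 : ℝ) / b < 1 / a :=
    one_div_lt_one_div_of_lt ha (by exact_mod_cast hab)
  refine ⟨fun hQ hL φ Φ hφ k t ht => ?_, fun hQ hL m hm => ?_, fun hQ => ?_⟩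
  · subst hL
    rw [← hSA.sphereAverage_singleton_zero hd hφ hQ (hc 0) k t]
    refine hlim φ Φ hφ k t ht {0} (by simp) (shellExponent (Q 0) d (n 0)) (fun ℓ hℓ => ?_)
      (fun ℓ hℓ => ?_)
    · rw [Finset.mem_singleton.1 hℓ]
    · exact absurd (Finset.mem_singleton.2 (Fin.ext (by omega))) hℓ
  · obtain ⟨ℓ₁, hℓ₁, hℓ₁m⟩ : ∃ ℓ ∈ Finset.univ.filter (fun ℓ : Fin (L + 1) => ℓ ≠ 0), m = n ℓ := by
      rw [hm]
      have hlast : Fin.last L ≠ 0 := fun h => hL.ne' (congrArg Fin.val h)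
      exact Finset.exists_mem_eq_sup _
        ⟨Fin.last L, Finset.mem_filter.2 ⟨Finset.mem_univ _, hlast⟩⟩ n
    have hℓ₁0 : ℓ₁ ≠ 0 := by simpa using hℓ₁
    have hm0 : (0 : ℝ) < m := hℓ₁m ▸ hn0 ℓ₁
    have hle (ℓ : Fin (L + 1)) (hℓ : ℓ ≠ 0) : n ℓ ≤ m :=
      hm ▸ Finset.le_sup (f := n) (by simpa using hℓ)
    -- Comparing `m` with `n 0 / d` is comparing the decay rates `1 / m` and `d / n 0`.
    have hcmp : (n 0 : ℝ) / d = 1 / ((d : ℝ) / n 0) := by rw [one_div_div]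
    have hdn : (0 : ℝ) < (d : ℝ) / n 0 := div_pos hd0 (hn0 0)
    have hne_lt (ℓ : Fin (L + 1)) (hℓ : ℓ ≠ 0) (hnm : n ℓ ≠ m) :
        (1 : ℝ) / m < shellExponent (Q ℓ) d (n ℓ) := by
      rw [hexp ℓ (hQne hQ ℓ hℓ)]
      exact hanti (hn0 ℓ) (lt_of_le_of_ne (hle ℓ hℓ) hnm)
    refine ⟨fun hlt => ?_, fun heq => ?_, fun hlt φ Φ hφ k t ht => ?_⟩
    · refine ⟨c, hc, fun φ Φ hφ k t ht => ?_⟩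
      have hlt' : (1 : ℝ) / m < (d : ℝ) / n 0 := by
        rw [hcmp] at hlt
        exact (one_div_lt hdn hm0).1 hlt
      refine hlim φ Φ hφ k t ht _ ⟨ℓ₁, by simp [hℓ₁0, hℓ₁m]⟩ (1 / m) (fun ℓ hℓ => ?_)
        (fun ℓ hℓ => ?_)
      · obtain ⟨h0, h1⟩ := (Finset.mem_filter.1 hℓ).2
        rw [hexp ℓ (hQne hQ ℓ h0), h1]
      · by_cases h0 : ℓ = 0
        · rw [h0, hexp0 hQ]; exact hlt'
        · exact hne_lt ℓ h0 fun h1 => hℓ (by simp [h0, h1])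
    · have heq' : (1 : ℝ) / m = (d : ℝ) / n 0 := by rw [heq, one_div_div]
      -- The origin counts as a sphere of radius zero: its weight carries the area of the sphere.
      refine ⟨Function.update c 0 (c 0 * (volume : Measure (Mom d)).toSphere.real Set.univ),
        fun ℓ => ?_, fun φ Φ hφ k t ht => ?_⟩
      · by_cases h0 : ℓ = 0
        · rw [h0, Function.update_self]
          exact mul_pos (hc 0) (toSphere_real_univ_pos hd)
        · rw [Function.update_of_ne h0]
          exact hc ℓ
      · rw [← StandingAssumptions.sphereAverage_insert_zero hQ c (by simp) k t]
        refine hlim φ Φ hφ k t ht _ (Finset.insert_nonempty _ _) (1 / m) (fun ℓ hℓ => ?_)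
          (fun ℓ hℓ => ?_)
        · rcases Finset.mem_insert.1 hℓ with h0 | hℓ
          · rw [h0, hexp0 hQ, heq']
          · obtain ⟨h0, h1⟩ := (Finset.mem_filter.1 hℓ).2
            rw [hexp ℓ (hQne hQ ℓ h0), h1]
        · rw [Finset.mem_insert, not_or] at hℓ
          exact hne_lt ℓ hℓ.1 fun h1 => hℓ.2 (by simp [hℓ.1, h1])
    · rw [← hSA.sphereAverage_singleton_zero hd hφ hQ (hc 0) k t]
      have hlt' : (d : ℝ) / n 0 < 1 / m := by
        rw [hcmp] at hlt
        exact (lt_one_div hm0 hdn).1 hlt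
      refine hlim φ Φ hφ k t ht {0} (by simp) ((d : ℝ) / n 0) (fun ℓ hℓ => ?_) (fun ℓ hℓ => ?_)
      · rw [Finset.mem_singleton.1 hℓ, hexp0 hQ]
      · have h0 : ℓ ≠ 0 := fun h => hℓ (Finset.mem_singleton.2 h)
        rw [hexp ℓ (hQne hQ ℓ h0)]
        exact hlt'.trans_le (one_div_le_one_div_of_le (hn0 ℓ) (by exact_mod_cast hle ℓ h0))
  · refine ⟨c, hc, fun φ Φ hφ k t ht => ?_⟩
    have hQpos (ℓ : Fin (L + 1)) : Q ℓ ≠ 0 :=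
      (hQ.trans_le (hSA.Q_strictMono.monotone (Fin.zero_le ℓ))).ne'
    obtain ⟨ℓ₁, -, hℓ₁⟩ := Finset.exists_mem_eq_sup Finset.univ Finset.univ_nonempty n
    refine hlim φ Φ hφ k t ht _ ⟨ℓ₁, by simp [hℓ₁]⟩ (1 / (Finset.univ.sup n : ℕ))
      (fun ℓ hℓ => ?_) (fun ℓ hℓ => ?_)
    · rw [hexp ℓ (hQpos ℓ), (Finset.mem_filter.1 hℓ).2]
    · rw [hexp ℓ (hQpos ℓ)]
      exact hanti (hn0 ℓ) (lt_of_le_of_ne (Finset.le_sup (Finset.mem_univ ℓ)) fun h =>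
        hℓ (by simp [h]))
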